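/- **Setting.** Let $S^1=\mathbb R/10\mathbb Z$ (coordinate $0\le\theta<10$), $I=[0,1]$ and $F=[-1,1]\times S^1$ with coordinates $(r,\theta)$; call $r$ the radius. Let $W_s$ and $\bar W_s$ be two copies of $F\times[-1,1]$ with coordinates $(r,\theta,z)$, and let $W$ be their union with the top of $W_s$ identified with the bottom of $\bar W_s$. Let $\mathcal W$ be the oriented 1-foliation of $W$ generated by $\partial_\theta+(r^2+z^6)\partial_z$ on $W_s$ and by $-\partial_\theta+(r^2+z^6)\partial_z$ on $\bar W_s$, and let $\alpha_-,\alpha_+:F\to W$ send $F$ onto the bottom and the top of $W$. Let $D=D_s\cup\bar D_s\subset F$, where $D_s$ (resp. $\bar D_s$) is the set of $(r,\theta)$ for which $\sigma(r,\theta)$ as given by the first (resp. second) formula lies in $W_s$ (resp. $\bar W_s$): $$\sigma(r,\theta)=(r-\tfrac14r^2-2(\theta-2)^2,\,6,\,2-\theta)\in W_s,\qquad \sigma(r,\theta)=(r-\tfrac14r^2-2(\theta-8)^2,\,4,\,\theta-8)\in\bar W_s .$$ **Self-insertion.** Choose an attaching map $\alpha:N_{F\times I}\to N_W$, that is, a homeomorphism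 between open neighborhoods of $\partial(F\times I)$ and $\partial W$ that identifies the foliation by the fibers $\{p\}\times I$ with $\mathcal W$ and satisfies $\alpha(p,0)=\alpha_-(p)$ and $\alpha(p,1)=\alpha_+(p)$. Choose an extension of $\sigma$ to an embedding $\sigma:D\times I\to W$ with $\sigma(q,0)=\sigma(q)$ that takes fibers, with their orientation, into leaves of $\mathcal W$ and whose image is disjoint from $\alpha_\pm(F)$ and from the closure of $\alpha((D\times I)\cap N_{F\times I})$. Let $\hat W$ be $W\setminus\sigma((D\times I)\setminus N_{F\times I})$ with $\alpha(q,t)$ glued to $\sigma(q,t)$ for all $(q,t)\in(D\times I)\cap N_{F\times I}$, with the foliation $\hat{\mathcal W}$ induced by $\mathcal W$. Let $\tilde W\subset\hat W$ be obtained by cutting off the stair-steps at the bottom and the top: every point removed lies on a piece of a leaf of $\mathcal W$ inside $W\setminus\sigma((D\times I)\setminus N_{F\times I})$ that either runs from an external entry point $\alpha_-(p)$, $p\in F\setminus D$, to its first point in $\tilde W$, or runs from its last point in $\tilde W$ to an external exit point $\alpha_+(p)$, $p\in F\setminus D$. Let $\tilde{\mathcal W}$ be the restriction of $\hat{\mathcal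 W}$ to $\tilde W$. The cut is chosen such that $\tilde{\mathcal W}$ is a flow bordism: $\tilde W$ is compact, connected and Hausdorff, is locally modelled with its oriented foliation on open sets of $\{(x,y)\in\mathbb R^2: x\ge0\}\times[0,1]$ foliated by the upward vertical fibers, and each leaf meeting $x=0$ in such a chart is a line segment. The points at the ends $0$ and $1$ of the fibers in such charts form the entry region $\tilde F_-$ and the exit region $\tilde F_+$. It is also chosen to have matched ends: there are a space $\tilde F$ (the base) and homeomorphisms $\tilde\alpha_\pm:\tilde F\to\tilde F_\pm$ such that $x=y$ whenever $\tilde\alpha_+(x)$ and $\tilde\alpha_-(y)$ lie on one leaf. Leaves are the connected components in the leaf topology, and a leaf is infinite if it is not compact in that topology. The stopped set $S\subset\tilde F$ consists of all $x$ such that $\tilde\alpha_-(x)$ is an endpoint of an infinite leaf of $\tilde{\mathcal W}$. **Proposition.** For all such choices, the self-inserted plug $\tilde{\mathcal W}$ stops content, that is, $S$ has non-empty interior in $\tilde F$. Moreover, every base point with radius in $(-\frac1{20},0)$ lies in $S$, in the following sense: if $p\in F$ has radius $-\frac1{20}<r<0$, then every $x\in\tilde F$ for which $\tilde\alpha_-(x)$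 lies on the leaf of $\hat{\mathcal W}$ through $\alpha_-(p)$ belongs to $S$; and if moreover $p\notin D$, such an $x$ exists. -/

import Mathlib

open Set Topology

noncomputable section

namespace AnalyticPlug

/-! Oriented 1-foliations -/

/-- An oriented 1-foliation, recorded through its forward leaf paths: `IsPath γ a b` says that
the restriction of `γ` to `[a, b]` is a continuous path that stays in one leaf and moves (weakly)
in the positive direction of that leaf.  The structure is only a container; the foliations used
below are the explicit ones `verticalFoliation`, `wilsonFoliation`, `SelfInsertion.hatFoliation`
and restrictions of the latter. -/
structure LeafPaths (X : Type*) where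
  IsPath : (ℝ → X) → ℝ → ℝ → Prop

/-- The foliation of `T × [0,1]` by the fibers `{p} × [0,1]`, oriented upwards. -/
def verticalFoliation (T : Type*) [TopologicalSpace T] : LeafPaths (T × unitInterval) where
  IsPath γ a b := a ≤ b ∧ ContinuousOn γ (Icc a b) ∧
    (∀ t ∈ Icc a b, (γ t).1 = (γ a).1) ∧ MonotoneOn (fun t => (γ t).2) (Icc a b)

namespace LeafPaths

variable {X : Type*} (𝓕 : LeafPaths X)

/-- The foliation induced on a subset: the leaf paths that stay inside it. -/
def restrict (P : Set X) : LeafPaths P where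
  IsPath γ a b := 𝓕.IsPath (fun t => (γ t : X)) a b

/-- The leaf topology: a set is open when its preimage under every leaf path is open. -/
@[reducible] def leafTopology : TopologicalSpace X :=
  ⨆ q : {q : (ℝ → X) × ℝ × ℝ // 𝓕.IsPath q.1 q.2.1 q.2.2},
    TopologicalSpace.coinduced (fun t : Icc q.1.2.1 q.1.2.2 => q.1.1 t) inferInstance

/-- The leaf through `x`: its connected component in the leaf topology. -/
def leaf (x : X) : Set X := @connectedComponent X 𝓕.leafTopology x

/-- The leaf through `x` is infinite, i.e. it is not compact (as a leaf, in the leaf topology). -/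
def InfiniteLeaf (x : X) : Prop := ¬ @IsCompact X 𝓕.leafTopology (𝓕.leaf x)

end LeafPaths

/-! Flow bordisms and plugs of dimension 3 -/

/-- The half plane `{(x, y) | 0 ≤ x}`. -/
abbrev HalfPlane : Type := {p : ℝ × ℝ // 0 ≤ p.1}

namespace LeafPaths

variable {X : Type*} [TopologicalSpace X] (𝓕 : LeafPaths X)

/-- A foliated chart, with values in `HalfPlane × [0,1]` foliated by vertical fibers.  The edge
`x = 0` of the half plane models parallel boundary, the two ends of `[0,1]` model transverse
boundary, and the points where both happen model corner separation. -/
def IsFlowChart (φ : OpenPartialHomeomorph X (HalfPlane × unitInterval)) : Prop :=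
  ∀ (γ : ℝ → X) (a b : ℝ), (∀ t ∈ Icc a b, γ t ∈ φ.source) →
    (𝓕.IsPath γ a b ↔ (verticalFoliation HalfPlane).IsPath (fun t => φ (γ t)) a b)

/-- The entry region `F₋` (transverse boundary oriented inward, with its corner points). -/
def entryRegion : Set X :=
  {x | ∃ φ : OpenPartialHomeomorph X (HalfPlane × unitInterval),
    𝓕.IsFlowChart φ ∧ x ∈ φ.source ∧ (φ x).2 = 0}

/-- The exit region `F₊` (transverse boundary oriented outward, with its corner points). -/
def exitRegion : Set X :=
  {x | ∃ φ : OpenPartialHomeomorph X (HalfPlane × unitInterval),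
    𝓕.IsFlowChart φ ∧ x ∈ φ.source ∧ (φ x).2 = 1}

/-- The parallel boundary, with its corner points. -/
def parallelBoundary : Set X :=
  {x | ∃ φ : OpenPartialHomeomorph X (HalfPlane × unitInterval),
    𝓕.IsFlowChart φ ∧ x ∈ φ.source ∧ (φ x).1.1.1 = 0}

/-- A (3-dimensional, topological) flow bordism: an oriented 1-foliation of a compact connected
manifold with corners whose boundary is transverse, parallel or corner separation, such that the
leaves in the parallel boundary are line segments. -/
structure IsFlowBordism : Prop where
  compact : CompactSpace X
  connected : ConnectedSpace X
  hausdorff : T2Space X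
  exists_chart : ∀ x : X, ∃ φ : OpenPartialHomeomorph X (HalfPlane × unitInterval),
    𝓕.IsFlowChart φ ∧ x ∈ φ.source
  parallel_segment : ∀ x ∈ 𝓕.parallelBoundary, ∃ γ : ℝ → X,
    𝓕.IsPath γ 0 1 ∧ InjOn γ (Icc 0 1) ∧ γ '' Icc 0 1 = 𝓕.leaf x

/-- Matched ends with base `B`: homeomorphisms `α₋`, `α₊` of `B` with the entry and the exit
region such that the two ends of a leaf always come from the same point of `B`. -/
structure MatchedEnds (B : Type*) [TopologicalSpace B] where
  entry : B → X
  exit : B → X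
  entry_isEmbedding : IsEmbedding entry
  exit_isEmbedding : IsEmbedding exit
  range_entry : range entry = 𝓕.entryRegion
  range_exit : range exit = 𝓕.exitRegion
  matched : ∀ p q : B, exit p ∈ 𝓕.leaf (entry q) → p = q

variable {𝓕}

/-- The stopped set: the base points whose entry point is the endpoint of an infinite leaf. -/
def MatchedEnds.stoppedSet {B : Type*} [TopologicalSpace B] (M : 𝓕.MatchedEnds B) : Set B :=
  {x | 𝓕.InfiniteLeaf (M.entry x)}

/-- A plug stops content if its stopped set has non-empty interior. -/
def MatchedEnds.StopsContent {B : Type*} [TopologicalSpace B] (M : 𝓕.MatchedEnds B) : Prop :=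
  (interior M.stoppedSet).Nonempty

end LeafPaths

/-! The plug that is inserted into itself -/

instance tenPos : Fact ((0 : ℝ) < 10) := ⟨by norm_num⟩

/-- The base `F = [-1,1] × S¹`, where `S¹ = ℝ / 10ℤ`. -/
abbrev Base : Type := Icc (-1 : ℝ) 1 × AddCircle (10 : ℝ)

/-- The support `W = W_s ∪ W̄_s`.  Both halves are `F × [-1,1]` and the top of `W_s` is glued to
the bottom of `W̄_s`; so `W` is `F × [-1,3]`, the point of `W_s` of height `z` has height `z`,
and the point of `W̄_s` of height `z` has height `z + 2`. -/
abbrev Support : Type := Base × Icc (-1 : ℝ) 3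

/-- The coordinate `r` on the base. -/
def radius (p : Base) : ℝ := p.1

/-- The coordinate `0 ≤ θ < 10` on the base. -/
def angle (p : Base) : ℝ := (AddCircle.equivIco (10 : ℝ) 0 p.2 : ℝ)

/-- `α₋ : F → W`, onto the bottom of `W`. -/
def bottom (p : Base) : Support := (p, ⟨-1, by norm_num, by norm_num⟩)

/-- `α₊ : F → W`, onto the top of `W`. -/
def top (p : Base) : Support := (p, ⟨3, by norm_num, by norm_num⟩)

/-- The coordinate `z ∈ [-1,1]` of `W_s` or of `W̄_s`, as a function of the height in `W`. -/
def localHeight (h : ℝ) : ℝ := if h ≤ 1 then h else h - 2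

/-- `t ↦ (r, ϑ t, ζ t)` is on `[a, b]` an integral curve of `∂_θ + (r² + z⁶) ∂_z` while it is in
`W_s` (height below `1`) and of `-∂_θ + (r² + z⁶) ∂_z` while it is in `W̄_s` (height above `1`).
It can have height `1` at one time only. -/
def IsIntegralCurve (r : ℝ) (ϑ ζ : ℝ → ℝ) (a b : ℝ) : Prop :=
  ContinuousOn ϑ (Icc a b) ∧ ContinuousOn ζ (Icc a b) ∧
  (∀ t ∈ Ioo a b, HasDerivAt ζ (r ^ 2 + localHeight (ζ t) ^ 6) t) ∧
  (∀ t ∈ Ioo a b, ζ t < 1 → HasDerivAt ϑ 1 t) ∧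
  (∀ t ∈ Ioo a b, 1 < ζ t → HasDerivAt ϑ (-1) t)

/-- The foliation `𝒲` of `W`: its leaf paths are the monotone continuous reparametrizations of
integral curves. -/
def wilsonFoliation : LeafPaths Support where
  IsPath γ a b := a ≤ b ∧
    ∃ (r : ℝ) (ϑ ζ τ : ℝ → ℝ) (a' b' : ℝ), IsIntegralCurve r ϑ ζ a' b' ∧
      ContinuousOn τ (Icc a b) ∧ MonotoneOn τ (Icc a b) ∧ MapsTo τ (Icc a b) (Icc a' b') ∧
      ∀ t ∈ Icc a b, radius (γ t).1 = r ∧ (γ t).1.2 = (ϑ (τ t) : AddCircle (10 : ℝ)) ∧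
        ((γ t).2 : ℝ) = ζ (τ t)

/-- `D_s`: the points `(r, θ)` such that `(r - r²/4 - 2(θ-2)², 6, 2-θ)` lies in `W_s`. -/
def domainS : Set Base :=
  {p | radius p - radius p ^ 2 / 4 - 2 * (angle p - 2) ^ 2 ∈ Icc (-1 : ℝ) 1 ∧
    2 - angle p ∈ Icc (-1 : ℝ) 1}

/-- `D̄_s`: the points `(r, θ)` such that `(r - r²/4 - 2(θ-8)², 4, θ-8)` lies in `W̄_s`. -/
def domainSbar : Set Base :=
  {p | radius p - radius p ^ 2 / 4 - 2 * (angle p - 8) ^ 2 ∈ Icc (-1 : ℝ) 1 ∧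
    angle p - 8 ∈ Icc (-1 : ℝ) 1}

/-- The domain `D = D_s ∪ D̄_s` of the self-insertion. -/
def insertionDomain : Set Base := domainS ∪ domainSbar

theorem mem_domainSbar_of_not_mem (q : insertionDomain) (h : (q : Base) ∉ domainS) :
    (q : Base) ∈ domainSbar := q.2.resolve_left h

open Classical in
/-- The self-insertion map `σ : D → W`. -/
def sigma (q : insertionDomain) : Support :=
  if h : (q : Base) ∈ domainS then
    ((⟨_, h.1⟩, ((6 : ℝ) : AddCircle (10 : ℝ))),
      ⟨2 - angle q, h.2.1, h.2.2.trans (by norm_num)⟩)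
  else
    ((⟨_, (mem_domainSbar_of_not_mem q h).1⟩, ((4 : ℝ) : AddCircle (10 : ℝ))),
      ⟨angle q - 8 + 2, by have := (mem_domainSbar_of_not_mem q h).2.1; linarith,
        by have := (mem_domainSbar_of_not_mem q h).2.2; linarith⟩)

/-- The boundary of `F × [0,1]`. -/
def cylinderBoundary : Set (Base × unitInterval) :=
  {x | |radius x.1| = 1 ∨ x.2 = 0 ∨ x.2 = 1}

/-- The boundary of `W`. -/
def supportBoundary : Set Support :=
  {x | |radius x.1| = 1 ∨ (x.2 : ℝ) = -1 ∨ (x.2 : ℝ) = 3}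

/-- The choices made in a self-insertion of `𝒲` along `σ`: an attaching map
`α : N_{F × I} → N_W` and a thickening `D × I → W` of `σ`. -/
structure SelfInsertion where
  /-- The open neighborhood `N_{F × I}` of the boundary of `F × I`. -/
  collar : Set (Base × unitInterval)
  collar_isOpen : IsOpen collar
  boundary_subset_collar : cylinderBoundary ⊆ collar
  /-- The attaching map `α` (only its values on the collar matter). -/
  attach : Base × unitInterval → Support
  attach_isOpenEmbedding : IsOpenEmbedding (fun x : collar => attach x)
  boundary_subset_attach : supportBoundary ⊆ attach '' collar
  attach_zero : ∀ p, attach (p, 0) = bottom p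
  attach_one : ∀ p, attach (p, 1) = top p
  /-- `α` is a leaf-preserving homeomorphism from the collar onto its image. -/
  attach_path : ∀ (γ : ℝ → Base × unitInterval) (a b : ℝ), (∀ t ∈ Icc a b, γ t ∈ collar) →
    ((verticalFoliation Base).IsPath γ a b ↔ wilsonFoliation.IsPath (fun t => attach (γ t)) a b)
  /-- The extension of `σ` to `D × I`. -/
  slab : insertionDomain × unitInterval → Support
  slab_isEmbedding : IsEmbedding slab
  slab_zero : ∀ q, slab (q, 0) = sigma q
  /-- It takes vertical fibers into leaves, with their orientation. -/
  slab_path : ∀ q, wilsonFoliation.IsPath (fun t => slab (q, projIcc 0 1 zero_le_one t)) 0 1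
  slab_disjoint_attach : Disjoint (range slab)
    (closure (attach '' {x | x ∈ collar ∧ x.1 ∈ insertionDomain}))
  slab_disjoint_bottom : Disjoint (range slab) (range bottom)
  slab_disjoint_top : Disjoint (range slab) (range top)

namespace SelfInsertion

variable (𝒮 : SelfInsertion)

/-- `W` with `σ((D × I) - N_{F × I})` removed. -/
def Cut : Type :=
  {x : Support // x ∉ 𝒮.slab '' {y | ((y.1 : Base), y.2) ∉ 𝒮.collar}}

instance : TopologicalSpace 𝒮.Cut := inferInstanceAs (TopologicalSpace (Subtype _))

/-- The identification `σ ∘ α⁻¹`: the point `α(q,t)` is glued to `σ(q,t)` whenever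
`(q,t) ∈ (D × I) ∩ N_{F × I}`. -/
def Glue (x y : 𝒮.Cut) : Prop :=
  ∃ (q : insertionDomain) (t : unitInterval), ((q : Base), t) ∈ 𝒮.collar ∧
    x.1 = 𝒮.attach ((q : Base), t) ∧ y.1 = 𝒮.slab (q, t)

/-- The space `Ŵ`. -/
def Hat : Type := Quot 𝒮.Glue

instance : TopologicalSpace 𝒮.Hat := inferInstanceAs (TopologicalSpace (Quot _))

/-- The projection onto `Ŵ`. -/
def proj (x : 𝒮.Cut) : 𝒮.Hat := Quot.mk _ x

/-- The leaf paths of `Ŵ`: finite concatenations of images of leaf paths of `𝒲` that avoid the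
removed part of `W`. -/
inductive HatPath (γ : ℝ → 𝒮.Hat) : ℝ → ℝ → Prop
  | of_path (c : ℝ → 𝒮.Cut) (a b : ℝ) (hc : wilsonFoliation.IsPath (fun t => (c t).1) a b)
      (hγ : ∀ t ∈ Icc a b, γ t = 𝒮.proj (c t)) : HatPath γ a b
  | trans (a b c : ℝ) (hab : HatPath γ a b) (hbc : HatPath γ b c) : HatPath γ a c

/-- The foliation of `Ŵ`. -/
def hatFoliation : LeafPaths 𝒮.Hat where
  IsPath := 𝒮.HatPath

theorem bottom_not_mem (p : Base) :
    bottom p ∉ 𝒮.slab '' {y | ((y.1 : Base), y.2) ∉ 𝒮.collar} := by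
  rintro ⟨y, -, hy⟩
  exact disjoint_left.1 𝒮.slab_disjoint_bottom ⟨y, rfl⟩ ⟨p, hy.symm⟩

/-- The point `α₋(p)`, in `Ŵ`. -/
def hatBottom (p : Base) : 𝒮.Hat := 𝒮.proj ⟨bottom p, 𝒮.bottom_not_mem p⟩

/-- `P ⊆ Ŵ` results from cutting off the stair-steps at the bottom and the top of `Ŵ` without
disturbing transition points: every point that is cut off lies on a piece of a leaf of `𝒲`
that runs from an external entry point `α₋(p)`, `p ∉ D`, to its first point in `P`, or on one that
runs from its last point in `P` to an external exit point `α₊(p)`, `p ∉ D`. -/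
def IsTrimming (P : Set 𝒮.Hat) : Prop :=
  ∀ y ∉ P, ∃ p ∉ insertionDomain, ∃ c : ℝ → 𝒮.Cut,
    wilsonFoliation.IsPath (fun t => (c t).1) 0 1 ∧
    (((c 0).1 = bottom p ∧ 𝒮.proj (c 1) ∈ P ∧ (∀ t ∈ Ico (0 : ℝ) 1, 𝒮.proj (c t) ∉ P) ∧
        ∃ t ∈ Ico (0 : ℝ) 1, 𝒮.proj (c t) = y) ∨
      ((c 1).1 = top p ∧ 𝒮.proj (c 0) ∈ P ∧ (∀ t ∈ Ioc (0 : ℝ) 1, 𝒮.proj (c t) ∉ P) ∧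
        ∃ t ∈ Ioc (0 : ℝ) 1, 𝒮.proj (c t) = y))

/-- The foliation `𝒲̃` of the trimmed support `P = W̃`. -/
def tildeFoliation (P : Set 𝒮.Hat) : LeafPaths P := 𝒮.hatFoliation.restrict P

end SelfInsertion

end AnalyticPlug

end

open AnalyticPlug

/-!
Write `r` for the radius of the point at which a leaf enters `W` from below. While it is in `W` its
radius is constant, and it leaves `W` at the matching point of the top, since the two halves of the
plug turn it by opposite angles; only the leaves of radius `0` never arrive, because they spiral
towards a circle. Inserting the plug into itself means that a leaf that meets `σ(q)` enters `W` anew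
at the bottom point `q`, and if it leaves `W` again, it goes on behind the inserted slab.

*A leaf of radius in `(-1/20, 0)` enters the plug infinitely often.* The formula for `σ` gives the
radius inequality: the new radius is larger than the old one, except on the circles
(`radius_sigma_lt`). Suppose that a leaf enters the plug only finitely often. Then it leaves each
plug that it enters (`passable_of_finite`): among the plugs that it does not leave take one of
maximal radius. It leaves all plugs that it enters from there, as they have larger radius, and so
it follows its original leaf to the top (`ahead_rising`) unless the radius is `0`; but in that case
it spirals towards a circle and meets the self-insertion infinitely often. On the other hand, a leaf
of small radius `r < 0` climbs past height `0` with speed about `r²`, so slowly that it makes a full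
turn within heights of order `r²`, where it meets the self-insertion at a point whose new radius
lies in `(r, 0)` (`exists_sigma_of_radius_neg`). Applied to the largest such radius, this is a
contradiction (`infinite_transitionAhead_hatBottom`).

*The leaf stays infinite after trimming.* Leaf paths of the self-inserted plug are determined by
their starts and by their ends (`arc_det`, `arc_det_reverse`), and each contains finitely many of
the transition points, at which the leaf enters anew. A point with infinitely many transition
points ahead does not run to an external exit point, so the leaf is not cut off at the top
(`mem_of_infinite_transitionAhead`). The transition points are closed and discrete in the leaf
topology, so the leaf is not compact there (`infiniteLeaf_of_infinite_transitionAhead`).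

*Existence and openness.* The leaf of an external entry point `p ∉ D` has a first point in the
trimmed plug, which lies in the entry region: a point from which a fiber of a chart goes down inside
the trimmed plug would have an earlier one (`mem_entryRegion`). Following that leaf from there up to
the first point of the slab, one arrives at a point with a neighborhood of points whose leaves also
start at radius in `(-1/20, 0)` (`exists_interior_stoppedLeaves`). Holonomy along the leaf path
(`LeafPaths.mem_interior_of_path`) carries this neighborhood back to the entry region, where it
consists of stopped points.
-/

noncomputable section

namespace AnalyticPlug

/-! ### The height equation -/

theorem localHeight_pow_six (h : ℝ) : localHeight h ^ 6 = min |h| |h - 2| ^ 6 := by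
  have e : localHeight h ^ 6 = |localHeight h| ^ 6 := by
    rw [show (6 : ℕ) = 2 * 3 by norm_num, pow_mul, pow_mul, sq_abs]
  rw [e]
  congr 1
  unfold localHeight
  split_ifs with h1
  · rw [min_eq_left]
    exact sq_le_sq.1 (by nlinarith)
  · rw [min_eq_right]
    exact sq_le_sq.1 (by nlinarith)

theorem continuous_localHeight_pow_six : Continuous fun h : ℝ => localHeight h ^ 6 := by
  simp only [localHeight_pow_six]
  fun_prop

theorem localHeight_reflect_pow_six (h : ℝ) : localHeight (2 - h) ^ 6 = localHeight h ^ 6 := by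
  rw [localHeight_pow_six, localHeight_pow_six, min_comm, show 2 - h - 2 = -h by ring, abs_neg,
    abs_sub_comm 2 h]

theorem localHeight_pow_six_nonneg (h : ℝ) : 0 ≤ localHeight h ^ 6 := by positivity

theorem abs_localHeight_pow_six_sub_le {h k : ℝ} (hh : h ∈ Icc (-1 : ℝ) 3)
    (hk : k ∈ Icc (-1 : ℝ) 3) :
    |localHeight h ^ 6 - localHeight k ^ 6| ≤ 6 * |h - k| := by
  have bound : ∀ x ∈ Icc (-1 : ℝ) 3, 0 ≤ min |x| |x - 2| ∧ min |x| |x - 2| ≤ 1 := by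
    intro x hx
    refine ⟨le_min (abs_nonneg _) (abs_nonneg _), ?_⟩
    rcases le_total x 1 with h1 | h1
    · exact (min_le_left _ _).trans (abs_le.2 ⟨hx.1, h1⟩)
    · exact (min_le_right _ _).trans (abs_le.2 ⟨by linarith, by linarith [hx.2]⟩)
  have lip : |min (|h|) (|h - 2|) - min (|k|) (|k - 2|)| ≤ |h - k| := by
    refine (abs_min_sub_min_le_max _ _ _ _).trans (max_le (abs_abs_sub_abs_le _ _) ?_)
    refine (abs_abs_sub_abs_le _ _).trans_eq ?_
    congr 1; ring
  rw [localHeight_pow_six, localHeight_pow_six]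
  obtain ⟨a0, a1⟩ := bound h hh
  obtain ⟨b0, b1⟩ := bound k hk
  generalize min |h| |h - 2| = a at *
  generalize min |k| |k - 2| = b at *
  have e : a ^ 6 - b ^ 6 = (a - b) *
      (a ^ 5 + a ^ 4 * b + a ^ 3 * b ^ 2 + a ^ 2 * b ^ 3 + a * b ^ 4 + b ^ 5) := by ring
  have p : ∀ i j : ℕ, 0 ≤ a ^ i * b ^ j ∧ a ^ i * b ^ j ≤ 1 := fun i j =>
    ⟨by positivity, mul_le_one₀ (pow_le_one₀ a0 a1) (by positivity) (pow_le_one₀ b0 b1)⟩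
  have s : |a ^ 5 + a ^ 4 * b + a ^ 3 * b ^ 2 + a ^ 2 * b ^ 3 + a * b ^ 4 + b ^ 5| ≤ 6 := by
    have h0 := p 5 0
    have h1 := p 4 1
    have h2 := p 3 2
    have h3 := p 2 3
    have h4 := p 1 4
    have h5 := p 0 5
    simp only [pow_zero, pow_one, mul_one, one_mul] at h0 h1 h2 h3 h4 h5
    rw [abs_le]
    constructor <;> linarith
  rw [e, abs_mul, mul_comm]
  exact mul_le_mul s lip (abs_nonneg _) (by norm_num)

/-- The second half of the plug mirrors the first: reversing time and reflecting the height
takes integral curves to integral curves. -/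
theorem IsIntegralCurve.reflect {r : ℝ} {ϑ ζ : ℝ → ℝ} {a b : ℝ} (h : IsIntegralCurve r ϑ ζ a b) :
    IsIntegralCurve r (fun s => ϑ (-s)) (fun s => 2 - ζ (-s)) (-b) (-a) := by
  obtain ⟨h1, h2, h3, h4, h5⟩ := h
  have m : MapsTo (fun s : ℝ => -s) (Icc (-b) (-a)) (Icc a b) := fun s hs =>
    ⟨by linarith [hs.2], by linarith [hs.1]⟩
  have m' : ∀ s ∈ Ioo (-b) (-a), -s ∈ Ioo a b := fun s hs =>
    ⟨by linarith [hs.2], by linarith [hs.1]⟩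
  refine ⟨h1.comp continuous_neg.continuousOn m,
    continuousOn_const.sub (h2.comp continuous_neg.continuousOn m), ?_, ?_, ?_⟩
  · intro t ht
    rw [localHeight_reflect_pow_six]
    exact (((h3 _ (m' t ht)).comp t (hasDerivAt_neg t)).const_sub 2).congr_deriv (by ring)
  · intro t ht hz
    exact ((h5 _ (m' t ht) (by linarith)).comp t (hasDerivAt_neg t)).congr_deriv (by ring)
  · intro t ht hz
    exact ((h4 _ (m' t ht) (by linarith)).comp t (hasDerivAt_neg t)).congr_deriv (by ring)

theorem IsIntegralCurve.mono {r : ℝ} {ϑ ζ : ℝ → ℝ} {a b c d : ℝ} (h : IsIntegralCurve r ϑ ζ a b)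
    (hc : a ≤ c) (hd : d ≤ b) : IsIntegralCurve r ϑ ζ c d :=
  ⟨h.1.mono (Icc_subset_Icc hc hd), h.2.1.mono (Icc_subset_Icc hc hd),
    fun t ht => h.2.2.1 t (Ioo_subset_Ioo hc hd ht),
    fun t ht => h.2.2.2.1 t (Ioo_subset_Ioo hc hd ht),
    fun t ht => h.2.2.2.2 t (Ioo_subset_Ioo hc hd ht)⟩

theorem IsIntegralCurve.shift {r : ℝ} {ϑ ζ : ℝ → ℝ} {a b : ℝ} (h : IsIntegralCurve r ϑ ζ a b)
    (c : ℝ) : IsIntegralCurve r (fun s => ϑ (s + c)) (fun s => ζ (s + c)) (a - c) (b - c) := by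
  have m : MapsTo (fun s : ℝ => s + c) (Icc (a - c) (b - c)) (Icc a b) := fun s hs =>
    ⟨by linarith [hs.1], by linarith [hs.2]⟩
  have m' : ∀ s ∈ Ioo (a - c) (b - c), s + c ∈ Ioo a b := fun s hs =>
    ⟨by linarith [hs.1], by linarith [hs.2]⟩
  refine ⟨h.1.comp (by fun_prop) m, h.2.1.comp (by fun_prop) m, ?_, ?_, ?_⟩
  · exact fun t ht => (h.2.2.1 _ (m' t ht)).comp_add_const t c
  · exact fun t ht hz => (h.2.2.2.1 _ (m' t ht) hz).comp_add_const t c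
  · exact fun t ht hz => (h.2.2.2.2 _ (m' t ht) hz).comp_add_const t c

theorem IsIntegralCurve.monotoneOn {r : ℝ} {ϑ ζ : ℝ → ℝ} {a b : ℝ}
    (h : IsIntegralCurve r ϑ ζ a b) : MonotoneOn ζ (Icc a b) := by
  refine monotoneOn_of_deriv_nonneg (convex_Icc a b) h.2.1 ?_ ?_
  · rw [interior_Icc]
    exact fun t ht => (h.2.2.1 t ht).differentiableAt.differentiableWithinAt
  · rw [interior_Icc]
    intro t ht
    rw [(h.2.2.1 t ht).deriv]
    have := localHeight_pow_six_nonneg (ζ t)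
    positivity

/-- The height is constant along a nontrivial piece of an integral curve only where its speed
vanishes. -/
theorem IsIntegralCurve.eq_of_height_eq {r : ℝ} {ϑ ζ : ℝ → ℝ} {a b : ℝ}
    (h : IsIntegralCurve r ϑ ζ a b) {s t : ℝ} (hs : s ∈ Icc a b) (ht : t ∈ Icc a b)
    (e : ζ s = ζ t) (hne : 0 < r ^ 2 + localHeight (ζ s) ^ 6) : s = t := by
  wlog hst : s ≤ t generalizing s t
  · exact (this ht hs e.symm (e ▸ hne) (le_of_not_ge hst)).symm
  by_contra hcon
  have hlt : s < t := lt_of_le_of_ne hst hcon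
  have c : ∀ x ∈ Icc s t, ζ x = ζ s := fun x hx => by
    have hx' : x ∈ Icc a b := ⟨hs.1.trans hx.1, hx.2.trans ht.2⟩
    exact le_antisymm (e ▸ h.monotoneOn hx' ht hx.2) (h.monotoneOn hs hx' hx.1)
  have hm : (s + t) / 2 ∈ Ioo s t := ⟨by linarith, by linarith⟩
  have d := h.2.2.1 ((s + t) / 2) ⟨by linarith [hs.1, hm.1], by linarith [ht.2, hm.2]⟩
  have d0 : HasDerivAt ζ 0 ((s + t) / 2) := by
    refine (hasDerivAt_const _ (ζ s)).congr_of_eventuallyEq ?_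
    filter_upwards [Icc_mem_nhds hm.1 hm.2] with x hx using c x hx
  have := d.unique d0
  rw [c _ (Ioo_subset_Icc_self hm)] at this
  linarith

theorem localHeight_one : localHeight 1 = 1 := by simp [localHeight]

theorem speed_pos_of_one (r : ℝ) : 0 < r ^ 2 + localHeight 1 ^ 6 := by
  rw [localHeight_one]; positivity

/-- Two functions with the derivative prescribed by the same height function differ by a
constant, since the height `1` is taken only once. -/
theorem IsIntegralCurve.angle_sub {r : ℝ} {ϑ ϑ' ζ : ℝ → ℝ} {a b : ℝ}
    (h : IsIntegralCurve r ϑ ζ a b) (h' : IsIntegralCurve r ϑ' ζ a b) {t : ℝ} (ht : t ∈ Icc a b) :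
    ϑ t - ϑ' t = ϑ a - ϑ' a := by
  have hs : {x ∈ Icc a b | ζ x = 1}.Countable := by
    refine Set.Subsingleton.countable ?_
    rintro x ⟨hx, ex⟩ y ⟨hy, ey⟩
    exact h.eq_of_height_eq hx hy (ex.trans ey.symm) (ex ▸ speed_pos_of_one r)
  have sub : Icc a t ⊆ Icc a b := Icc_subset_Icc_right ht.2
  have := MeasureTheory.integral_eq_of_hasDerivAt_off_countable_of_le (fun x => ϑ x - ϑ' x)
    (fun _ => 0) ht.1 hs ((h.1.mono sub).sub (h'.1.mono sub)) (fun x hx => by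
      have hx' : x ∈ Ioo a b := ⟨hx.1.1, hx.1.2.trans_le ht.2⟩
      rcases lt_trichotomy (ζ x) 1 with h1 | h1 | h1
      · exact ((h.2.2.2.1 x hx' h1).sub (h'.2.2.2.1 x hx' h1)).congr_deriv (by ring)
      · exact absurd ⟨Ioo_subset_Icc_self hx', h1⟩ hx.2
      · exact ((h.2.2.2.2 x hx' h1).sub (h'.2.2.2.2 x hx' h1)).congr_deriv (by ring)) (by simp)
  simp only [intervalIntegral.integral_zero] at this
  linarith

/-- Uniqueness of the height: the square of the difference of two solutions, times
`exp (-12 t)`, does not increase. -/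
theorem IsIntegralCurve.height_unique {r : ℝ} {ϑ ϑ' ζ ζ' : ℝ → ℝ} {a b : ℝ}
    (h : IsIntegralCurve r ϑ ζ a b) (h' : IsIntegralCurve r ϑ' ζ' a b)
    (m : ∀ t ∈ Icc a b, ζ t ∈ Icc (-1 : ℝ) 3) (m' : ∀ t ∈ Icc a b, ζ' t ∈ Icc (-1 : ℝ) 3)
    (e : ζ a = ζ' a) {t : ℝ} (ht : t ∈ Icc a b) : ζ t = ζ' t := by
  have d : ∀ x ∈ Ioo a b, HasDerivAt (fun x => (ζ x - ζ' x) ^ 2 * Real.exp (-12 * x))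
      ((2 * (ζ x - ζ' x) * ((r ^ 2 + localHeight (ζ x) ^ 6) - (r ^ 2 + localHeight (ζ' x) ^ 6)))
        * Real.exp (-12 * x) + (ζ x - ζ' x) ^ 2 * (Real.exp (-12 * x) * (-12))) x := by
    intro x hx
    have h1 := ((h.2.2.1 x hx).sub (h'.2.2.1 x hx)).pow 2
    have h2 := ((hasDerivAt_id x).const_mul (-12)).exp
    exact (h1.mul h2).congr_deriv (by simp)
  have anti : AntitoneOn (fun x => (ζ x - ζ' x) ^ 2 * Real.exp (-12 * x)) (Icc a b) := by
    refine antitoneOn_of_deriv_nonpos (convex_Icc a b) ?_ ?_ ?_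
    · exact ((h.2.1.sub h'.2.1).pow 2).mul (by fun_prop)
    · rw [interior_Icc]
      exact fun x hx => (d x hx).differentiableAt.differentiableWithinAt
    · rw [interior_Icc]
      intro x hx
      rw [(d x hx).deriv]
      have hx' := Ioo_subset_Icc_self hx
      have l := abs_localHeight_pow_six_sub_le (m x hx') (m' x hx')
      have l2 : (ζ x - ζ' x) * (localHeight (ζ x) ^ 6 - localHeight (ζ' x) ^ 6)
          ≤ 6 * (ζ x - ζ' x) ^ 2 := by
        calc _ ≤ |(ζ x - ζ' x) * (localHeight (ζ x) ^ 6 - localHeight (ζ' x) ^ 6)| := le_abs_self _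
          _ ≤ |ζ x - ζ' x| * (6 * |ζ x - ζ' x|) := by
            rw [abs_mul]; exact mul_le_mul_of_nonneg_left l (abs_nonneg _)
          _ = _ := by rw [← sq_abs (ζ x - ζ' x)]; ring
      have := Real.exp_pos (-12 * x)
      nlinarith
  have := anti (left_mem_Icc.2 (ht.1.trans ht.2)) ht ht.1
  simp only [e, sub_self, ne_eq, OfNat.ofNat_ne_zero, not_false_eq_true, zero_pow, zero_mul] at this
  have p := Real.exp_pos (-12 * t)
  have z : (ζ t - ζ' t) ^ 2 = 0 := by nlinarith [sq_nonneg (ζ t - ζ' t)]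
  linarith [pow_eq_zero_iff (two_ne_zero) |>.1 z]

/-- The angle increases at unit rate until the height `1` is reached, and then decreases. -/
theorem IsIntegralCurve.exists_angle_eq {r : ℝ} {ϑ ζ : ℝ → ℝ} {a b : ℝ}
    (h : IsIntegralCurve r ϑ ζ a b) : ∃ s₁ C : ℝ, ∀ t ∈ Icc a b, ϑ t = C - |t - s₁| := by
  rcases lt_or_ge b a with hab | hab
  · exact ⟨0, 0, fun t ht => absurd (ht.1.trans ht.2) (not_le.2 hab)⟩
  have main : ∀ s₁ : ℝ, (∀ t ∈ Icc a b, t < s₁ → ζ t ≤ 1) → (∀ t ∈ Icc a b, s₁ < t → 1 ≤ ζ t) →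
      ∃ s₁ C : ℝ, ∀ t ∈ Icc a b, ϑ t = C - |t - s₁| := by
    intro s₁ h1 h2
    have c : IsIntegralCurve r (fun t => -|t - s₁|) ζ a b := by
      refine ⟨by fun_prop, h.2.1, h.2.2.1, fun t ht hz => ?_, fun t ht hz => ?_⟩
      · have hts : t < s₁ := by
          by_contra hcon
          rcases (not_lt.1 hcon).lt_or_eq with h3 | h3
          · exact absurd (h2 t (Ioo_subset_Icc_self ht) h3) (not_le.2 hz)
          · -- at `t = s₁` itself the height would be below `1` slightly later as well
            have ev : ∀ᶠ x in 𝓝 t, ζ x < 1 :=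
              (h.2.2.1 t ht).continuousAt.eventually (gt_mem_nhds hz)
            have ev2 : ∀ᶠ x in 𝓝[>] t, x ∈ Ioo a b :=
              nhdsWithin_le_nhds (Ioo_mem_nhds ht.1 ht.2)
            obtain ⟨x, hx1, hx2, hx3⟩ :=
              ((ev.filter_mono nhdsWithin_le_nhds).and (ev2.and self_mem_nhdsWithin)).exists
            exact absurd (h2 x (Ioo_subset_Icc_self hx2) (h3 ▸ hx3)) (not_le.2 hx1)
        have : HasDerivAt (fun x => x - s₁) 1 t := (hasDerivAt_id t).sub_const s₁
        refine this.congr_of_eventuallyEq ?_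
        filter_upwards [gt_mem_nhds hts] with x hx
        rw [abs_of_neg (by linarith)]; ring
      · have hts : s₁ < t := by
          by_contra hcon
          rcases (not_lt.1 hcon).lt_or_eq with h3 | h3
          · exact absurd (h1 t (Ioo_subset_Icc_self ht) h3) (not_le.2 hz)
          · have ev : ∀ᶠ x in 𝓝 t, 1 < ζ x :=
              (h.2.2.1 t ht).continuousAt.eventually (lt_mem_nhds hz)
            have ev2 : ∀ᶠ x in 𝓝[<] t, x ∈ Ioo a b :=
              nhdsWithin_le_nhds (Ioo_mem_nhds ht.1 ht.2)
            obtain ⟨x, hx1, hx2, hx3⟩ :=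
              ((ev.filter_mono nhdsWithin_le_nhds).and (ev2.and self_mem_nhdsWithin)).exists
            exact absurd (h1 x (Ioo_subset_Icc_self hx2) (h3 ▸ hx3)) (not_le.2 hx1)
        have : HasDerivAt (fun x => -(x - s₁)) (-1) t := ((hasDerivAt_id t).sub_const s₁).neg
        refine this.congr_of_eventuallyEq ?_
        filter_upwards [lt_mem_nhds hts] with x hx
        rw [abs_of_pos (by linarith)]
    refine ⟨s₁, ϑ a + |a - s₁|, fun t ht => ?_⟩
    have := h.angle_sub c ht
    linarith
  by_cases hex : ∃ s ∈ Icc a b, ζ s = 1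
  · obtain ⟨s₁, hs, e⟩ := hex
    exact main s₁ (fun t ht hlt => e ▸ h.monotoneOn ht hs hlt.le)
      (fun t ht hlt => e ▸ h.monotoneOn hs ht hlt.le)
  · rcases lt_or_ge (ζ b) 1 with hb | hb
    · exact main b (fun t ht _ => (h.monotoneOn ht (right_mem_Icc.2 hab) ht.2).trans hb.le)
        (fun t ht hlt => absurd ht.2 (not_le.2 hlt))
    · have ha : 1 < ζ a := by
        by_contra hcon
        obtain ⟨s, hs, e⟩ := intermediate_value_Icc hab h.2.1 ⟨not_lt.1 hcon, hb⟩
        exact hex ⟨s, hs, e⟩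
      exact main a (fun t ht hlt => absurd ht.1 (not_le.2 hlt))
        (fun t ht _ => ha.le.trans (h.monotoneOn (left_mem_Icc.2 hab) ht ht.1))

theorem coe_circle_eq_iff {x y : ℝ} :
    (x : AddCircle (10 : ℝ)) = (y : AddCircle (10 : ℝ)) ↔ ∃ n : ℤ, x = y + 10 * n := by
  rw [← sub_eq_zero, ← AddCircle.coe_sub, AddCircle.coe_eq_zero_iff]
  refine exists_congr fun n => ?_
  rw [zsmul_eq_mul]
  constructor <;> intro h <;> linarith

/-- An integral curve meets a given fiber of the angle at finitely many times. -/
theorem IsIntegralCurve.finite_angle {r : ℝ} {ϑ ζ : ℝ → ℝ} {a b : ℝ}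
    (h : IsIntegralCurve r ϑ ζ a b) (φ : ℝ) :
    {t ∈ Icc a b | (ϑ t : AddCircle (10 : ℝ)) = (φ : AddCircle (10 : ℝ))}.Finite := by
  obtain ⟨s₁, C, hC⟩ := h.exists_angle_eq
  -- each such time is `s₁ ± (C - φ - 10 n)` for one of finitely many integers `n`
  have bd : Bornology.IsBounded (ϑ '' Icc a b) := (isCompact_Icc.image_of_continuousOn h.1).isBounded
  obtain ⟨R, hR⟩ := bd.exists_norm_le
  set N : ℤ := ⌈(R + |φ|) / 10⌉
  refine Set.Finite.subset (((Set.finite_Icc (-N) N).image fun n : ℤ => s₁ + (C - φ - 10 * n)).union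
    ((Set.finite_Icc (-N) N).image fun n : ℤ => s₁ - (C - φ - 10 * n))) ?_
  rintro t ⟨ht, e⟩
  obtain ⟨n, hn⟩ := coe_circle_eq_iff.1 e
  have h1 := abs_le.1 (hR _ (mem_image_of_mem ϑ ht))
  have h2 := le_abs_self φ
  have h3 := neg_abs_le φ
  have h4 : (R + |φ|) / 10 ≤ N := Int.le_ceil _
  have hn' : n ∈ Icc (-N) N := by
    constructor
    · have : (-(N : ℝ)) ≤ n := by linarith [h1.1]
      exact_mod_cast this
    · have : (n : ℝ) ≤ N := by linarith [h1.2]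
      exact_mod_cast this
  have h5 := hC t ht
  rcases abs_cases (t - s₁) with ⟨h6, -⟩ | ⟨h6, -⟩
  · exact Or.inl ⟨n, hn', by simp only; linarith⟩
  · exact Or.inr ⟨n, hn', by simp only; linarith⟩

/-! ### Leaf paths of the plug before insertion -/

theorem support_ext {u v : Support} (h₁ : radius u.1 = radius v.1) (h₂ : u.1.2 = v.1.2)
    (h₃ : (u.2 : ℝ) = v.2) : u = v :=
  Prod.ext (Prod.ext (Subtype.ext h₁) h₂) (Subtype.ext h₃)

/-- A leaf path of the plug, written as a reparametrization of an integral curve defined exactly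
on the interval `[0, T]` of times it runs through. -/
structure TimeForm (γ : ℝ → Support) (a b r T : ℝ) (ϑ ζ τ : ℝ → ℝ) : Prop where
  le : a ≤ b
  curve : IsIntegralCurve r ϑ ζ 0 T
  cont : ContinuousOn τ (Icc a b)
  mono : MonotoneOn τ (Icc a b)
  left : τ a = 0
  right : τ b = T
  coords : ∀ t ∈ Icc a b, radius (γ t).1 = r ∧ (γ t).1.2 = (ϑ (τ t) : AddCircle (10 : ℝ)) ∧
    ((γ t).2 : ℝ) = ζ (τ t)

theorem exists_timeForm {γ : ℝ → Support} {a b : ℝ} (h : wilsonFoliation.IsPath γ a b) :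
    ∃ r T ϑ ζ τ, TimeForm γ a b r T ϑ ζ τ := by
  obtain ⟨hab, r, ϑ, ζ, τ, a', b', hc, hτ, hmono, hmaps, hco⟩ := h
  refine ⟨r, τ b - τ a, fun s => ϑ (s + τ a), fun s => ζ (s + τ a), fun t => τ t - τ a, hab, ?_,
    hτ.sub continuousOn_const, fun x hx y hy hxy => sub_le_sub_right (hmono hx hy hxy) _,
    sub_self _, rfl, ?_⟩
  · have := (hc.mono (hmaps (left_mem_Icc.2 hab)).1 (hmaps (right_mem_Icc.2 hab)).2).shift (τ a)
    rwa [sub_self] at this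
  · intro t ht
    simpa using hco t ht

namespace TimeForm

variable {γ δ : ℝ → Support} {a b c d r r' T T' : ℝ} {ϑ ζ τ ϑ' ζ' τ' : ℝ → ℝ}

theorem mapsTo (h : TimeForm γ a b r T ϑ ζ τ) : MapsTo τ (Icc a b) (Icc 0 T) := fun _ ht =>
  ⟨h.left ▸ h.mono (left_mem_Icc.2 h.le) ht ht.1, h.right ▸ h.mono ht (right_mem_Icc.2 h.le) ht.2⟩

theorem exists_eq (h : TimeForm γ a b r T ϑ ζ τ) {s : ℝ} (hs : s ∈ Icc 0 T) :
    ∃ t ∈ Icc a b, τ t = s := by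
  have := intermediate_value_Icc h.le h.cont
  rw [h.left, h.right] at this
  exact this hs

theorem nonneg (h : TimeForm γ a b r T ϑ ζ τ) : 0 ≤ T :=
  (h.mapsTo (left_mem_Icc.2 h.le)).1.trans (h.mapsTo (left_mem_Icc.2 h.le)).2

theorem height_mem (h : TimeForm γ a b r T ϑ ζ τ) {s : ℝ} (hs : s ∈ Icc 0 T) :
    ζ s ∈ Icc (-1 : ℝ) 3 := by
  obtain ⟨t, ht, rfl⟩ := h.exists_eq hs
  rw [← (h.coords t ht).2.2]
  exact (γ t).2.2

theorem eq_of_time_eq (h : TimeForm γ a b r T ϑ ζ τ) {s t : ℝ} (hs : s ∈ Icc a b)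
    (ht : t ∈ Icc a b) (e : τ s = τ t) : γ s = γ t := by
  obtain ⟨h1, h2, h3⟩ := h.coords s hs
  obtain ⟨k1, k2, k3⟩ := h.coords t ht
  exact support_ext (h1.trans k1.symm) (by rw [h2, k2, e]) (by rw [h3, k3, e])

/-- Leaf paths from the same point agree at equal times. -/
theorem agree (h : TimeForm γ a b r T ϑ ζ τ) (k : TimeForm δ c d r' T' ϑ' ζ' τ')
    (e : γ a = δ c) (hT : T' ≤ T) {s t : ℝ} (hs : s ∈ Icc a b) (ht : t ∈ Icc c d)
    (hst : τ s = τ' t) : γ s = δ t := by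
  have ha := h.coords a (left_mem_Icc.2 h.le)
  have hc := k.coords c (left_mem_Icc.2 k.le)
  have hr : r = r' := by rw [← ha.1, ← hc.1, e]
  subst hr
  rw [h.left] at ha
  rw [k.left] at hc
  have hm : τ s ∈ Icc 0 T' := hst ▸ k.mapsTo ht
  have h' : IsIntegralCurve r ϑ ζ 0 T' := h.curve.mono le_rfl hT
  have hz : ∀ x ∈ Icc 0 T', ζ x = ζ' x := fun x hx =>
    h'.height_unique k.curve (fun y hy => h.height_mem ⟨hy.1, hy.2.trans hT⟩)
      (fun y hy => k.height_mem hy) (by rw [← ha.2.2, ← hc.2.2, e]) hx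
  -- transport the second angle to the first height function
  have k' : IsIntegralCurve r ϑ' ζ 0 T' :=
    ⟨k.curve.1, h'.2.1, h'.2.2.1,
      fun x hx hx1 => k.curve.2.2.2.1 x hx (hz x (Ioo_subset_Icc_self hx) ▸ hx1),
      fun x hx hx1 => k.curve.2.2.2.2 x hx (hz x (Ioo_subset_Icc_self hx) ▸ hx1)⟩
  have hϑ := h'.angle_sub k' hm
  have e0 : (ϑ 0 : AddCircle (10 : ℝ)) = ϑ' 0 := by rw [← ha.2.1, ← hc.2.1, e]
  obtain ⟨n, hn⟩ := coe_circle_eq_iff.1 e0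
  obtain ⟨h1, h2, h3⟩ := h.coords s hs
  obtain ⟨k1, k2, k3⟩ := k.coords t ht
  refine support_ext (h1.trans k1.symm) ?_ (by rw [h3, k3, ← hst, hz _ hm])
  rw [h2, k2, ← hst]
  exact coe_circle_eq_iff.2 ⟨n, by linarith⟩

theorem det (h : TimeForm γ a b r T ϑ ζ τ) (k : TimeForm δ c d r' T' ϑ' ζ' τ')
    (e : γ a = δ c) (hT : T' ≤ T) :
    ∃ s ∈ Icc a b, γ s = δ d ∧ γ '' Icc a s = δ '' Icc c d := by
  obtain ⟨s, hs, es⟩ := h.exists_eq ⟨k.nonneg, hT⟩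
  refine ⟨s, hs, h.agree k e hT hs (right_mem_Icc.2 k.le) (es.trans k.right.symm), ?_⟩
  ext u
  constructor
  · rintro ⟨t, ht, rfl⟩
    have ht' : t ∈ Icc a b := ⟨ht.1, ht.2.trans hs.2⟩
    obtain ⟨t', ht1, ht2⟩ := k.exists_eq (s := τ t)
      ⟨(h.mapsTo ht').1, es ▸ h.mono ht' hs ht.2⟩
    exact ⟨t', ht1, (h.agree k e hT ht' ht1 ht2.symm).symm⟩
  · rintro ⟨t, ht, rfl⟩
    have := intermediate_value_Icc hs.1 (h.cont.mono (Icc_subset_Icc_right hs.2))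
    rw [h.left, es] at this
    obtain ⟨t', ht1, ht2⟩ := this (k.mapsTo ht)
    exact ⟨t', ht1, h.agree k e hT ⟨ht1.1, ht1.2.trans hs.2⟩ ht ht2⟩

end TimeForm

section WilsonPaths

variable {γ δ : ℝ → Support} {a b c d : ℝ}

theorem wilson_le (h : wilsonFoliation.IsPath γ a b) : a ≤ b := h.1

theorem wilson_sub (h : wilsonFoliation.IsPath γ a b) {s t : ℝ} (hs : a ≤ s) (hst : s ≤ t)
    (ht : t ≤ b) : wilsonFoliation.IsPath γ s t := by
  obtain ⟨-, r, ϑ, ζ, τ, a', b', hc, hτ, hmono, hmaps, hco⟩ := h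
  have sub := Icc_subset_Icc hs ht
  exact ⟨hst, r, ϑ, ζ, τ, a', b', hc, hτ.mono sub, hmono.mono sub, hmaps.mono_left sub,
    fun x hx => hco x (sub hx)⟩

theorem wilson_congr (h : wilsonFoliation.IsPath γ a b) (e : EqOn δ γ (Icc a b)) :
    wilsonFoliation.IsPath δ a b := by
  obtain ⟨hab, r, ϑ, ζ, τ, a', b', hc, hτ, hmono, hmaps, hco⟩ := h
  exact ⟨hab, r, ϑ, ζ, τ, a', b', hc, hτ, hmono, hmaps, fun x hx => by rw [e hx]; exact hco x hx⟩

theorem wilson_const (u : Support) (h : a ≤ b) : wilsonFoliation.IsPath (fun _ => u) a b := by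
  obtain ⟨φ, hφ⟩ := QuotientAddGroup.mk_surjective u.1.2
  refine ⟨h, radius u.1, fun _ => φ, fun _ => u.2, fun _ => 0, 0, 0, ?_, continuousOn_const,
    fun _ _ _ _ _ => le_rfl, fun _ _ => ⟨le_rfl, le_rfl⟩, fun _ _ => ⟨rfl, hφ.symm, rfl⟩⟩
  refine ⟨continuousOn_const, continuousOn_const, ?_, ?_, ?_⟩ <;>
  · intro t ht
    exact absurd (ht.1.trans ht.2) (lt_irrefl _)

theorem wilson_continuousOn (h : wilsonFoliation.IsPath γ a b) : ContinuousOn γ (Icc a b) := by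
  obtain ⟨r, T, ϑ, ζ, τ, f⟩ := exists_timeForm h
  have c1 : ContinuousOn (fun t => (γ t).1.1) (Icc a b) := by
    rw [Topology.IsInducing.subtypeVal.continuousOn_iff]
    exact (continuousOn_const (c := r)).congr fun t ht => (f.coords t ht).1
  have c2 : ContinuousOn (fun t => (γ t).1.2) (Icc a b) := by
    refine ContinuousOn.congr (f := fun t => (ϑ (τ t) : AddCircle (10 : ℝ))) ?_
      fun t ht => (f.coords t ht).2.1
    exact (AddCircle.continuous_mk' 10).comp_continuousOn (f.curve.1.comp f.cont f.mapsTo)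
  have c3 : ContinuousOn (fun t => (γ t).2) (Icc a b) := by
    rw [Topology.IsInducing.subtypeVal.continuousOn_iff]
    exact (f.curve.2.1.comp f.cont f.mapsTo).congr fun t ht => (f.coords t ht).2.2
  exact (c1.prodMk c2).prodMk c3

theorem wilson_height_mono (h : wilsonFoliation.IsPath γ a b) {s t : ℝ} (hs : s ∈ Icc a b)
    (ht : t ∈ Icc a b) (hst : s ≤ t) : ((γ s).2 : ℝ) ≤ (γ t).2 := by
  obtain ⟨r, T, ϑ, ζ, τ, f⟩ := exists_timeForm h
  rw [(f.coords s hs).2.2, (f.coords t ht).2.2]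
  exact f.curve.monotoneOn (f.mapsTo hs) (f.mapsTo ht) (f.mono hs ht hst)

theorem wilson_eq_of_height_eq (h : wilsonFoliation.IsPath γ a b) {s t : ℝ} (hs : s ∈ Icc a b)
    (ht : t ∈ Icc a b) (e : ((γ s).2 : ℝ) = (γ t).2)
    (hne : 0 < radius (γ s).1 ^ 2 + localHeight (γ s).2 ^ 6) : γ s = γ t := by
  obtain ⟨r, T, ϑ, ζ, τ, f⟩ := exists_timeForm h
  rw [(f.coords s hs).1, (f.coords s hs).2.2] at hne
  rw [(f.coords s hs).2.2, (f.coords t ht).2.2] at e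
  exact f.eq_of_time_eq hs ht (f.curve.eq_of_height_eq (f.mapsTo hs) (f.mapsTo ht) e hne)

/-- Of two leaf paths from the same point, one is an initial piece of the other. -/
theorem wilson_det_forward (h : wilsonFoliation.IsPath γ a b) (k : wilsonFoliation.IsPath δ c d)
    (e : γ a = δ c) :
    (∃ s ∈ Icc a b, γ s = δ d ∧ γ '' Icc a s = δ '' Icc c d) ∨
      ∃ s ∈ Icc c d, δ s = γ b ∧ δ '' Icc c s = γ '' Icc a b := by
  obtain ⟨r, T, ϑ, ζ, τ, f⟩ := exists_timeForm h
  obtain ⟨r', T', ϑ', ζ', τ', g⟩ := exists_timeForm k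
  rcases le_total T' T with hT | hT
  · exact Or.inl (f.det g e hT)
  · exact Or.inr (g.det f e.symm hT)

/-- The reflection of the plug in its middle level, which reverses the foliation. -/
def mirror (u : Support) : Support :=
  (u.1, ⟨2 - u.2, by linarith [u.2.2.2], by linarith [u.2.2.1]⟩)

theorem mirror_mirror (u : Support) : mirror (mirror u) = u :=
  Prod.ext rfl (Subtype.ext (sub_sub_cancel _ _))

theorem mirror_injective : Function.Injective mirror :=
  Function.LeftInverse.injective mirror_mirror

theorem wilson_mirror (h : wilsonFoliation.IsPath γ a b) :
    wilsonFoliation.IsPath (fun t => mirror (γ (-t))) (-b) (-a) := by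
  obtain ⟨hab, r, ϑ, ζ, τ, a', b', hc, hτ, hmono, hmaps, hco⟩ := h
  have m : MapsTo (fun s : ℝ => -s) (Icc (-b) (-a)) (Icc a b) := fun s hs =>
    ⟨by linarith [hs.2], by linarith [hs.1]⟩
  refine ⟨neg_le_neg hab, r, _, _, fun t => -τ (-t), -b', -a', hc.reflect,
    (hτ.comp continuous_neg.continuousOn m).neg,
    fun x hx y hy hxy => neg_le_neg (hmono (m hy) (m hx) (neg_le_neg hxy)),
    fun x hx => ⟨neg_le_neg (hmaps (m hx)).2, neg_le_neg (hmaps (m hx)).1⟩, fun t ht => ?_⟩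
  obtain ⟨h1, h2, h3⟩ := hco (-t) (m ht)
  refine ⟨h1, ?_, ?_⟩
  · simpa [mirror] using h2
  · simpa [mirror] using h3

/-- Of two leaf paths to the same point, one is a final piece of the other. -/
theorem wilson_det_backward (h : wilsonFoliation.IsPath γ a b) (k : wilsonFoliation.IsPath δ c d)
    (e : γ b = δ d) :
    (∃ s ∈ Icc a b, γ s = δ c ∧ γ '' Icc s b = δ '' Icc c d) ∨
      ∃ s ∈ Icc c d, δ s = γ a ∧ δ '' Icc s d = γ '' Icc a b := by
  have im : ∀ (f : ℝ → Support) (x y : ℝ),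
      (fun t => mirror (f (-t))) '' Icc (-y) (-x) = mirror '' (f '' Icc x y) := fun f x y => by
    rw [← image_neg_Icc, image_image, image_image]
    simp only [neg_neg]
  have key := wilson_det_forward (wilson_mirror h) (wilson_mirror k) (by simp [e])
  refine key.imp ?_ ?_ <;>
  · rintro ⟨s, hs, e1, e2⟩
    refine ⟨-s, ⟨by linarith [hs.2], by linarith [hs.1]⟩, ?_, ?_⟩
    · simpa using mirror_injective e1
    · rw [im, show s = -(-s) by ring, im] at e2
      exact mirror_injective.image_injective e2

theorem wilson_eq_of_top (h : wilsonFoliation.IsPath γ a b) {p : Base} (e : γ a = top p) {t : ℝ}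
    (ht : t ∈ Icc a b) : γ t = top p := by
  have ha := left_mem_Icc.2 (wilson_le h)
  have h3 : ((γ a).2 : ℝ) = 3 := by rw [e]; rfl
  have := wilson_height_mono h ha ht ht.1
  rw [← e]
  refine (wilson_eq_of_height_eq h ha ht (le_antisymm this (by rw [h3]; exact (γ t).2.2.2)) ?_).symm
  rw [h3, show localHeight 3 = 1 by norm_num [localHeight]]
  positivity

theorem wilson_eq_of_bottom (h : wilsonFoliation.IsPath γ a b) {p : Base} (e : γ b = bottom p)
    {t : ℝ} (ht : t ∈ Icc a b) : γ t = bottom p := by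
  have hb := right_mem_Icc.2 (wilson_le h)
  have h3 : ((γ b).2 : ℝ) = -1 := by rw [e]; rfl
  have := wilson_height_mono h ht hb ht.2
  rw [← e]
  refine (wilson_eq_of_height_eq h hb ht (le_antisymm (by rw [h3]; exact (γ t).2.2.1) this) ?_).symm
  rw [h3, show localHeight (-1) = -1 by norm_num [localHeight]]
  positivity

theorem wilson_finite_angle (h : wilsonFoliation.IsPath γ a b) (φ : ℝ) :
    {u ∈ γ '' Icc a b | u.1.2 = (φ : AddCircle (10 : ℝ))}.Finite := by
  obtain ⟨r, T, ϑ, ζ, τ, f⟩ := exists_timeForm h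
  have fin : (τ '' {t ∈ Icc a b | (γ t).1.2 = (φ : AddCircle (10 : ℝ))}).Finite := by
    refine (f.curve.finite_angle φ).subset ?_
    rintro _ ⟨t, ⟨ht, e⟩, rfl⟩
    exact ⟨f.mapsTo ht, (f.coords t ht).2.1 ▸ e⟩
  -- the point is determined by the time
  choose! x hx using fun (s : ℝ) (hs : s ∈ Icc 0 T) => f.exists_eq hs
  refine (fin.image fun s => γ (x s)).subset ?_
  rintro _ ⟨⟨t, ht, rfl⟩, e⟩
  refine ⟨τ t, mem_image_of_mem τ ⟨ht, e⟩, ?_⟩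
  have := hx (τ t) (f.mapsTo ht)
  exact f.eq_of_time_eq this.1 ht this.2

end WilsonPaths

/-! ### The leaf above a point of the bottom, parametrized by height -/

/-- The speed of the height along the leaves of radius `r`, continued constantly outside the
heights `[-1, m]`. -/
def clampedSpeed (r m x : ℝ) : ℝ := r ^ 2 + localHeight (max (-1) (min m x)) ^ 6

/-- The time that a leaf of radius `r` needs to climb from height `-1` to height `h`. For `r = 0`
it is finite only for `h < 0`, and the cut-off `m < 0` keeps it meaningful. -/
def clock (r m h : ℝ) : ℝ := ∫ x in (-1 : ℝ)..h, (clampedSpeed r m x)⁻¹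

theorem clampedSpeed_eq {r m x : ℝ} (hx : x ∈ Icc (-1) m) :
    clampedSpeed r m x = r ^ 2 + localHeight x ^ 6 := by
  rw [clampedSpeed, min_eq_right hx.2, max_eq_right hx.1]

theorem continuous_clampedSpeed (r m : ℝ) : Continuous (clampedSpeed r m) :=
  continuous_const.add (continuous_localHeight_pow_six.comp (by fun_prop))

theorem localHeight_pow_six_le_one {h : ℝ} (hh : h ∈ Icc (-1 : ℝ) 3) : localHeight h ^ 6 ≤ 1 := by
  have : |localHeight h| ≤ 1 := by
    unfold localHeight
    rw [abs_le]
    split_ifs <;> constructor <;> linarith [hh.1, hh.2]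
  calc localHeight h ^ 6 ≤ |localHeight h| ^ 6 := by
        rw [← abs_pow]; exact le_abs_self _
    _ ≤ 1 := pow_le_one₀ (abs_nonneg _) this

/-- The leaf of radius `r` climbs from the bottom to height `m` without approaching a circle. -/
def Climbs (r m : ℝ) : Prop := m ∈ Icc (-1 : ℝ) 3 ∧ (r ≠ 0 ∨ m < 0)

section Rising

variable {r m : ℝ}

theorem Climbs.speed_pos (h : Climbs r m) {x : ℝ} (hx : x ≤ m) :
    0 < r ^ 2 + localHeight x ^ 6 := by
  have := localHeight_pow_six_nonneg x
  rcases h.2 with h0 | h0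
  · positivity
  · have hx0 : x < 0 := hx.trans_lt h0
    have : 0 < localHeight x ^ 6 := by
      rw [localHeight, if_pos (by linarith)]
      exact Even.pow_pos (by decide) hx0.ne
    positivity

theorem Climbs.clampedSpeed_pos (h : Climbs r m) (x : ℝ) : 0 < clampedSpeed r m x :=
  h.speed_pos (max_le h.1.1 (min_le_left _ _))

theorem Climbs.clampedSpeed_le (h : Climbs r m) (x : ℝ) : clampedSpeed r m x ≤ r ^ 2 + 1 :=
  add_le_add_right (localHeight_pow_six_le_one
    ⟨le_max_left _ _, max_le (by norm_num) ((min_le_left _ _).trans h.1.2)⟩) _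

theorem Climbs.continuous_inv (h : Climbs r m) : Continuous fun x => (clampedSpeed r m x)⁻¹ :=
  (continuous_clampedSpeed r m).inv₀ fun x => (h.clampedSpeed_pos x).ne'

theorem Climbs.hasDerivAt_clock (h : Climbs r m) (x : ℝ) :
    HasDerivAt (clock r m) (clampedSpeed r m x)⁻¹ x :=
  intervalIntegral.integral_hasDerivAt_right (h.continuous_inv.intervalIntegrable _ _)
    (h.continuous_inv.stronglyMeasurableAtFilter _ _) h.continuous_inv.continuousAt

theorem Climbs.continuous_clock (h : Climbs r m) : Continuous (clock r m) :=
  continuous_iff_continuousAt.2 fun x => (h.hasDerivAt_clock x).continuousAt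

theorem clock_neg_one (r m : ℝ) : clock r m (-1) = 0 := intervalIntegral.integral_same

theorem Climbs.strictMono_clock (h : Climbs r m) : StrictMono (clock r m) :=
  strictMono_of_deriv_pos fun x => by
    rw [(h.hasDerivAt_clock x).deriv]
    exact inv_pos.2 (h.clampedSpeed_pos x)

/-- A bound for the speed gives a lower bound for the time. -/
theorem Climbs.le_clock_sub (h : Climbs r m) {a b M : ℝ} (hab : a ≤ b)
    (hM : ∀ x ∈ Icc a b, clampedSpeed r m x ≤ M) : (b - a) / M ≤ clock r m b - clock r m a := by
  have e : clock r m b - clock r m a = ∫ x in a..b, (clampedSpeed r m x)⁻¹ :=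
    intervalIntegral.integral_interval_sub_left (h.continuous_inv.intervalIntegrable _ _)
      (h.continuous_inv.intervalIntegrable _ _)
  rw [e, div_eq_mul_inv]
  have := intervalIntegral.integral_mono_on (μ := MeasureTheory.volume)
    (f := fun _ => M⁻¹) hab intervalIntegrable_const
    (h.continuous_inv.intervalIntegrable _ _)
    (fun x hx => inv_anti₀ (h.clampedSpeed_pos x) (hM x hx))
  simpa using this

theorem Climbs.surjective_clock (h : Climbs r m) : Function.Surjective (clock r m) := by
  have hM : 0 < r ^ 2 + 1 := by positivity
  refine h.continuous_clock.surjective ?_ ?_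
  · refine Filter.tendsto_atTop_mono' _ (f₁ := fun x => (x - 0) / (r ^ 2 + 1) + clock r m 0) ?_ ?_
    · filter_upwards [Filter.eventually_ge_atTop 0] with x hx
      linarith [h.le_clock_sub hx fun y _ => h.clampedSpeed_le y]
    · exact Filter.tendsto_atTop_add_const_right _ _
        ((Filter.tendsto_atTop_add_const_right _ _ Filter.tendsto_id).atTop_div_const hM)
  · refine Filter.tendsto_atBot_mono' _ (f₁ := fun x => (x - 0) / (r ^ 2 + 1) + clock r m 0) ?_ ?_
    · filter_upwards [Filter.eventually_le_atBot 0] with x hx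
      have := h.le_clock_sub hx fun y _ => h.clampedSpeed_le y
      have e : (x - 0) / (r ^ 2 + 1) = - ((0 - x) / (r ^ 2 + 1)) := by ring
      linarith
    · exact Filter.tendsto_atBot_add_const_right _ _
        ((Filter.tendsto_atBot_add_const_right _ _ Filter.tendsto_id).atBot_div_const hM)

/-- The angle by which a leaf of radius `r` has turned when it reaches height `h`: the time spent
below height `1`, minus the time spent above. -/
def turn (r m h : ℝ) : ℝ := clock r m 1 - |clock r m h - clock r m 1|

theorem turn_neg_one (h : Climbs r m) : turn r m (-1) = 0 := by
  have : clock r m (-1) ≤ clock r m 1 := h.strictMono_clock.monotone (by norm_num)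
  rw [turn, abs_of_nonpos (by linarith), clock_neg_one]
  ring

theorem turn_of_le_one (h : Climbs r m) {x : ℝ} (hx : x ≤ 1) : turn r m x = clock r m x := by
  have : clock r m x ≤ clock r m 1 := h.strictMono_clock.monotone hx
  rw [turn, abs_of_nonpos (by linarith)]
  ring

/-- The two halves of the plug turn the leaf by opposite angles. -/
theorem turn_three (hr : r ≠ 0) : turn r 3 3 = 0 := by
  have h : Climbs r 3 := ⟨by norm_num, Or.inl hr⟩
  have h13 : clock r 3 1 ≤ clock r 3 3 := h.strictMono_clock.monotone (by norm_num)
  have e : clock r 3 3 - clock r 3 1 = ∫ x in (1 : ℝ)..3, (clampedSpeed r 3 x)⁻¹ :=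
    intervalIntegral.integral_interval_sub_left (h.continuous_inv.intervalIntegrable _ _)
      (h.continuous_inv.intervalIntegrable _ _)
  have e2 : ∫ x in (1 : ℝ)..3, (clampedSpeed r 3 x)⁻¹ = clock r 3 1 := by
    have := intervalIntegral.integral_comp_sub_left (a := (-1 : ℝ)) (b := 1)
      (fun x => (clampedSpeed r 3 x)⁻¹) 2
    rw [show (2 : ℝ) - 1 = 1 by norm_num, show (2 : ℝ) - -1 = 3 by norm_num] at this
    rw [← this, clock]
    refine intervalIntegral.integral_congr fun x hx => ?_
    rw [uIcc_of_le (by norm_num)] at hx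
    rw [clampedSpeed_eq ⟨by linarith [hx.2], by linarith [hx.1]⟩,
      clampedSpeed_eq ⟨hx.1, by linarith [hx.2]⟩, localHeight_reflect_pow_six]
  rw [turn, abs_of_nonneg (by linarith)]
  linarith

/-- The leaf through the bottom point `p`, parametrized by the height in `[-1, m]`. -/
def rising (p : Base) (m h : ℝ) : Support :=
  ((p.1, p.2 + (turn (radius p) m h : AddCircle (10 : ℝ))), projIcc (-1) 3 (by norm_num) h)

theorem rising_height (p : Base) (m : ℝ) {h : ℝ} (hh : h ∈ Icc (-1 : ℝ) 3) :
    ((rising p m h).2 : ℝ) = h := by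
  rw [rising, projIcc_of_mem _ hh]

theorem rising_radius (p : Base) (m h : ℝ) : radius (rising p m h).1 = radius p := rfl

theorem rising_bottom {p : Base} (h : Climbs (radius p) m) : rising p m (-1) = bottom p := by
  refine support_ext rfl ?_ ?_
  · simp [rising, turn_neg_one h, bottom]
  · rw [rising_height _ _ (by norm_num)]; rfl

theorem rising_top {p : Base} (h : radius p ≠ 0) : rising p 3 3 = top p := by
  refine support_ext rfl ?_ ?_
  · simp [rising, turn_three h, top]
  · rw [rising_height _ _ (by norm_num)]; rfl

theorem rising_path {p : Base} (h : Climbs (radius p) m) :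
    wilsonFoliation.IsPath (rising p m) (-1) m := by
  obtain ⟨φ, hφ⟩ := QuotientAddGroup.mk_surjective p.2
  set r := radius p with hr
  set Z := (h.strictMono_clock.orderIsoOfSurjective _ h.surjective_clock).symm with hZ
  have hZ1 : ∀ s, clock r m (Z s) = s := fun s =>
    (h.strictMono_clock.orderIsoOfSurjective _ h.surjective_clock).apply_symm_apply s
  have hZ2 : ∀ x, Z (clock r m x) = x := fun x =>
    (h.strictMono_clock.orderIsoOfSurjective _ h.surjective_clock).symm_apply_apply x
  have hZc : Continuous Z := Z.continuous
  have hZd : ∀ s, HasDerivAt Z (clampedSpeed r m (Z s)) s := fun s => by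
    have := HasDerivAt.of_local_left_inverse hZc.continuousAt (h.hasDerivAt_clock (Z s))
      (inv_ne_zero (h.clampedSpeed_pos _).ne') (Filter.Eventually.of_forall hZ1)
    rwa [inv_inv] at this
  have hmem : ∀ s ∈ Icc 0 (clock r m m), Z s ∈ Icc (-1) m := fun s hs => by
    constructor
    · rw [← h.strictMono_clock.le_iff_le, clock_neg_one, hZ1]; exact hs.1
    · rw [← h.strictMono_clock.le_iff_le, hZ1]; exact hs.2
  refine ⟨h.1.1, r, fun s => φ + (clock r m 1 - |s - clock r m 1|), Z, clock r m, 0, clock r m m,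
    ⟨by fun_prop, hZc.continuousOn, ?_, ?_, ?_⟩, h.continuous_clock.continuousOn,
    h.strictMono_clock.monotone.monotoneOn _, ?_, ?_⟩
  · intro s hs
    rw [← clampedSpeed_eq (hmem s (Ioo_subset_Icc_self hs))]
    exact hZd s
  · intro s hs hz
    have hs1 : s < clock r m 1 := by
      rw [← h.strictMono_clock.lt_iff_lt, hZ1] at hz; exact hz
    refine HasDerivAt.congr_of_eventuallyEq (f := fun x => φ + x)
      ((hasDerivAt_id s).const_add φ) ?_
    filter_upwards [gt_mem_nhds hs1] with x hx
    rw [abs_of_neg (by linarith)]; ring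
  · intro s hs hz
    have hs1 : clock r m 1 < s := by
      rw [← h.strictMono_clock.lt_iff_lt, hZ1] at hz; exact hz
    refine HasDerivAt.congr_of_eventuallyEq (f := fun x => (φ + 2 * clock r m 1) - x)
      ((hasDerivAt_id s).const_sub _) ?_
    filter_upwards [lt_mem_nhds hs1] with x hx
    rw [abs_of_pos (by linarith)]; ring
  · intro x hx
    exact ⟨clock_neg_one r m ▸ h.strictMono_clock.monotone hx.1, h.strictMono_clock.monotone hx.2⟩
  · intro x hx
    refine ⟨rfl, ?_, ?_⟩
    · rw [rising, ← hφ]; rfl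
    · rw [rising_height _ _ ⟨hx.1, hx.2.trans h.1.2⟩, hZ2]

/-- While the leaf turns by at least `10` below height `1`, it meets the angle `6`. -/
theorem exists_angle_six {p : Base} (h : Climbs (radius p) m) {a b M : ℝ} (hab : a ≤ b)
    (ha : -1 ≤ a) (hbm : b ≤ m) (hb : b ≤ 1) (hM0 : 0 < M)
    (hM : ∀ x ∈ Icc a b, radius p ^ 2 + localHeight x ^ 6 ≤ M) (hlen : 10 * M ≤ b - a) :
    ∃ x ∈ Icc a b, (rising p m x).1.2 = ((6 : ℝ) : AddCircle (10 : ℝ)) := by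
  obtain ⟨φ, hφ⟩ := QuotientAddGroup.mk_surjective p.2
  have h1 := h.le_clock_sub hab fun x hx => by
    rw [clampedSpeed_eq ⟨ha.trans hx.1, hx.2.trans hbm⟩]; exact hM x hx
  have h2 : 10 ≤ (b - a) / M := by rwa [le_div_iff₀ hM0]
  set r := radius p
  -- the first time after `clock r m a` at which the angle is `6` modulo `10`
  set n : ℤ := ⌈(φ + clock r m a - 6) / 10⌉ with hn
  have n1 : (φ + clock r m a - 6) / 10 ≤ n := Int.le_ceil _
  have n2 : (n : ℝ) < (φ + clock r m a - 6) / 10 + 1 := Int.ceil_lt_add_one _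
  obtain ⟨x, hx, ex⟩ := intermediate_value_Icc hab (h.continuous_clock.continuousOn)
    (show 6 + 10 * (n : ℝ) - φ ∈ Icc (clock r m a) (clock r m b) from
      ⟨by linarith, by linarith⟩)
  refine ⟨x, hx, ?_⟩
  rw [rising, ← hφ]
  simp only
  rw [turn_of_le_one h (hx.2.trans hb), ex]
  exact coe_circle_eq_iff.2 ⟨n, by ring⟩

end Rising

/-! ### The points of the self-insertion -/

theorem sigma_spec (q : insertionDomain) :
    ((q : Base) ∈ domainS ∧
      radius (sigma q).1 = radius q - radius q ^ 2 / 4 - 2 * (angle q - 2) ^ 2 ∧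
      (sigma q).1.2 = ((6 : ℝ) : AddCircle (10 : ℝ)) ∧ ((sigma q).2 : ℝ) = 2 - angle q) ∨
    ((q : Base) ∈ domainSbar ∧
      radius (sigma q).1 = radius q - radius q ^ 2 / 4 - 2 * (angle q - 8) ^ 2 ∧
      (sigma q).1.2 = ((4 : ℝ) : AddCircle (10 : ℝ)) ∧ ((sigma q).2 : ℝ) = angle q - 6) := by
  by_cases h : (q : Base) ∈ domainS
  · left
    simp only [sigma, dif_pos h]
    exact ⟨h, rfl, trivial, trivial⟩
  · right
    simp only [sigma, dif_neg h]
    exact ⟨mem_domainSbar_of_not_mem q h, rfl, trivial, by ring⟩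

theorem sigma_circle (q : insertionDomain) :
    (sigma q).1.2 = ((6 : ℝ) : AddCircle (10 : ℝ)) ∨
      (sigma q).1.2 = ((4 : ℝ) : AddCircle (10 : ℝ)) :=
  (sigma_spec q).imp (fun h => h.2.2.1) fun h => h.2.2.1

/-- The radius inequality: a leaf that enters the inserted plug enters it at a larger radius,
except on the two circular leaves. -/
theorem radius_sigma_lt (q : insertionDomain)
    (h : radius (sigma q).1 ≠ 0 ∨ ((sigma q).2 : ℝ) < 0) : radius (sigma q).1 < radius q := by
  by_contra hcon
  rcases sigma_spec q with ⟨-, h1, -, h2⟩ | ⟨-, h1, -, h2⟩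
  all_goals
    have r0 : radius (q : Base) = 0 := by
      nlinarith [sq_nonneg (radius (q : Base)), sq_nonneg (angle q - 2), sq_nonneg (angle q - 8)]
  · have z0 : angle q - 2 = 0 := by nlinarith [sq_nonneg (angle q - 2)]
    rw [r0, z0] at h1
    rcases h with h | h
    · exact h (by rw [h1]; norm_num)
    · linarith
  · have z0 : angle q - 8 = 0 := by nlinarith [sq_nonneg (angle q - 8)]
    rw [r0, z0] at h1
    rcases h with h | h
    · exact h (by rw [h1]; norm_num)
    · linarith

theorem coe_angle (p : Base) : ((angle p : ℝ) : AddCircle (10 : ℝ)) = p.2 :=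
  (AddCircle.equivIco (10 : ℝ) 0).symm_apply_apply p.2

theorem angle_mk (r : Icc (-1 : ℝ) 1) {x : ℝ} (hx : x ∈ Ico (0 : ℝ) 10) :
    angle (r, (x : AddCircle (10 : ℝ))) = x := by
  have := AddCircle.coe_equivIco_mk_apply (p := (10 : ℝ)) x
  rw [angle]
  rw [this, Int.fract_eq_self.2 ⟨by linarith [hx.1], by linarith [hx.2]⟩]
  ring

/-- Every point of angle `6` in the first half of the plug whose radius is at most the maximal one
over its height is a point of the self-insertion. The new radius is the root
`2 - 2 √(1 - w)` of `x - x² / 4 = w`. -/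
theorem exists_sigma_eq {u : Support} (hu : u.1.2 = ((6 : ℝ) : AddCircle (10 : ℝ)))
    (h1 : (u.2 : ℝ) ≤ 1) (hw : radius u.1 + 2 * (u.2 : ℝ) ^ 2 ≤ 3 / 4) :
    ∃ q : insertionDomain, sigma q = u ∧
      radius q = 2 - 2 * √(1 - (radius u.1 + 2 * (u.2 : ℝ) ^ 2)) := by
  obtain ⟨⟨r, θ⟩, z⟩ := u
  obtain ⟨r, hr⟩ := r
  obtain ⟨z, hz⟩ := z
  simp only [radius] at *
  set w := r + 2 * z ^ 2 with hwdef
  have hw' : -1 ≤ w := by nlinarith [hr.1]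
  have s1 : 1 / 2 ≤ √(1 - w) := Real.le_sqrt_of_sq_le (by norm_num; linarith)
  have s2 : √(1 - w) ≤ 3 / 2 := Real.sqrt_le_iff.2 ⟨by norm_num, by norm_num; linarith⟩
  have s3 : √(1 - w) ^ 2 = 1 - w := Real.sq_sqrt (by linarith)
  set p : Base := (⟨2 - 2 * √(1 - w), by linarith, by linarith⟩, ((2 - z : ℝ) : AddCircle (10 : ℝ)))
    with hp
  have ha : angle p = 2 - z := angle_mk _ ⟨by linarith [hz.1], by linarith [hz.1]⟩
  have hrad : radius p = 2 - 2 * √(1 - w) := rfl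
  have e : radius p - radius p ^ 2 / 4 - 2 * (angle p - 2) ^ 2 = r := by
    rw [ha, hrad]
    nlinarith
  have hS : p ∈ domainS := ⟨by rw [e]; exact hr, by rw [ha]; exact ⟨by linarith [hz.1], by linarith⟩⟩
  refine ⟨⟨p, Or.inl hS⟩, ?_, hrad⟩
  simp only [sigma, dif_pos hS]
  refine support_ext e hu.symm ?_
  simp only [ha]
  ring

/-- A leaf of small negative radius `r` moves so slowly through height `0` that it meets the
self-insertion there, and enters the inserted plug with radius in `(r, 0)`. -/
theorem exists_sigma_of_radius_neg {p : Base} (h1 : -(1 / 20) < radius p) (h2 : radius p < 0) :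
    ∃ h ∈ Icc (-1 : ℝ) 1, ∃ q : insertionDomain, sigma q = rising p 3 h ∧
      radius p < radius q ∧ radius q < 0 := by
  have hc : Climbs (radius p) 3 := ⟨by norm_num, Or.inl h2.ne⟩
  set r := radius p with hr
  have r2 : r ^ 2 < 1 / 400 := by nlinarith
  have r2' : 0 < r ^ 2 := by nlinarith
  have rs : r ^ 2 ≤ -r / 20 := by nlinarith
  have bd : ∀ x ∈ Icc (-(6 * r ^ 2)) (6 * r ^ 2), r ^ 2 + localHeight x ^ 6 ≤ 6 / 5 * r ^ 2 := by
    intro x hx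
    rw [localHeight, if_pos (by linarith [hx.2])]
    have a : x ^ 2 ≤ (6 * r ^ 2) ^ 2 := sq_le_sq' hx.1 hx.2
    have a1 : x ^ 2 ≤ 36 / 400 * r ^ 2 := by nlinarith
    have a2 : x ^ 2 ≤ 1 := by nlinarith
    have a3 : x ^ 6 ≤ x ^ 2 := by
      have : x ^ 6 = x ^ 2 * (x ^ 2) ^ 2 := by ring
      rw [this]
      nlinarith [sq_nonneg x, sq_nonneg (x ^ 2)]
    linarith
  obtain ⟨x, hx, e⟩ := exists_angle_six (p := p) hc (a := -(6 * r ^ 2)) (b := 6 * r ^ 2)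
    (by linarith) (by linarith) (by linarith) (by linarith) (by positivity) bd (by linarith)
  have hx1 : x ∈ Icc (-1 : ℝ) 1 := ⟨by linarith [hx.1], by linarith [hx.2]⟩
  have hht := rising_height p 3 (h := x) ⟨hx1.1, by linarith [hx1.2]⟩
  have a : x ^ 2 ≤ (6 * r ^ 2) ^ 2 := sq_le_sq' hx.1 hx.2
  have a1 : x ^ 2 ≤ 36 / 400 * r ^ 2 := by nlinarith
  obtain ⟨q, hq, hqr⟩ := exists_sigma_eq (u := rising p 3 x) e (by rw [hht]; exact hx1.2) (by
    rw [hht, rising_radius]; nlinarith)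
  rw [hht, rising_radius] at hqr
  refine ⟨x, hx1, q, hq, ?_, ?_⟩
  · have : radius (sigma q).1 = r := by rw [hq]; rfl
    have := radius_sigma_lt q (by rw [this]; exact Or.inl h2.ne)
    rwa [hq] at this
  · rw [hqr]
    have : 1 < √(1 - (radius p + 2 * x ^ 2)) := by
      rw [Real.lt_sqrt (by norm_num)]
      nlinarith
    linarith

/-- A leaf of radius `0` meets the self-insertion at heights arbitrarily close to `0`. -/
theorem exists_sigma_of_radius_zero {p : Base} (h0 : radius p = 0) {d : ℝ} (hd : 0 < d)
    (hd' : d ≤ 1 / 4) : ∃ h ∈ Icc (-(2 * d)) (-d), ∃ q : insertionDomain,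
      sigma q = rising p (-d) h := by
  have hc : Climbs (radius p) (-d) := ⟨⟨by linarith, by linarith⟩, Or.inr (by linarith)⟩
  have d4 : d ^ 5 ≤ (1 / 4) ^ 5 := pow_le_pow_left₀ hd.le hd' 5
  have bd : ∀ x ∈ Icc (-(2 * d)) (-d), radius p ^ 2 + localHeight x ^ 6 ≤ (2 * d) ^ 6 := by
    intro x hx
    rw [localHeight, if_pos (by linarith [hx.2]), h0]
    have a : x ^ 2 ≤ (2 * d) ^ 2 := sq_le_sq' hx.1 (by linarith [hx.2])
    calc 0 ^ 2 + x ^ 6 = (x ^ 2) ^ 3 := by ring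
      _ ≤ ((2 * d) ^ 2) ^ 3 := pow_le_pow_left₀ (sq_nonneg x) a 3
      _ = (2 * d) ^ 6 := by ring
  obtain ⟨x, hx, e⟩ := exists_angle_six (p := p) hc (a := -(2 * d)) (b := -d)
    (by linarith) (by linarith) le_rfl (by linarith) (by positivity) bd (by
      have : (2 * d) ^ 6 = 64 * (d ^ 5 * d) := by ring
      nlinarith)
  have hx1 : x ∈ Icc (-1 : ℝ) 3 := ⟨by linarith [hx.1], by linarith [hx.2]⟩
  have hht := rising_height p (-d) hx1
  obtain ⟨q, hq, -⟩ := exists_sigma_eq (u := rising p (-d) x) e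
    (by rw [hht]; linarith [hx.2]) (by
    rw [hht, rising_radius, h0]; nlinarith [hx.1, hx.2])
  exact ⟨x, hx, q, hq⟩

/-- A leaf path meets the image of the self-insertion in finitely many points. -/
theorem wilson_finite_sigma {γ : ℝ → Support} {a b : ℝ} (h : wilsonFoliation.IsPath γ a b) :
    (γ '' Icc a b ∩ range sigma).Finite := by
  refine ((wilson_finite_angle h 6).union (wilson_finite_angle h 4)).subset ?_
  rintro _ ⟨hu, q, rfl⟩
  exact (sigma_circle q).imp (fun e => ⟨hu, e⟩) fun e => ⟨hu, e⟩

/-- A leaf path meets the bottom in at most one point. -/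
theorem wilson_subsingleton_bottom {γ : ℝ → Support} {a b : ℝ}
    (h : wilsonFoliation.IsPath γ a b) : (γ '' Icc a b ∩ range bottom).Subsingleton := by
  rintro _ ⟨⟨s, hs, rfl⟩, p, hp⟩ _ ⟨⟨t, ht, rfl⟩, p', hp'⟩
  have h3 : ((γ s).2 : ℝ) = -1 := by rw [← hp]; rfl
  have h4 : ((γ t).2 : ℝ) = -1 := by rw [← hp']; rfl
  refine wilson_eq_of_height_eq h hs ht (h3.trans h4.symm) ?_
  rw [h3, show localHeight (-1) = -1 by norm_num [localHeight]]
  positivity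

/-! ### Chains of arcs -/

section Chains

variable {X : Type*}

/-- Concatenations of arcs, where `A x y S` means that `S` is an arc from `x` to `y`. -/
inductive Chain (A : X → X → Set X → Prop) : X → X → Set X → Prop
  | single {x y : X} {S : Set X} (h : A x y S) : Chain A x y S
  | trans {x y z : X} {S T : Set X} (h : Chain A x y S) (k : Chain A y z T) : Chain A x z (S ∪ T)

/-- Arcs contain their ends, and can be divided at each of their points. -/
structure ArcSystem (A : X → X → Set X → Prop) : Prop where
  left_mem : ∀ {x y S}, A x y S → x ∈ S
  right_mem : ∀ {x y S}, A x y S → y ∈ S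
  split_left : ∀ {x y S w}, A x y S → w ∈ S → ∃ T ⊆ S, A x w T
  split_right : ∀ {x y S w}, A x y S → w ∈ S → ∃ T ⊆ S, A w y T

/-- Of two arcs with the same start, one contains the end of the other. -/
def Deterministic (A : X → X → Set X → Prop) : Prop :=
  ∀ {x y z S T}, A x y S → A x z T → z ∈ S ∨ y ∈ T

/-- Arcs run through backwards. -/
def reverseArc (A : X → X → Set X → Prop) : X → X → Set X → Prop := fun x y S => A y x S

variable {A : X → X → Set X → Prop}

theorem ArcSystem.reverse (h : ArcSystem A) : ArcSystem (reverseArc A) :=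
  ⟨h.right_mem, h.left_mem, h.split_right, h.split_left⟩

theorem ArcSystem.chain (h : ArcSystem A) : ArcSystem (Chain A) where
  left_mem c := by
    induction c with
    | single h' => exact h.left_mem h'
    | trans _ _ ih _ => exact Or.inl ih
  right_mem c := by
    induction c with
    | single h' => exact h.right_mem h'
    | trans _ _ _ ih => exact Or.inr ih
  split_left {x y S w} c hw := by
    induction c with
    | single h' =>
      obtain ⟨T, hT, a⟩ := h.split_left h' hw
      exact ⟨T, hT, .single a⟩
    | trans c₁ c₂ ih₁ ih₂ =>
      rcases hw with hw | hw
      · obtain ⟨T, hT, a⟩ := ih₁ hw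
        exact ⟨T, hT.trans subset_union_left, a⟩
      · obtain ⟨T, hT, a⟩ := ih₂ hw
        exact ⟨_, union_subset_union_right _ hT, .trans c₁ a⟩
  split_right {x y S w} c hw := by
    induction c with
    | single h' =>
      obtain ⟨T, hT, a⟩ := h.split_right h' hw
      exact ⟨T, hT, .single a⟩
    | trans c₁ c₂ ih₁ ih₂ =>
      rcases hw with hw | hw
      · obtain ⟨T, hT, a⟩ := ih₁ hw
        exact ⟨_, union_subset_union_left _ hT, .trans a c₂⟩
      · obtain ⟨T, hT, a⟩ := ih₂ hw
        exact ⟨T, hT.trans subset_union_right, a⟩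

theorem Chain.reverse {x y : X} {S : Set X} (c : Chain A x y S) : Chain (reverseArc A) y x S := by
  induction c with
  | single h => exact .single h
  | trans _ _ ih₁ ih₂ => rw [union_comm]; exact .trans ih₂ ih₁

theorem Deterministic.chain (h : ArcSystem A) (d : Deterministic A) : Deterministic (Chain A) := by
  have aux : ∀ {x z T}, Chain A x z T → ∀ {y S}, A x y S → z ∈ S ∨ y ∈ T := by
    intro x z T c
    induction c with
    | single h' => exact fun a => d a h'
    | trans c₁ c₂ ih₁ ih₂ =>
      intro y S a
      rcases ih₁ a with hw | hw
      · obtain ⟨S₂, hS, a₂⟩ := h.split_right a hw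
        exact (ih₂ a₂).imp (fun e => hS e) Or.inr
      · exact Or.inr (Or.inl hw)
  intro x y z S T c
  induction c generalizing z T with
  | single h' => exact fun k => aux k h'
  | trans c₁ c₂ ih₁ ih₂ =>
    intro k
    rcases ih₁ k with hw | hw
    · exact Or.inl (Or.inl hw)
    · obtain ⟨T₂, hT, k₂⟩ := h.chain.split_right k hw
      exact (ih₂ k₂).imp Or.inr fun e => hT e

end Chains

/-! ### Leaves -/

section Leaves

variable {X : Type*} {𝓕 : LeafPaths X}

theorem LeafPaths.continuous_leafPath {γ : ℝ → X} {a b : ℝ} (h : 𝓕.IsPath γ a b) :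
    @Continuous (Icc a b) X inferInstance 𝓕.leafTopology fun t => γ t := by
  let _ := 𝓕.leafTopology
  rw [continuous_iff_coinduced_le]
  exact le_iSup (fun q : {q : (ℝ → X) × ℝ × ℝ // 𝓕.IsPath q.1 q.2.1 q.2.2} =>
    TopologicalSpace.coinduced (fun t : Icc q.1.2.1 q.1.2.2 => q.1.1 t) inferInstance)
    ⟨(γ, a, b), h⟩

theorem LeafPaths.isClosed_leafTopology {Z : Set X}
    (h : ∀ γ a b, 𝓕.IsPath γ a b → IsClosed {t : Icc a b | γ t ∈ Z}) :
    @IsClosed X 𝓕.leafTopology Z := by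
  let _ := 𝓕.leafTopology
  rw [isClosed_iSup_iff]
  rintro ⟨⟨γ, a, b⟩, hq⟩
  rw [isClosed_coinduced]
  exact h γ a b hq

theorem LeafPaths.isOpen_leafTopology {Z : Set X}
    (h : ∀ γ a b, 𝓕.IsPath γ a b → IsOpen {t : Icc a b | γ t ∈ Z}) :
    @IsOpen X 𝓕.leafTopology Z := by
  let _ := 𝓕.leafTopology
  rw [isOpen_iSup_iff]
  rintro ⟨⟨γ, a, b⟩, hq⟩
  rw [isOpen_coinduced]
  exact h γ a b hq

theorem LeafPaths.leaf_eq {x y : X} (h : y ∈ 𝓕.leaf x) : 𝓕.leaf y = 𝓕.leaf x := by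
  let _ := 𝓕.leafTopology
  exact (connectedComponent_eq h).symm

theorem LeafPaths.mem_leaf_of_path {γ : ℝ → X} {a b : ℝ} (h : 𝓕.IsPath γ a b) {s t : ℝ}
    (hs : s ∈ Icc a b) (ht : t ∈ Icc a b) : γ t ∈ 𝓕.leaf (γ s) := by
  let _ := 𝓕.leafTopology
  have c := LeafPaths.continuous_leafPath h
  have : PreconnectedSpace (Icc a b) := isPreconnected_iff_preconnectedSpace.1 isPreconnected_Icc
  have p : IsPreconnected (range fun t : Icc a b => γ t) := isPreconnected_range c
  exact p.subset_connectedComponent ⟨⟨s, hs⟩, rfl⟩ ⟨⟨t, ht⟩, rfl⟩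

/-- A leaf lies in every set that is saturated under leaf paths and meets it: such a set is open
and closed in the leaf topology. -/
theorem LeafPaths.leaf_subset {x : X} {C : Set X} (hx : x ∈ C)
    (h : ∀ γ a b, 𝓕.IsPath γ a b → ∀ s ∈ Icc a b, ∀ t ∈ Icc a b, γ s ∈ C → γ t ∈ C) :
    𝓕.leaf x ⊆ C := by
  have dich : ∀ γ a b, 𝓕.IsPath γ a b →
      {t : Icc a b | γ t ∈ C} = ∅ ∨ {t : Icc a b | γ t ∈ C} = univ := by
    intro γ a b hγ
    rcases eq_empty_or_nonempty {t : Icc a b | γ t ∈ C} with h0 | ⟨s, hs⟩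
    · exact Or.inl h0
    · exact Or.inr (eq_univ_of_forall fun t => h γ a b hγ s s.2 t t.2 hs)
  have hc := LeafPaths.isClosed_leafTopology (𝓕 := 𝓕) (Z := C) fun γ a b hγ => by
    rcases dich γ a b hγ with e | e <;> rw [e]
    exacts [isClosed_empty, isClosed_univ]
  have ho := LeafPaths.isOpen_leafTopology (𝓕 := 𝓕) (Z := C) fun γ a b hγ => by
    rcases dich γ a b hγ with e | e <;> rw [e]
    exacts [isOpen_empty, isOpen_univ]
  let _ := 𝓕.leafTopology
  exact IsClopen.connectedComponent_subset ⟨hc, ho⟩ hx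

end Leaves

/-! ### Leaf paths of the self-inserted plug -/

namespace SelfInsertion

variable (𝒮 : SelfInsertion)

/-- The point of `W` is not removed by the self-insertion. -/
def Kept (u : Support) : Prop := u ∉ 𝒮.slab '' {y | ((y.1 : Base), y.2) ∉ 𝒮.collar}

open Classical in
/-- The point of `Ŵ` given by a point of `W` that is not removed. The value at a removed point
is irrelevant. -/
def point (u : Support) : 𝒮.Hat :=
  if h : 𝒮.Kept u then 𝒮.proj ⟨u, h⟩ else 𝒮.hatBottom (⟨0, by norm_num⟩, 0)

/-- The point of the slab over `q` at parameter `t`, cut off to `[0, 1]`. -/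
def slabAt (q : insertionDomain) (t : ℝ) : Support := 𝒮.slab (q, projIcc 0 1 zero_le_one t)

/-- The point of the attaching map over `p` at parameter `t`, cut off to `[0, 1]`. -/
def attachAt (p : Base) (t : ℝ) : Support := 𝒮.attach (p, projIcc 0 1 zero_le_one t)

/-- The fiber parameter `t` over `p`, cut off to `[0, 1]`, belongs to the collar. -/
def InCollar (p : Base) (t : ℝ) : Prop := (p, projIcc 0 1 zero_le_one t) ∈ 𝒮.collar

variable {𝒮}

theorem point_coe (x : 𝒮.Cut) : 𝒮.point x.1 = 𝒮.proj x := by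
  have h : 𝒮.Kept x.1 := x.2
  rw [point, dif_pos h]
  rfl

theorem kept_bottom (p : Base) : 𝒮.Kept (bottom p) := 𝒮.bottom_not_mem p

theorem point_bottom (p : Base) : 𝒮.point (bottom p) = 𝒮.hatBottom p := by
  rw [point, dif_pos (𝒮.kept_bottom p)]
  rfl

theorem kept_of_not_mem_range {u : Support} (h : u ∉ range 𝒮.slab) : 𝒮.Kept u :=
  fun ⟨y, _, hy⟩ => h ⟨y, hy⟩

theorem kept_top (p : Base) : 𝒮.Kept (top p) :=
  kept_of_not_mem_range fun h => disjoint_left.1 𝒮.slab_disjoint_top h ⟨p, rfl⟩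

theorem bottom_not_mem_range_slab (p : Base) : bottom p ∉ range 𝒮.slab :=
  fun h => disjoint_left.1 𝒮.slab_disjoint_bottom h ⟨p, rfl⟩

theorem top_not_mem_range_slab (p : Base) : top p ∉ range 𝒮.slab :=
  fun h => disjoint_left.1 𝒮.slab_disjoint_top h ⟨p, rfl⟩

theorem kept_slab {q : insertionDomain} {t : unitInterval} :
    𝒮.Kept (𝒮.slab (q, t)) ↔ ((q : Base), t) ∈ 𝒮.collar := by
  constructor
  · intro h
    by_contra hc
    exact h ⟨(q, t), hc, rfl⟩
  · rintro h ⟨y, hy, e⟩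
    rw [𝒮.slab_isEmbedding.injective e] at hy
    exact hy h

theorem kept_slabAt {q : insertionDomain} {t : ℝ} : 𝒮.Kept (𝒮.slabAt q t) ↔ 𝒮.InCollar q t :=
  kept_slab

theorem attach_not_mem_range_slab {q : insertionDomain} {t : unitInterval}
    (h : ((q : Base), t) ∈ 𝒮.collar) : 𝒮.attach ((q : Base), t) ∉ range 𝒮.slab := fun hr =>
  disjoint_left.1 𝒮.slab_disjoint_attach hr
    (subset_closure ⟨((q : Base), t), ⟨h, q.2⟩, rfl⟩)

theorem attach_injOn : InjOn 𝒮.attach 𝒮.collar := fun x hx y hy e =>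
  congrArg Subtype.val (𝒮.attach_isOpenEmbedding.injective (a₁ := ⟨x, hx⟩) (a₂ := ⟨y, hy⟩) e)

theorem inCollar_zero (p : Base) : 𝒮.InCollar p 0 :=
  𝒮.boundary_subset_collar (Or.inr (Or.inl (by simp)))

theorem inCollar_one (p : Base) : 𝒮.InCollar p 1 :=
  𝒮.boundary_subset_collar (Or.inr (Or.inr (by simp)))

theorem slabAt_zero (q : insertionDomain) : 𝒮.slabAt q 0 = sigma q := by
  simp [slabAt, 𝒮.slab_zero]

theorem attachAt_zero (p : Base) : 𝒮.attachAt p 0 = bottom p := by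
  simp [attachAt, 𝒮.attach_zero]

theorem attachAt_one (p : Base) : 𝒮.attachAt p 1 = top p := by
  simp [attachAt, 𝒮.attach_one]

/-- Two points of `W` are identified in `Ŵ` only directly, since the glued pieces are disjoint. -/
theorem point_eq_point_iff {u v : Support} (hu : 𝒮.Kept u) (hv : 𝒮.Kept v) :
    𝒮.point u = 𝒮.point v ↔ u = v ∨ 𝒮.Glue ⟨u, hu⟩ ⟨v, hv⟩ ∨ 𝒮.Glue ⟨v, hv⟩ ⟨u, hu⟩ := by
  constructor
  · intro h
    rw [point, dif_pos hu, point, dif_pos hv] at h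
    have key : ∀ x y : 𝒮.Cut, Relation.EqvGen 𝒮.Glue x y → x = y ∨ 𝒮.Glue x y ∨ 𝒮.Glue y x := by
      intro x y hxy
      induction hxy with
      | rel x y h => exact Or.inr (Or.inl h)
      | refl x => exact Or.inl rfl
      | symm x y _ ih => exact ih.imp Eq.symm Or.symm
      | trans x y z _ _ ih₁ ih₂ =>
        rcases ih₁ with rfl | ⟨q, t, h1, h2, h3⟩ | ⟨q, t, h1, h2, h3⟩
        · exact ih₂
        · rcases ih₂ with rfl | ⟨q', t', k1, k2, k3⟩ | ⟨q', t', k1, k2, k3⟩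
          · exact Or.inr (Or.inl ⟨q, t, h1, h2, h3⟩)
          · exact absurd ⟨_, h3.symm.trans k2⟩ (attach_not_mem_range_slab k1)
          · have e := 𝒮.slab_isEmbedding.injective (h3.symm.trans k3)
            rw [Prod.mk.injEq] at e
            obtain ⟨rfl, rfl⟩ := e
            exact Or.inl (Subtype.ext (h2.trans k2.symm))
        · rcases ih₂ with rfl | ⟨q', t', k1, k2, k3⟩ | ⟨q', t', k1, k2, k3⟩
          · exact Or.inr (Or.inr ⟨q, t, h1, h2, h3⟩)
          · have e := attach_injOn h1 k1 (h2.symm.trans k2)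
            rw [Prod.mk.injEq] at e
            obtain ⟨e1, rfl⟩ := e
            obtain rfl := Subtype.ext e1
            exact Or.inl (Subtype.ext (h3.trans k3.symm))
          · exact absurd ⟨_, k3.symm.trans h2⟩ (attach_not_mem_range_slab h1)
    rcases key _ _ (Quot.eqvGen_exact h) with e | e
    · exact Or.inl (congrArg Subtype.val e)
    · exact Or.inr e
  · rw [point, dif_pos hu, point, dif_pos hv]
    rintro (rfl | h | h)
    · rfl
    · exact Quot.sound h
    · exact (Quot.sound h).symm

theorem point_slabAt {q : insertionDomain} {t : ℝ} (h : 𝒮.InCollar q t) :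
    𝒮.point (𝒮.slabAt q t) = 𝒮.point (𝒮.attachAt q t) := by
  have h1 : 𝒮.Kept (𝒮.slabAt q t) := kept_slabAt.2 h
  have h2 : 𝒮.Kept (𝒮.attachAt q t) := kept_of_not_mem_range (attach_not_mem_range_slab h)
  exact (point_eq_point_iff h1 h2).2 (Or.inr (Or.inr ⟨q, _, h, rfl, rfl⟩))

theorem point_sigma (q : insertionDomain) : 𝒮.point (sigma q) = 𝒮.hatBottom q := by
  rw [← slabAt_zero, point_slabAt (inCollar_zero _), attachAt_zero, point_bottom]

theorem slabAt_path (q : insertionDomain) {s t : ℝ} (hs : 0 ≤ s) (hst : s ≤ t) (ht : t ≤ 1) :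
    wilsonFoliation.IsPath (𝒮.slabAt q) s t :=
  wilson_sub (𝒮.slab_path q) hs hst ht

theorem attachAt_path {p : Base} {s t : ℝ} (hst : s ≤ t)
    (h : ∀ x ∈ Icc s t, 𝒮.InCollar p x) : wilsonFoliation.IsPath (𝒮.attachAt p) s t := by
  refine (𝒮.attach_path (fun x => (p, projIcc 0 1 zero_le_one x)) s t h).1
    ⟨hst, ?_, fun _ _ => rfl, (monotone_projIcc zero_le_one).monotoneOn (Icc s t)⟩
  exact (continuous_const.prodMk continuous_projIcc).continuousOn

variable (𝒮)

/-- The image in `Ŵ` of a leaf path of `W` that avoids the removed part. -/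
def Piece (x y : 𝒮.Hat) (S : Set 𝒮.Hat) : Prop :=
  ∃ (γ : ℝ → Support) (a b : ℝ), wilsonFoliation.IsPath γ a b ∧ (∀ t ∈ Icc a b, 𝒮.Kept (γ t)) ∧
    x = 𝒮.point (γ a) ∧ y = 𝒮.point (γ b) ∧ S = (fun t => 𝒮.point (γ t)) '' Icc a b

variable {𝒮}

theorem arcSystem_piece : ArcSystem 𝒮.Piece where
  left_mem := by
    rintro x y S ⟨γ, a, b, h, -, rfl, rfl, rfl⟩
    exact ⟨a, left_mem_Icc.2 (wilson_le h), rfl⟩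
  right_mem := by
    rintro x y S ⟨γ, a, b, h, -, rfl, rfl, rfl⟩
    exact ⟨b, right_mem_Icc.2 (wilson_le h), rfl⟩
  split_left := by
    rintro x y S w ⟨γ, a, b, h, k, rfl, rfl, rfl⟩ ⟨t, ht, rfl⟩
    have sub : Icc a t ⊆ Icc a b := Icc_subset_Icc_right ht.2
    exact ⟨_, image_mono sub, γ, a, t, wilson_sub h le_rfl ht.1 ht.2,
      fun x hx => k x (sub hx), rfl, rfl, rfl⟩
  split_right := by
    rintro x y S w ⟨γ, a, b, h, k, rfl, rfl, rfl⟩ ⟨t, ht, rfl⟩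
    have sub : Icc t b ⊆ Icc a b := Icc_subset_Icc_left ht.1
    exact ⟨_, image_mono sub, γ, t, b, wilson_sub h ht.1 ht.2 le_rfl,
      fun x hx => k x (sub hx), rfl, rfl, rfl⟩

/-- Two leaf paths of `W` that start at glued points stay glued until one of them ends: they
follow the same fiber of the collar, and the path through `α` cannot go beyond the top of `W`. -/
theorem det_forward_of_glued {γ δ : ℝ → Support} {a b c d : ℝ}
    (hγ : wilsonFoliation.IsPath γ a b) (hδ : wilsonFoliation.IsPath δ c d)
    (kδ : ∀ t ∈ Icc c d, 𝒮.Kept (δ t)) {q : insertionDomain} {t₀ : ℝ} (ht₀ : t₀ ∈ Icc (0 : ℝ) 1)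
    (e₁ : γ a = 𝒮.attachAt q t₀) (e₂ : δ c = 𝒮.slabAt q t₀) :
    𝒮.point (δ d) ∈ (fun t => 𝒮.point (γ t)) '' Icc a b ∨
      𝒮.point (γ b) ∈ (fun t => 𝒮.point (δ t)) '' Icc c d := by
  obtain ⟨t₁, ht₁, sub, hend⟩ : ∃ t₁ ∈ Icc t₀ 1, 𝒮.slabAt q '' Icc t₀ t₁ ⊆ δ '' Icc c d ∧
      (𝒮.slabAt q t₁ = δ d ∨ t₁ = 1) := by
    rcases wilson_det_forward (slabAt_path q ht₀.1 ht₀.2 le_rfl) hδ e₂.symm with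
      ⟨s, hs, es, im⟩ | ⟨s, hs, es, im⟩
    · exact ⟨s, hs, im.subset, Or.inl es⟩
    · exact ⟨1, ⟨ht₀.2, le_rfl⟩, im ▸ image_mono (Icc_subset_Icc_right hs.2), Or.inr rfl⟩
  have hcol : ∀ x ∈ Icc t₀ t₁, 𝒮.InCollar q x := fun x hx => by
    obtain ⟨y, hy, ey⟩ := sub (mem_image_of_mem _ hx)
    exact kept_slabAt.1 (ey ▸ kδ y hy)
  have inδ : ∀ x ∈ Icc t₀ t₁, 𝒮.point (𝒮.attachAt q x) ∈ (fun t => 𝒮.point (δ t)) '' Icc c d :=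
    fun x hx => by
      obtain ⟨y, hy, ey⟩ := sub (mem_image_of_mem _ hx)
      exact ⟨y, hy, by simp only [ey]; exact point_slabAt (hcol x hx)⟩
  rcases wilson_det_forward (attachAt_path ht₁.1 hcol) hγ e₁.symm with
    ⟨s, hs, es, -⟩ | ⟨s, hs, es, -⟩
  · exact Or.inr (es ▸ inδ s hs)
  · rcases hend with hend | rfl
    · refine Or.inl ⟨s, hs, ?_⟩
      simp only [es, ← hend]
      exact (point_slabAt (hcol t₁ (right_mem_Icc.2 ht₁.1))).symm
    · rw [attachAt_one] at es
      have := wilson_eq_of_top (wilson_sub hγ hs.1 hs.2 le_rfl) es (right_mem_Icc.2 hs.2)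
      rw [this, ← 𝒮.attachAt_one]
      exact Or.inr (inδ 1 (right_mem_Icc.2 ht₁.1))

/-- The same for two leaf paths that end at glued points, followed backwards: the path through `α`
cannot go below the bottom of `W`. -/
theorem det_backward_of_glued {γ δ : ℝ → Support} {a b c d : ℝ}
    (hγ : wilsonFoliation.IsPath γ a b) (hδ : wilsonFoliation.IsPath δ c d)
    (kδ : ∀ t ∈ Icc c d, 𝒮.Kept (δ t)) {q : insertionDomain} {t₀ : ℝ} (ht₀ : t₀ ∈ Icc (0 : ℝ) 1)
    (e₁ : γ b = 𝒮.attachAt q t₀) (e₂ : δ d = 𝒮.slabAt q t₀) :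
    𝒮.point (δ c) ∈ (fun t => 𝒮.point (γ t)) '' Icc a b ∨
      𝒮.point (γ a) ∈ (fun t => 𝒮.point (δ t)) '' Icc c d := by
  obtain ⟨t₁, ht₁, sub, hend⟩ : ∃ t₁ ∈ Icc 0 t₀, 𝒮.slabAt q '' Icc t₁ t₀ ⊆ δ '' Icc c d ∧
      (𝒮.slabAt q t₁ = δ c ∨ t₁ = 0) := by
    rcases wilson_det_backward (slabAt_path q le_rfl ht₀.1 ht₀.2) hδ e₂.symm with
      ⟨s, hs, es, im⟩ | ⟨s, hs, es, im⟩
    · exact ⟨s, hs, im.subset, Or.inl es⟩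
    · exact ⟨0, ⟨le_rfl, ht₀.1⟩, im ▸ image_mono (Icc_subset_Icc_left hs.1), Or.inr rfl⟩
  have hcol : ∀ x ∈ Icc t₁ t₀, 𝒮.InCollar q x := fun x hx => by
    obtain ⟨y, hy, ey⟩ := sub (mem_image_of_mem _ hx)
    exact kept_slabAt.1 (ey ▸ kδ y hy)
  have inδ : ∀ x ∈ Icc t₁ t₀, 𝒮.point (𝒮.attachAt q x) ∈ (fun t => 𝒮.point (δ t)) '' Icc c d :=
    fun x hx => by
      obtain ⟨y, hy, ey⟩ := sub (mem_image_of_mem _ hx)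
      exact ⟨y, hy, by simp only [ey]; exact point_slabAt (hcol x hx)⟩
  rcases wilson_det_backward (attachAt_path ht₁.2 hcol) hγ e₁.symm with
    ⟨s, hs, es, -⟩ | ⟨s, hs, es, -⟩
  · exact Or.inr (es ▸ inδ s hs)
  · rcases hend with hend | rfl
    · refine Or.inl ⟨s, hs, ?_⟩
      simp only [es, ← hend]
      exact (point_slabAt (hcol t₁ (left_mem_Icc.2 ht₁.2))).symm
    · rw [attachAt_zero] at es
      have := wilson_eq_of_bottom (wilson_sub hγ le_rfl hs.1 hs.2) es (left_mem_Icc.2 hs.1)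
      rw [this, ← 𝒮.attachAt_zero]
      exact Or.inr (inδ 0 (left_mem_Icc.2 ht₁.2))

theorem exists_of_glue {u v : Support} {hu : 𝒮.Kept u} {hv : 𝒮.Kept v}
    (h : 𝒮.Glue ⟨u, hu⟩ ⟨v, hv⟩) : ∃ (q : insertionDomain), ∃ t ∈ Icc (0 : ℝ) 1,
      u = 𝒮.attachAt q t ∧ v = 𝒮.slabAt q t := by
  obtain ⟨q, t, -, h1, h2⟩ := h
  refine ⟨q, t, t.2, ?_, ?_⟩
  · rw [attachAt, projIcc_val]; exact h1
  · rw [slabAt, projIcc_val]; exact h2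

theorem deterministic_piece : Deterministic 𝒮.Piece := by
  rintro x y z S T ⟨γ, a, b, hγ, kγ, rfl, rfl, rfl⟩ ⟨δ, c, d, hδ, kδ, e, rfl, rfl⟩
  rcases (point_eq_point_iff (kγ a (left_mem_Icc.2 (wilson_le hγ)))
    (kδ c (left_mem_Icc.2 (wilson_le hδ)))).1 e with e | h | h
  · rcases wilson_det_forward hγ hδ e with ⟨s, hs, es, -⟩ | ⟨s, hs, es, -⟩
    · exact Or.inl ⟨s, hs, by simp only [es]⟩
    · exact Or.inr ⟨s, hs, by simp only [es]⟩
  · obtain ⟨q, t, ht, e₁, e₂⟩ := exists_of_glue h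
    exact det_forward_of_glued hγ hδ kδ ht e₁ e₂
  · obtain ⟨q, t, ht, e₁, e₂⟩ := exists_of_glue h
    exact (det_forward_of_glued hδ hγ kγ ht e₁ e₂).symm

theorem deterministic_reverse_piece : Deterministic (reverseArc 𝒮.Piece) := by
  rintro x y z S T ⟨γ, a, b, hγ, kγ, rfl, rfl, rfl⟩ ⟨δ, c, d, hδ, kδ, rfl, e, rfl⟩
  rcases (point_eq_point_iff (kγ b (right_mem_Icc.2 (wilson_le hγ)))
    (kδ d (right_mem_Icc.2 (wilson_le hδ)))).1 e with e | h | h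
  · rcases wilson_det_backward hγ hδ e with ⟨s, hs, es, -⟩ | ⟨s, hs, es, -⟩
    · exact Or.inl ⟨s, hs, by simp only [es]⟩
    · exact Or.inr ⟨s, hs, by simp only [es]⟩
  · obtain ⟨q, t, ht, e₁, e₂⟩ := exists_of_glue h
    exact det_backward_of_glued hγ hδ kδ ht e₁ e₂
  · obtain ⟨q, t, ht, e₁, e₂⟩ := exists_of_glue h
    exact (det_backward_of_glued hδ hγ kγ ht e₁ e₂).symm

variable (𝒮)

/-- The leaf paths of `Ŵ`, as point sets. -/
abbrev Arc : 𝒮.Hat → 𝒮.Hat → Set 𝒮.Hat → Prop := Chain 𝒮.Piece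

/-- The point `y` lies ahead of `x` (or is `x`) on a leaf of `Ŵ`. -/
def Ahead (x y : 𝒮.Hat) : Prop := ∃ S, 𝒮.Arc x y S

variable {𝒮}

theorem arcSystem_arc : ArcSystem 𝒮.Arc := arcSystem_piece.chain

theorem arc_det {x y z : 𝒮.Hat} {S T : Set 𝒮.Hat} (h : 𝒮.Arc x y S) (k : 𝒮.Arc x z T) :
    z ∈ S ∨ y ∈ T := deterministic_piece.chain arcSystem_piece h k

theorem arc_det_reverse {x y z : 𝒮.Hat} {S T : Set 𝒮.Hat} (h : 𝒮.Arc y x S) (k : 𝒮.Arc z x T) :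
    z ∈ S ∨ y ∈ T :=
  deterministic_reverse_piece.chain arcSystem_piece.reverse h.reverse k.reverse

theorem exists_kept (x : 𝒮.Hat) : ∃ u, 𝒮.Kept u ∧ 𝒮.point u = x := by
  obtain ⟨u, rfl⟩ := Quot.exists_rep x
  exact ⟨u.1, u.2, point_coe u⟩

theorem Ahead.refl (x : 𝒮.Hat) : 𝒮.Ahead x x := by
  obtain ⟨u, hu, rfl⟩ := exists_kept x
  exact ⟨_, .single ⟨fun _ => u, 0, 0, wilson_const u le_rfl, fun _ _ => hu, rfl, rfl, rfl⟩⟩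

theorem Ahead.trans {x y z : 𝒮.Hat} (h : 𝒮.Ahead x y) (k : 𝒮.Ahead y z) : 𝒮.Ahead x z := by
  obtain ⟨S, hS⟩ := h
  obtain ⟨T, hT⟩ := k
  exact ⟨_, .trans hS hT⟩

theorem ahead_of_mem_left {x y w : 𝒮.Hat} {S : Set 𝒮.Hat} (h : 𝒮.Arc x y S) (hw : w ∈ S) :
    𝒮.Ahead x w := by
  obtain ⟨T, -, hT⟩ := arcSystem_arc.split_left h hw
  exact ⟨T, hT⟩

theorem ahead_of_mem_right {x y w : 𝒮.Hat} {S : Set 𝒮.Hat} (h : 𝒮.Arc x y S) (hw : w ∈ S) :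
    𝒮.Ahead w y := by
  obtain ⟨T, -, hT⟩ := arcSystem_arc.split_right h hw
  exact ⟨T, hT⟩

theorem Ahead.total_of_left {x y z : 𝒮.Hat} (h : 𝒮.Ahead x y) (k : 𝒮.Ahead x z) :
    𝒮.Ahead y z ∨ 𝒮.Ahead z y := by
  obtain ⟨S, hS⟩ := h
  obtain ⟨T, hT⟩ := k
  rcases arc_det hS hT with hz | hy
  · exact Or.inr (ahead_of_mem_right hS hz)
  · exact Or.inl (ahead_of_mem_right hT hy)

theorem Ahead.total_of_right {x y z : 𝒮.Hat} (h : 𝒮.Ahead y x) (k : 𝒮.Ahead z x) :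
    𝒮.Ahead y z ∨ 𝒮.Ahead z y := by
  obtain ⟨S, hS⟩ := h
  obtain ⟨T, hT⟩ := k
  rcases arc_det_reverse hS hT with hz | hy
  · exact Or.inl (ahead_of_mem_left hS hz)
  · exact Or.inr (ahead_of_mem_left hT hy)

theorem ahead_of_path {γ : ℝ → Support} {a b : ℝ} (h : wilsonFoliation.IsPath γ a b)
    (k : ∀ t ∈ Icc a b, 𝒮.Kept (γ t)) : 𝒮.Ahead (𝒮.point (γ a)) (𝒮.point (γ b)) :=
  ⟨_, .single ⟨γ, a, b, h, k, rfl, rfl, rfl⟩⟩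

theorem hatPath_le {γ : ℝ → 𝒮.Hat} {a b : ℝ} (h : 𝒮.HatPath γ a b) : a ≤ b := by
  induction h with
  | of_path c a b hc _ => exact wilson_le hc
  | trans a b c _ _ ih₁ ih₂ => exact ih₁.trans ih₂

theorem arc_of_hatPath {γ : ℝ → 𝒮.Hat} {a b : ℝ} (h : 𝒮.HatPath γ a b) :
    𝒮.Arc (γ a) (γ b) (γ '' Icc a b) := by
  induction h with
  | of_path c a b hc hγ =>
    refine .single ⟨_, a, b, hc, fun t _ => (c t).2, ?_, ?_, ?_⟩
    · rw [hγ a (left_mem_Icc.2 (wilson_le hc)), point_coe]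
    · rw [hγ b (right_mem_Icc.2 (wilson_le hc)), point_coe]
    · exact image_congr fun t ht => by rw [hγ t ht, point_coe]
  | trans a b c hab hbc ih₁ ih₂ =>
    rw [← Icc_union_Icc_eq_Icc (hatPath_le hab) (hatPath_le hbc), image_union]
    exact .trans ih₁ ih₂

/-- A leaf of `Ŵ` is linearly ordered by the direction of the foliation. -/
theorem ahead_or_ahead_of_mem_leaf {x y : 𝒮.Hat} (h : y ∈ 𝒮.hatFoliation.leaf x) :
    𝒮.Ahead x y ∨ 𝒮.Ahead y x := by
  refine LeafPaths.leaf_subset (C := {y | 𝒮.Ahead x y ∨ 𝒮.Ahead y x}) (Or.inl (Ahead.refl x)) ?_ h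
  intro γ a b hγ s hs t ht hx
  have arc := arc_of_hatPath hγ
  have h1 : 𝒮.Ahead (γ s) (γ t) ∨ 𝒮.Ahead (γ t) (γ s) :=
    (ahead_of_mem_left arc (mem_image_of_mem γ hs)).total_of_left
      (ahead_of_mem_left arc (mem_image_of_mem γ ht))
  rcases hx with hx | hx <;> rcases h1 with h1 | h1
  · exact Or.inl (hx.trans h1)
  · exact hx.total_of_right h1
  · exact (h1.total_of_left hx).symm
  · exact Or.inr (h1.trans hx)

/-- A piece of a leaf path of `W` that avoids the removed part, as a leaf path of `Ŵ`. -/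
theorem hatPath_of_path {γ : ℝ → Support} {a b : ℝ} (h : wilsonFoliation.IsPath γ a b)
    (k : ∀ t ∈ Icc a b, 𝒮.Kept (γ t)) : 𝒮.HatPath (fun t => 𝒮.point (γ t)) a b := by
  have hab := wilson_le h
  refine .of_path (fun t => ⟨γ (projIcc a b hab t), k _ (projIcc a b hab t).2⟩) a b
    (wilson_congr h fun t ht => by simp only [projIcc_of_mem hab ht]) fun t ht => ?_
  refine Eq.trans ?_ (point_coe (⟨γ (projIcc a b hab t), k _ (projIcc a b hab t).2⟩ : 𝒮.Cut))
  simp only [projIcc_of_mem hab ht]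

theorem subset_leaf_of_arc {x y : 𝒮.Hat} {S : Set 𝒮.Hat} (h : 𝒮.Arc x y S) :
    S ⊆ 𝒮.hatFoliation.leaf x := by
  induction h with
  | single h =>
    obtain ⟨γ, a, b, hγ, k, rfl, rfl, rfl⟩ := h
    rintro _ ⟨t, ht, rfl⟩
    exact LeafPaths.mem_leaf_of_path (𝓕 := 𝒮.hatFoliation) (hatPath_of_path hγ k)
      (left_mem_Icc.2 (wilson_le hγ)) ht
  | trans h k ih₁ ih₂ =>
    refine union_subset ih₁ ?_
    rw [← LeafPaths.leaf_eq (ih₁ (arcSystem_arc.right_mem h))]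
    exact ih₂

end SelfInsertion

namespace SelfInsertion

variable {𝒮 : SelfInsertion}

/-! ### Transition points -/

theorem slab_eq_sigma_iff {q q' : insertionDomain} {t : unitInterval} :
    𝒮.slab (q, t) = sigma q' ↔ q = q' ∧ t = 0 := by
  rw [← 𝒮.slab_zero, 𝒮.slab_isEmbedding.injective.eq_iff, Prod.mk.injEq]

theorem slabAt_mem_range (q : insertionDomain) (t : ℝ) : 𝒮.slabAt q t ∈ range 𝒮.slab := ⟨_, rfl⟩

theorem exists_slabAt_of_mem_range {u : Support} (h : u ∈ range 𝒮.slab) :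
    ∃ q, ∃ t ∈ Icc (0 : ℝ) 1, u = 𝒮.slabAt q t := by
  obtain ⟨⟨q, t⟩, rfl⟩ := h
  exact ⟨q, t, t.2, by rw [slabAt, projIcc_val]⟩

theorem kept_sigma (q : insertionDomain) : 𝒮.Kept (sigma q) := by
  rw [← slabAt_zero, kept_slabAt]
  exact inCollar_zero _

theorem point_eq_hatBottom {u : Support} {p : Base} (hu : 𝒮.Kept u)
    (h : 𝒮.point u = 𝒮.hatBottom p) : u = bottom p ∨ ∃ hp : p ∈ insertionDomain, u = sigma ⟨p, hp⟩ := by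
  rw [← point_bottom, point_eq_point_iff hu (kept_bottom p)] at h
  rcases h with h | ⟨q, t, -, -, h⟩ | ⟨q, t, h1, h2, h3⟩
  · exact Or.inl h
  · exact absurd ⟨_, h.symm⟩ (bottom_not_mem_range_slab (𝒮 := 𝒮) p)
  · have e : ((p : Base), (0 : unitInterval)) = ((q : Base), t) := by
      refine attach_injOn (𝒮.boundary_subset_collar (Or.inr (Or.inl rfl))) h1 ?_
      rw [𝒮.attach_zero]
      exact h2
    rw [Prod.mk.injEq] at e
    obtain ⟨rfl, rfl⟩ := e
    exact Or.inr ⟨q.2, h3.trans (𝒮.slab_zero q)⟩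

theorem point_eq_top {u : Support} {p : Base} (hu : 𝒮.Kept u) (hp : p ∉ insertionDomain)
    (h : 𝒮.point u = 𝒮.point (top p)) : u = top p := by
  rw [point_eq_point_iff hu (kept_top p)] at h
  rcases h with h | ⟨q, t, -, -, h⟩ | ⟨q, t, h1, h2, h3⟩
  · exact h
  · exact absurd ⟨_, h.symm⟩ (top_not_mem_range_slab (𝒮 := 𝒮) p)
  · have e : ((p : Base), (1 : unitInterval)) = ((q : Base), t) := by
      refine attach_injOn (𝒮.boundary_subset_collar (Or.inr (Or.inr rfl))) h1 ?_
      rw [𝒮.attach_one]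
      exact h2
    rw [Prod.mk.injEq] at e
    exact absurd (e.1 ▸ q.2) hp

theorem hatBottom_injective : Function.Injective 𝒮.hatBottom := by
  intro p p' h
  rw [← point_bottom] at h
  rcases point_eq_hatBottom (kept_bottom p) h with h | ⟨hp, h⟩
  · exact congrArg Prod.fst h
  · exact absurd ⟨_, (𝒮.slab_zero _).trans h.symm⟩ (bottom_not_mem_range_slab (𝒮 := 𝒮) p)

variable (𝒮)

/-- The transition points: the points of the bottom of `W` that are glued to the self-insertion. -/
def transition : Set 𝒮.Hat := 𝒮.hatBottom '' insertionDomain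

/-- The transition points that lie ahead of `x`. -/
def transitionAhead (x : 𝒮.Hat) : Set 𝒮.Hat := {z ∈ 𝒮.transition | 𝒮.Ahead x z}

/-- The leaf that enters `W` at `p` leaves `W` again, at the matching point of the top. -/
def Passable (p : Base) : Prop := 𝒮.Ahead (𝒮.hatBottom p) (𝒮.point (top p))

variable {𝒮}

/-- A leaf path of `Ŵ` has finitely many transition points. -/
theorem finite_inter_transition {x y : 𝒮.Hat} {S : Set 𝒮.Hat} (h : 𝒮.Arc x y S) :
    (S ∩ 𝒮.transition).Finite := by
  induction h with
  | single h =>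
    obtain ⟨γ, a, b, hγ, k, rfl, rfl, rfl⟩ := h
    refine (((wilson_finite_sigma hγ).union
      (wilson_subsingleton_bottom hγ).finite).image 𝒮.point).subset ?_
    rintro _ ⟨⟨t, ht, rfl⟩, p, hp, e⟩
    refine ⟨γ t, ?_, rfl⟩
    rcases point_eq_hatBottom (k t ht) e.symm with h | ⟨hp', h⟩
    · exact Or.inr ⟨⟨t, ht, rfl⟩, p, h.symm⟩
    · exact Or.inl ⟨⟨t, ht, rfl⟩, _, h.symm⟩
  | trans _ _ ih₁ ih₂ =>
    rw [union_inter_distrib_right]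
    exact ih₁.union ih₂

theorem transitionAhead_subset {x y : 𝒮.Hat} (h : 𝒮.Ahead x y) :
    𝒮.transitionAhead y ⊆ 𝒮.transitionAhead x := fun _ hz => ⟨hz.1, h.trans hz.2⟩

/-- Moving along a leaf path passes only finitely many transition points. -/
theorem infinite_transitionAhead {x y : 𝒮.Hat} (h : 𝒮.Ahead x y)
    (hx : (𝒮.transitionAhead x).Infinite) : (𝒮.transitionAhead y).Infinite := by
  obtain ⟨S, hS⟩ := h
  intro hfin
  refine hx (((finite_inter_transition hS).union hfin).subset ?_)
  rintro z ⟨hz, T, hT⟩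
  rcases arc_det hS hT with h | h
  · exact Or.inl ⟨h, hz⟩
  · exact Or.inr ⟨hz, ahead_of_mem_right hT h⟩

/-! ### Passing through the inserted plug -/

theorem rising_injOn (p : Base) (m : ℝ) : InjOn (rising p m) (Icc (-1) 3) := fun a ha b hb e => by
  rw [← rising_height p m ha, ← rising_height p m hb, e]

variable {p : Base} {m : ℝ}

/-- A leaf above `p` that meets the slab has entered it through the self-insertion. -/
theorem exists_entry_of_rising (hc : Climbs (radius p) m) {h : ℝ} (hh : h ∈ Icc (-1) m)
    {q : insertionDomain} {t : ℝ} (ht : t ∈ Icc (0 : ℝ) 1) (e : rising p m h = 𝒮.slabAt q t) :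
    ∃ h' ∈ Icc (-1) h, rising p m h' = sigma q ∧
      rising p m '' Icc h' h = 𝒮.slabAt q '' Icc 0 t := by
  rcases wilson_det_backward (wilson_sub (rising_path hc) le_rfl hh.1 hh.2)
    (slabAt_path q le_rfl ht.1 ht.2) e with ⟨s, hs, es, im⟩ | ⟨s, hs, es, -⟩
  · exact ⟨s, hs, es.trans (slabAt_zero q), im⟩
  · rw [rising_bottom hc] at es
    exact absurd (es ▸ slabAt_mem_range q s) (bottom_not_mem_range_slab p)

/-- A leaf above `p` that enters the slab runs along a whole fiber of it, unless it ends there. -/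
theorem exists_exit_of_rising (hc : Climbs (radius p) m) {x h : ℝ} (hx : x ∈ Icc (-1) m)
    (hh : h ≤ m) (hxh : x < h) {q : insertionDomain} (e : rising p m x = sigma q)
    (hend : rising p m h ∉ range 𝒮.slab ∨ ∃ q', rising p m h = sigma q') :
    ∃ x' ∈ Icc x h, rising p m x' = 𝒮.slabAt q 1 ∧
      rising p m '' Icc x x' = 𝒮.slabAt q '' Icc 0 1 := by
  rcases wilson_det_forward (wilson_sub (rising_path hc) hx.1 hxh.le hh)
    (slabAt_path q le_rfl zero_le_one le_rfl) (e.trans (slabAt_zero q).symm) with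
    ⟨s, hs, es, im⟩ | ⟨s, hs, es, -⟩
  · exact ⟨s, hs, es, im⟩
  · exfalso
    rcases hend with hend | ⟨q', hq'⟩
    · exact hend (es ▸ slabAt_mem_range q s)
    · rw [hq', slabAt, slab_eq_sigma_iff] at es
      have := rising_injOn p m ⟨hx.1, hx.2.trans hc.1.2⟩
        ⟨hx.1.trans hxh.le, hh.trans hc.1.2⟩ (e.trans (es.1 ▸ hq'.symm))
      exact hxh.ne this

/-- If all inserted plugs that the leaf enters at larger radius can be passed, then the leaf
reaches every point of the original leaf above `p` that lies outside of the slab or on its lower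
face. -/
theorem ahead_rising (hc : Climbs (radius p) m)
    (hpass : ∀ q : insertionDomain, 𝒮.Ahead (𝒮.hatBottom p) (𝒮.hatBottom q) →
      radius p < radius q → 𝒮.Passable q)
    {h : ℝ} (hh : h ∈ Icc (-1) m)
    (hend : rising p m h ∉ range 𝒮.slab ∨ ∃ q', rising p m h = sigma q') :
    𝒮.Ahead (𝒮.hatBottom p) (𝒮.point (rising p m h)) := by
  have hitfin : {x ∈ Icc (-1) m | rising p m x ∈ range sigma}.Finite := by
    have sub : {x ∈ Icc (-1) m | rising p m x ∈ range sigma} ⊆ Icc (-1) 3 := fun x hx =>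
      ⟨hx.1.1, hx.1.2.trans hc.1.2⟩
    refine Set.Finite.of_finite_image (f := rising p m) ?_ ((rising_injOn p m).mono sub)
    refine (wilson_finite_sigma (rising_path hc)).subset ?_
    rintro _ ⟨x, hx, rfl⟩
    exact ⟨mem_image_of_mem _ hx.1, hx.2⟩
  -- induction on the number of entries into the slab below height `h`
  induction hn : {x ∈ Icc (-1) m | rising p m x ∈ range sigma ∧ x < h}.ncard using
    Nat.strong_induction_on generalizing h with
  | _ n ih =>
  have kend : 𝒮.Kept (rising p m h) := by
    rcases hend with hend | ⟨q', hq'⟩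
    · exact kept_of_not_mem_range hend
    · exact hq' ▸ kept_sigma q'
  have fin : {x ∈ Icc (-1) m | rising p m x ∈ range sigma ∧ x < h}.Finite :=
    hitfin.subset fun x hx => ⟨hx.1, hx.2.1⟩
  rcases eq_empty_or_nonempty {x ∈ Icc (-1) m | rising p m x ∈ range sigma ∧ x < h} with h0 | hne
  · have := ahead_of_path (𝒮 := 𝒮) (wilson_sub (rising_path hc) le_rfl hh.1 hh.2) fun u hu => by
      rcases hu.2.lt_or_eq with hlt | rfl
      · refine kept_of_not_mem_range fun hr => ?_
        obtain ⟨q, t, ht, e⟩ := exists_slabAt_of_mem_range hr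
        obtain ⟨h', hh', e', -⟩ := exists_entry_of_rising hc ⟨hu.1, hu.2.trans hh.2⟩ ht e
        exact eq_empty_iff_forall_notMem.1 h0 h'
          ⟨⟨hh'.1, hh'.2.trans (hu.2.trans hh.2)⟩, ⟨q, e'.symm⟩, hh'.2.trans_lt hlt⟩
      · exact kend
    rwa [rising_bottom hc, point_bottom] at this
  · obtain ⟨x, ⟨hx, ⟨q, hq⟩, hxh⟩, hmax⟩ := Set.exists_max_image _ id fin hne
    have a1 : 𝒮.Ahead (𝒮.hatBottom p) (𝒮.hatBottom q) := by
      rw [← point_sigma, hq]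
      refine ih _ ?_ hx (Or.inr ⟨q, hq.symm⟩) rfl
      rw [← hn]
      refine Set.ncard_lt_ncard ?_ fin
      refine ⟨fun y hy => ⟨hy.1, hy.2.1, hy.2.2.trans hxh⟩, fun hsub => ?_⟩
      exact lt_irrefl x (hsub ⟨hx, ⟨q, hq⟩, hxh⟩).2.2
    have hrad : radius p < radius q := by
      have := radius_sigma_lt q (by
        rw [hq, rising_radius, rising_height _ _ ⟨hx.1, hx.2.trans hc.1.2⟩]
        exact hc.2.imp id fun hm => hx.2.trans_lt hm)
      rwa [hq, rising_radius] at this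
    have a2 : 𝒮.Ahead (𝒮.hatBottom p) (𝒮.point (𝒮.slabAt q 1)) := by
      rw [point_slabAt (inCollar_one _), attachAt_one]
      exact a1.trans (hpass q a1 hrad)
    obtain ⟨x', hx', ex', im⟩ := exists_exit_of_rising hc hx hh.2 hxh hq.symm hend
    rw [← ex'] at a2
    refine a2.trans (ahead_of_path (wilson_sub (rising_path hc) (hx.1.trans hx'.1) hx'.2 hh.2)
      fun u hu => ?_)
    rcases hu.2.lt_or_eq with hlt | rfl
    · by_cases hr : rising p m u ∈ range 𝒮.slab
      · obtain ⟨q₂, t, ht, e⟩ := exists_slabAt_of_mem_range hr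
        have hum : u ∈ Icc (-1) m := ⟨hx.1.trans (hx'.1.trans hu.1), hu.2.trans hh.2⟩
        obtain ⟨h', hh', e', im'⟩ := exists_entry_of_rising hc hum ht e
        have hle : h' ≤ x := hmax h'
          ⟨⟨hh'.1, hh'.2.trans hum.2⟩, ⟨q₂, e'.symm⟩, hh'.2.trans_lt hlt⟩
        -- the fiber through `u` passes through the entry at height `x`, so it is the one just left
        have hmem : sigma q ∈ 𝒮.slabAt q₂ '' Icc 0 t := by
          rw [← im', hq]
          exact mem_image_of_mem _ ⟨hle, hx'.1.trans hu.1⟩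
        obtain ⟨s, -, es⟩ := hmem
        rw [slabAt, slab_eq_sigma_iff] at es
        obtain rfl := es.1
        have hmem : rising p m u ∈ rising p m '' Icc x x' := by
          rw [im, e]
          exact mem_image_of_mem _ ht
        obtain ⟨y, hy, ey⟩ := hmem
        have : y = u := rising_injOn p m
          ⟨hx.1.trans hy.1, hy.2.trans (hx'.2.trans (hh.2.trans hc.1.2))⟩
          ⟨hum.1, hum.2.trans hc.1.2⟩ ey
        have hux : u = x' := le_antisymm (this ▸ hy.2) hu.1
        rw [hux, ex', kept_slabAt]
        exact inCollar_one _
      · exact kept_of_not_mem_range hr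
    · exact kend

/-! ### Leaves of small negative radius meet infinitely many transition points -/

/-- The points at which leaf paths from `p` enter `W`, including `p`. -/
def reached (𝒮 : SelfInsertion) (p : Base) : Set Base :=
  {q | q = p ∨ q ∈ insertionDomain ∧ 𝒮.Ahead (𝒮.hatBottom p) (𝒮.hatBottom q)}

theorem finite_reached (h : (𝒮.transitionAhead (𝒮.hatBottom p)).Finite) :
    (𝒮.reached p).Finite := by
  refine ((finite_singleton p).union (h.preimage hatBottom_injective.injOn)).subset ?_
  rintro q (rfl | ⟨h1, h2⟩)
  · exact Or.inl rfl
  · exact Or.inr ⟨⟨q, h1, rfl⟩, h2⟩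

theorem reached_trans {q : Base} (hq : q ∈ 𝒮.reached p) {q' : insertionDomain}
    (h : 𝒮.Ahead (𝒮.hatBottom q) (𝒮.hatBottom q')) : (q' : Base) ∈ 𝒮.reached p := by
  refine Or.inr ⟨q'.2, ?_⟩
  rcases hq with rfl | hq
  · exact h
  · exact hq.2.trans h

/-- If a leaf meets finitely many transition points ahead of `p`, then it passes through every
plug it enters: a plug of maximal radius that it does not pass contains no such plug, so it could
be stopped only by a circular leaf, and then it would enter infinitely many plugs. -/
theorem passable_of_finite (hfin : (𝒮.transitionAhead (𝒮.hatBottom p)).Finite) {q : Base}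
    (hq : q ∈ 𝒮.reached p) : 𝒮.Passable q := by
  by_contra hcon
  obtain ⟨q, ⟨hq, hnot⟩, hmax⟩ := Set.exists_max_image {q ∈ 𝒮.reached p | ¬ 𝒮.Passable q} radius
    ((finite_reached hfin).subset (sep_subset _ _)) ⟨q, hq, hcon⟩
  have hpass : ∀ q' : insertionDomain, 𝒮.Ahead (𝒮.hatBottom q) (𝒮.hatBottom q') →
      radius q < radius q' → 𝒮.Passable q' := by
    intro q' ha hr
    by_contra hq'
    exact absurd (hmax q' ⟨reached_trans hq ha, hq'⟩) (not_le.2 hr)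
  by_cases h0 : radius q = 0
  · have hd : ∀ k : ℕ, 0 < (1 / 4 : ℝ) ^ (k + 1) ∧ (1 / 4 : ℝ) ^ (k + 1) ≤ 1 / 4 := fun k =>
      ⟨by positivity, by
        rw [pow_succ]
        have : (1 / 4 : ℝ) ^ k ≤ 1 := pow_le_one₀ (by norm_num) (by norm_num)
        linarith⟩
    choose h hh f hf using fun k : ℕ => exists_sigma_of_radius_zero h0 (hd k).1 (hd k).2
    have height : ∀ k, ((sigma (f k)).2 : ℝ) = h k := fun k => by
      rw [hf k, rising_height]
      have := hd k
      exact ⟨by linarith [(hh k).1], by linarith [(hh k).2]⟩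
    have mono : StrictMono h := strictMono_nat_of_lt_succ fun k => by
      have h1 := (hh k).2
      have h2 := (hh (k + 1)).1
      rw [pow_succ] at h2
      linarith [(hd k).1]
    have inj : Function.Injective fun k => ((f k : insertionDomain) : Base) := fun i j e => by
      refine mono.injective ?_
      rw [← height, ← height, Subtype.ext e]
    refine Set.infinite_of_injective_forall_mem inj (fun k => ?_) (finite_reached hfin)
    refine reached_trans hq ?_
    have hc : Climbs (radius q) (-(1 / 4 : ℝ) ^ (k + 1)) := by
      have := hd k
      exact ⟨⟨by linarith, by linarith⟩, Or.inr (by linarith)⟩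
    have := ahead_rising hc hpass (h := h k)
      ⟨by linarith [(hh k).1, (hd k).2], (hh k).2⟩ (Or.inr ⟨_, (hf k).symm⟩)
    rwa [← hf k, point_sigma] at this
  · refine hnot ?_
    have := ahead_rising (m := 3) ⟨by norm_num, Or.inl h0⟩ hpass (h := 3) (by norm_num)
      (Or.inl (by rw [rising_top h0]; exact top_not_mem_range_slab q))
    rwa [rising_top h0] at this

/-- A leaf of radius in `(-1/20, 0)` meets infinitely many transition points: otherwise it passes
through every plug that it enters, and so enters plugs at ever larger radii in `(-1/20, 0)`. -/
theorem infinite_transitionAhead_hatBottom (h1 : -(1 / 20) < radius p) (h2 : radius p < 0) :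
    (𝒮.transitionAhead (𝒮.hatBottom p)).Infinite := by
  intro hfin
  obtain ⟨q, ⟨hq, hq1, hq2⟩, hmax⟩ := Set.exists_max_image
    {q ∈ 𝒮.reached p | -(1 / 20) < radius q ∧ radius q < 0} radius
    ((finite_reached hfin).subset (sep_subset _ _)) ⟨p, Or.inl rfl, h1, h2⟩
  obtain ⟨h, hh, q', e, hr1, hr2⟩ := exists_sigma_of_radius_neg hq1 hq2
  have ha := ahead_rising (𝒮 := 𝒮) (m := 3) ⟨by norm_num, Or.inl hq2.ne⟩
    (fun q'' ha _ => passable_of_finite hfin (reached_trans hq ha))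
    ⟨hh.1, hh.2.trans (by norm_num)⟩ (Or.inr ⟨q', e.symm⟩)
  rw [← e, point_sigma] at ha
  exact absurd (hmax q' ⟨reached_trans hq ha, hq1.trans hr1, hr2⟩) (not_le.2 hr1)

end SelfInsertion

/-- In a foliated chart, the vertical segments are leaf paths. -/
theorem LeafPaths.isPath_vertical {X : Type*} [TopologicalSpace X] {𝓕 : LeafPaths X}
    {φ : OpenPartialHomeomorph X (HalfPlane × unitInterval)} (hφ : 𝓕.IsFlowChart φ)
    {h : HalfPlane} {a b : ℝ} (hab : a ≤ b)
    (htgt : ∀ t ∈ Icc a b, (h, projIcc (0 : ℝ) 1 zero_le_one t) ∈ φ.target) :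
    𝓕.IsPath (fun t => φ.symm (h, projIcc (0 : ℝ) 1 zero_le_one t)) a b := by
  refine (hφ _ a b fun t ht => φ.map_target (htgt t ht)).2 ?_
  have eq : ∀ t ∈ Icc a b, φ (φ.symm (h, projIcc (0 : ℝ) 1 zero_le_one t)) =
      (h, projIcc (0 : ℝ) 1 zero_le_one t) := fun t ht => φ.right_inv (htgt t ht)
  refine ⟨hab, ?_, ?_, ?_⟩
  · exact (continuous_const.prodMk continuous_projIcc).continuousOn.congr eq
  · intro t ht
    simp only [eq t ht, eq a (left_mem_Icc.2 hab)]
  · intro s hs t ht hst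
    simp only [eq s hs, eq t ht]
    exact monotone_projIcc _ hst

namespace SelfInsertion

variable {𝒮 : SelfInsertion}

/-! ### The leaves of the trimmed plug -/

/-- Nothing lies ahead of an external exit point. -/
theorem subset_of_arc_top {x y : 𝒮.Hat} {S : Set 𝒮.Hat} (h : 𝒮.Arc x y S) {p : Base}
    (hp : p ∉ insertionDomain) (hx : x = 𝒮.point (top p)) : S ⊆ {𝒮.point (top p)} := by
  induction h with
  | single h =>
    obtain ⟨γ, a, b, hγ, k, rfl, rfl, rfl⟩ := h
    have ea := point_eq_top (k a (left_mem_Icc.2 (wilson_le hγ))) hp hx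
    rintro _ ⟨t, ht, rfl⟩
    simp only [wilson_eq_of_top hγ ea ht, mem_singleton_iff]
  | trans h _ ih₁ ih₂ =>
    exact union_subset (ih₁ hx) (ih₂ (ih₁ hx (arcSystem_arc.right_mem h)))

/-- Nothing lies behind an external entry point. -/
theorem subset_of_arc_bottom {x y : 𝒮.Hat} {S : Set 𝒮.Hat} (h : 𝒮.Arc x y S) {p : Base}
    (hp : p ∉ insertionDomain) (hy : y = 𝒮.hatBottom p) : S ⊆ {𝒮.hatBottom p} := by
  induction h with
  | single h =>
    obtain ⟨γ, a, b, hγ, k, rfl, rfl, rfl⟩ := h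
    have eb := (point_eq_hatBottom (k b (right_mem_Icc.2 (wilson_le hγ))) hy).resolve_right
      fun h => hp h.1
    rintro _ ⟨t, ht, rfl⟩
    simp only [wilson_eq_of_bottom hγ eb ht, point_bottom, mem_singleton_iff]
  | trans _ k ih₁ ih₂ =>
    exact union_subset (ih₁ (ih₂ hy (arcSystem_arc.left_mem k))) (ih₂ hy)

theorem arc_of_cut {c : ℝ → 𝒮.Cut} {a b : ℝ}
    (h : wilsonFoliation.IsPath (fun t => (c t).1) a b) :
    𝒮.Arc (𝒮.proj (c a)) (𝒮.proj (c b)) ((fun t => 𝒮.proj (c t)) '' Icc a b) :=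
  arc_of_hatPath (γ := fun t => 𝒮.proj (c t)) (.of_path c a b h fun _ _ => rfl)

variable {P : Set 𝒮.Hat}

/-- Ahead of a point of the trimmed plug, a leaf stays in the trimmed plug as long as there are
infinitely many transition points to come: the pieces cut off at the bottom lie at the beginning of
a leaf, and those cut off at the top lie at the end. -/
theorem mem_of_infinite_transitionAhead (hP : 𝒮.IsTrimming P) {e y : 𝒮.Hat} (he : e ∈ P)
    (hey : 𝒮.Ahead e y) (hy : (𝒮.transitionAhead y).Infinite) : y ∈ P := by
  by_contra hyP
  obtain ⟨p, hp, c, hc, ⟨h0, -, hnot, t, ht, rfl⟩ | ⟨h1, -, -, t, ht, rfl⟩⟩ := hP y hyP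
  · obtain ⟨S, hS⟩ := hey
    have e0 : 𝒮.proj (c 0) = 𝒮.hatBottom p := by rw [← point_coe, h0, point_bottom]
    rcases arc_det_reverse hS (arc_of_cut (wilson_sub hc le_rfl ht.1 ht.2.le)) with h | h
    · obtain ⟨T, hT⟩ := ahead_of_mem_left hS h
      have := subset_of_arc_bottom hT hp e0 (arcSystem_arc.left_mem hT)
      rw [mem_singleton_iff, ← e0] at this
      exact hnot 0 (by norm_num) (this ▸ he)
    · obtain ⟨s, hs, rfl⟩ := h
      exact hnot s ⟨hs.1, hs.2.trans_lt ht.2⟩ he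
  · have e1 : 𝒮.proj (c 1) = 𝒮.point (top p) := by rw [← point_coe, h1]
    have ha : 𝒮.Ahead (𝒮.proj (c t)) (𝒮.proj (c 1)) :=
      ⟨_, arc_of_cut (wilson_sub hc ht.1.le ht.2 le_rfl)⟩
    refine infinite_transitionAhead ha hy ((finite_singleton (𝒮.point (top p))).subset ?_)
    rintro z ⟨-, T, hT⟩
    exact subset_of_arc_top hT hp e1 (arcSystem_arc.right_mem hT)

theorem mem_leaf_of_arc {x y : 𝒮.Hat} {S : Set 𝒮.Hat} (h : 𝒮.Arc x y S) (hS : S ⊆ P) :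
    ∀ (hx : x ∈ P) {w : 𝒮.Hat} (hw : w ∈ S),
      (⟨w, hS hw⟩ : P) ∈ (𝒮.tildeFoliation P).leaf ⟨x, hx⟩ := by
  induction h with
  | single h =>
    obtain ⟨γ, a, b, hγ, k, rfl, rfl, rfl⟩ := h
    rintro hx w ⟨t, ht, rfl⟩
    have hab := wilson_le hγ
    have hpath : (𝒮.tildeFoliation P).IsPath
        (fun t => ⟨𝒮.point (γ (projIcc a b hab t)), hS ⟨_, (projIcc a b hab t).2, rfl⟩⟩) a b :=
      hatPath_of_path (γ := fun t => γ (projIcc a b hab t))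
        (wilson_congr hγ fun t ht => by simp only [projIcc_of_mem hab ht])
        fun t _ => k _ (projIcc a b hab t).2
    have := LeafPaths.mem_leaf_of_path hpath (left_mem_Icc.2 hab) ht
    simpa only [projIcc_of_mem hab ht, projIcc_left] using this
  | trans h k ih₁ ih₂ =>
    intro hx w hw
    have hS₁ := subset_union_left.trans hS
    have hS₂ := subset_union_right.trans hS
    rcases hw with hw | hw
    · exact ih₁ hS₁ hx hw
    · rw [← LeafPaths.leaf_eq (ih₁ hS₁ hx (arcSystem_arc.right_mem h))]
      exact ih₂ hS₂ _ hw

theorem hatPath_continuousOn {γ : ℝ → 𝒮.Hat} {a b : ℝ} (h : 𝒮.HatPath γ a b) :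
    ContinuousOn γ (Icc a b) := by
  induction h with
  | of_path c a b hc hγ =>
    have h1 : ContinuousOn c (Icc a b) :=
      (Topology.IsInducing.subtypeVal
        (t := {x | x ∉ 𝒮.slab '' {y | ((y.1 : Base), y.2) ∉ 𝒮.collar}})).continuousOn_iff.2
        (wilson_continuousOn hc)
    have h2 : Continuous 𝒮.proj := continuous_quot_mk
    exact (h2.comp_continuousOn h1).congr hγ
  | trans a b c hab hbc ih₁ ih₂ =>
    rw [← Icc_union_Icc_eq_Icc (hatPath_le hab) (hatPath_le hbc)]
    exact ih₁.union_of_isClosed ih₂ isClosed_Icc isClosed_Icc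

/-- A leaf of the trimmed plug is infinite if infinitely many transition points lie ahead: they
form a closed discrete subset in the leaf topology. -/
theorem infiniteLeaf_of_infinite_transitionAhead (hP : 𝒮.IsTrimming P) [T2Space P] {e : P}
    (he : (𝒮.transitionAhead e).Infinite) : (𝒮.tildeFoliation P).InfiniteLeaf e := by
  have onLeaf : ∀ z ∈ 𝒮.transitionAhead e, ∃ hz : z ∈ P,
      (⟨z, hz⟩ : P) ∈ (𝒮.tildeFoliation P).leaf e := by
    rintro z ⟨hz, S, hS⟩
    have sub : S ⊆ P := fun w hw => mem_of_infinite_transitionAhead hP e.2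
      (ahead_of_mem_left hS hw) (infinite_transitionAhead (ahead_of_mem_left hS hw) he)
    exact ⟨_, mem_leaf_of_arc hS sub e.2 (arcSystem_arc.right_mem hS)⟩
  set Z : Set P := Subtype.val ⁻¹' 𝒮.transitionAhead e with hZ
  have Zinf : Z.Infinite := he.preimage fun z hz => ⟨⟨z, (onLeaf z hz).1⟩, rfl⟩
  have Zsub : Z ⊆ (𝒮.tildeFoliation P).leaf e := fun z hz => (onLeaf z hz).2
  have closed : ∀ Z' ⊆ Z, @IsClosed P (𝒮.tildeFoliation P).leafTopology Z' := by
    intro Z' hZ'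
    refine LeafPaths.isClosed_leafTopology fun γ a b hγ => ?_
    have hγ' : 𝒮.HatPath (fun t => (γ t : 𝒮.Hat)) a b := hγ
    have cont : ContinuousOn γ (Icc a b) :=
      Topology.IsInducing.subtypeVal.continuousOn_iff.2 (hatPath_continuousOn hγ')
    have fin : (γ '' Icc a b ∩ Z').Finite := by
      refine Set.Finite.of_finite_image (f := Subtype.val) ?_ Subtype.val_injective.injOn
      refine (finite_inter_transition (arc_of_hatPath hγ')).subset ?_
      rintro _ ⟨_, ⟨⟨t, ht, rfl⟩, hz⟩, rfl⟩
      exact ⟨⟨t, ht, rfl⟩, (hZ' hz).1⟩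
    have := fin.isClosed.preimage (continuousOn_iff_continuous_domRestrict.1 cont)
    convert this using 1
    ext t
    exact ⟨fun h => ⟨⟨t, t.2, rfl⟩, h⟩, fun h => h.2⟩
  intro hcpt
  let _ := (𝒮.tildeFoliation P).leafTopology
  obtain ⟨x, -, hx⟩ := Zinf.exists_accPt_of_subset_isCompact hcpt Zsub
  have hx' := accPt_principal_iff_clusterPt.1 hx
  rw [← mem_closure_iff_clusterPt, (closed _ sdiff_subset).closure_eq] at hx'
  exact hx'.2 rfl

/-- From every point of the leaf of a bottom point of radius in `(-1/20, 0)`, infinitely many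
transition points lie ahead. -/
theorem infinite_transitionAhead_of_mem_leaf {p : Base} (h1 : -(1 / 20) < radius p)
    (h2 : radius p < 0) {e : 𝒮.Hat} (h : e ∈ 𝒮.hatFoliation.leaf (𝒮.hatBottom p)) :
    (𝒮.transitionAhead e).Infinite := by
  have hinf := infinite_transitionAhead_hatBottom (𝒮 := 𝒮) h1 h2
  rcases ahead_or_ahead_of_mem_leaf h with h | h
  · exact infinite_transitionAhead h hinf
  · exact hinf.mono (transitionAhead_subset h)

/-! ### Entry points -/

/-- The first point of the trimmed plug on a leaf from an external entry point belongs to the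
entry region: in a chart where it were not at the lower end of its fiber, the fiber below it would
belong to the trimmed plug as well. -/
theorem mem_entryRegion (hb : (𝒮.tildeFoliation P).IsFlowBordism) {p : Base}
    (hp : p ∉ insertionDomain) {S : Set 𝒮.Hat} {e : P} (h : 𝒮.Arc (𝒮.hatBottom p) e S)
    (hS : ∀ w ∈ S, w ∈ P → w = e) : e ∈ (𝒮.tildeFoliation P).entryRegion := by
  obtain ⟨φ, hφ, he⟩ := hb.exists_chart e
  refine ⟨φ, hφ, he, ?_⟩
  by_contra hne
  set t₀ : unitInterval := (φ e).2 with ht₀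
  have hpos : (0 : ℝ) < t₀ := lt_of_le_of_ne t₀.2.1 fun h => hne (Subtype.ext h.symm)
  -- a short fiber below `e`
  have hcont : ContinuousAt (fun t : ℝ => ((φ e).1, projIcc (0 : ℝ) 1 zero_le_one t)) t₀ :=
    (continuous_const.prodMk continuous_projIcc).continuousAt
  have hmem : φ.target ∈ 𝓝 (((φ e).1, projIcc (0 : ℝ) 1 zero_le_one (t₀ : ℝ))) := by
    rw [projIcc_val]
    exact φ.open_target.mem_nhds (φ.map_source he)
  obtain ⟨ε, hε, hball⟩ := Metric.mem_nhds_iff.1 (hcont hmem)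
  set a : ℝ := max 0 (t₀ - ε / 2) with ha
  have hat : a < t₀ := max_lt hpos (by linarith)
  have ha0 : 0 ≤ a := le_max_left _ _
  have htgt : ∀ t ∈ Icc a (t₀ : ℝ), ((φ e).1, projIcc (0 : ℝ) 1 zero_le_one t) ∈ φ.target := by
    intro t ht
    refine hball ?_
    rw [Metric.mem_ball, Real.dist_eq, abs_lt]
    have := le_max_right 0 ((t₀ : ℝ) - ε / 2)
    constructor <;> linarith [ht.1, ht.2]
  set γ : ℝ → P := fun t => φ.symm ((φ e).1, projIcc (0 : ℝ) 1 zero_le_one t) with hγdef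
  have hγ : (𝒮.tildeFoliation P).IsPath γ a t₀ :=
    LeafPaths.isPath_vertical hφ hat.le htgt
  have γend : γ t₀ = e := by
    simp only [hγdef, projIcc_val]
    exact φ.left_inv he
  have γa : γ a ≠ e := by
    intro h
    have := congrArg (fun x => (φ x).2) h
    simp only [hγdef] at this
    rw [φ.right_inv (htgt a (left_mem_Icc.2 hat.le)),
      projIcc_of_mem _ ⟨ha0, hat.le.trans t₀.2.2⟩] at this
    exact hat.ne (congrArg Subtype.val this)
  have arc : 𝒮.Arc (γ a) e ((fun t => (γ t : 𝒮.Hat)) '' Icc a t₀) := by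
    have hh : 𝒮.HatPath (fun t => (γ t : 𝒮.Hat)) a t₀ := hγ
    have := arc_of_hatPath hh
    rwa [γend] at this
  rcases arc_det_reverse h arc with hw | hw
  · exact γa (Subtype.ext (hS _ hw (γ a).2))
  · -- the entry point itself lies on that fiber
    obtain ⟨t, ht, et⟩ := hw
    simp only at et
    have e1 : 𝒮.hatBottom p = e :=
      hS _ (arcSystem_arc.left_mem h) (et ▸ (γ t).2)
    have := subset_of_arc_bottom arc hp e1.symm (arcSystem_arc.left_mem arc)
    rw [mem_singleton_iff, e1] at this
    exact γa (Subtype.ext this)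

/-- The leaf of an external entry point reaches the trimmed plug along a leaf path of `W`. -/
theorem exists_first_point (hP : 𝒮.IsTrimming P) {p : Base} (hp : p ∉ insertionDomain) :
    ∃ c : ℝ → 𝒮.Cut, wilsonFoliation.IsPath (fun t => (c t).1) 0 1 ∧ (c 0).1 = bottom p ∧
      𝒮.proj (c 1) ∈ P ∧ ∀ t ∈ Icc (0 : ℝ) 1, 𝒮.proj (c t) ∈ P → 𝒮.proj (c t) = 𝒮.proj (c 1) := by
  by_cases hin : 𝒮.hatBottom p ∈ P
  · exact ⟨fun _ => ⟨bottom p, 𝒮.bottom_not_mem p⟩, wilson_const _ zero_le_one, rfl, hin,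
      fun _ _ _ => rfl⟩
  · obtain ⟨p', hp', c, hc, ⟨h0, h1, hnot, t, ht, e⟩ | ⟨h1, h0, -, t, ht, e⟩⟩ := hP _ hin
    all_goals
      rw [← point_coe] at e
      have e' := (point_eq_hatBottom (c t).2 e).resolve_right fun h => hp h.1
    · refine ⟨c, hc, ?_, h1, fun s hs hsP => ?_⟩
      · exact wilson_eq_of_bottom (wilson_sub hc le_rfl ht.1 ht.2.le) e' ⟨le_rfl, ht.1⟩
      · rcases hs.2.lt_or_eq with hlt | rfl
        · exact absurd hsP (hnot s ⟨hs.1, hlt⟩)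
        · rfl
    · exfalso
      have := wilson_eq_of_bottom (wilson_sub hc le_rfl ht.1.le ht.2) e' ⟨le_rfl, ht.1.le⟩
      rw [← point_coe, this, point_bottom] at h0
      exact hin h0

end SelfInsertion

/-! ### Holonomy along leaf paths -/

/-- A set saturated under leaf paths that is a neighborhood of one point of a fiber in a box of a
foliated chart is a neighborhood of every point of that fiber. -/
theorem LeafPaths.mem_interior_of_box {X : Type*} [TopologicalSpace X] {𝓕 : LeafPaths X}
    {φ : OpenPartialHomeomorph X (HalfPlane × unitInterval)} (hφ : 𝓕.IsFlowChart φ) {C : Set X}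
    (hC : ∀ γ a b, 𝓕.IsPath γ a b → ∀ s ∈ Icc a b, ∀ t ∈ Icc a b, γ s ∈ C → γ t ∈ C)
    {U : Set HalfPlane} {J : Set unitInterval} (hU : IsOpen U) (hJ : IsOpen J)
    (hJc : J.OrdConnected) (hbox : U ×ˢ J ⊆ φ.target) {x y : X} (hx : x ∈ φ.source)
    (hy : y ∈ φ.source) (hxU : φ x ∈ U ×ˢ J) (hyU : φ y ∈ U ×ˢ J) (e : (φ x).1 = (φ y).1)
    (h : x ∈ interior C) : y ∈ interior C := by
  -- for the points of the same height as `x` on the fibers close to that of `x`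
  have ev₁ : ∀ᶠ k in 𝓝 (φ y).1, φ.symm (k, (φ x).2) ∈ C := by
    have c : ContinuousAt (fun k => φ.symm (k, (φ x).2)) (φ y).1 := by
      refine ContinuousAt.comp (f := fun k => (k, (φ x).2)) (g := φ.symm) ?_ (by fun_prop)
      rw [← e]
      exact φ.continuousAt_symm (φ.map_source hx)
    have e2 : φ.symm ((φ y).1, (φ x).2) = x := by rw [← e]; exact φ.left_inv hx
    have := c.preimage_mem_nhds (t := interior C) (by rw [e2]; exact isOpen_interior.mem_nhds h)
    filter_upwards [this] with k hk using interior_subset hk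
  have cy := φ.continuousAt hy
  rw [mem_interior_iff_mem_nhds]
  filter_upwards [φ.open_source.mem_nhds hy,
    cy.preimage_mem_nhds ((hU.prod hJ).mem_nhds hyU),
    (continuousAt_fst.comp cy).eventually ev₁] with z hz hzU hzC
  simp only [Function.comp_apply] at hzC
  have seg : ∀ t ∈ Icc (min ((φ x).2 : ℝ) (φ z).2) (max ((φ x).2 : ℝ) (φ z).2),
      ((φ z).1, projIcc (0 : ℝ) 1 zero_le_one t) ∈ φ.target := by
    intro t ht
    refine hbox ⟨hzU.1, ?_⟩
    have htI : t ∈ Icc (0 : ℝ) 1 :=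
      ⟨(le_min (φ x).2.2.1 (φ z).2.2.1).trans ht.1, ht.2.trans (max_le (φ x).2.2.2 (φ z).2.2.2)⟩
    rw [projIcc_of_mem _ htI]
    refine hJc.uIcc_subset hxU.2 hzU.2 ?_
    rw [uIcc, mem_Icc]
    exact ⟨by rw [← Subtype.coe_le_coe]; exact ht.1, by rw [← Subtype.coe_le_coe]; exact ht.2⟩
  have := hC _ _ _ (LeafPaths.isPath_vertical hφ (min_le_max) seg) (φ x).2
    ⟨min_le_left _ _, le_max_left _ _⟩ (φ z).2 ⟨min_le_right _ _, le_max_right _ _⟩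
  simp only [projIcc_val] at this
  have := this hzC
  rwa [Prod.mk.eta, φ.left_inv hz] at this

/-- A set saturated under leaf paths is a neighborhood of the start of a leaf path as soon as it
is a neighborhood of its end. -/
theorem LeafPaths.mem_interior_of_path {X : Type*} [TopologicalSpace X] {𝓕 : LeafPaths X}
    (hch : ∀ x : X, ∃ φ : OpenPartialHomeomorph X (HalfPlane × unitInterval),
      𝓕.IsFlowChart φ ∧ x ∈ φ.source) {C : Set X}
    (hC : ∀ γ a b, 𝓕.IsPath γ a b → ∀ s ∈ Icc a b, ∀ t ∈ Icc a b, γ s ∈ C → γ t ∈ C)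
    {γ : ℝ → X} {a b : ℝ} (hab : a ≤ b) (hcont : ContinuousOn γ (Icc a b))
    (hγ : ∀ s t, a ≤ s → s ≤ t → t ≤ b → 𝓕.IsPath γ s t) (h : γ b ∈ interior C) :
    γ a ∈ interior C := by
  refine isPreconnected_Icc.induction₂' (fun s t => γ s ∈ interior C → γ t ∈ interior C) ?_ ?_
    (right_mem_Icc.2 hab) (left_mem_Icc.2 hab) h
  · intro t₀ ht₀
    obtain ⟨φ, hφ, hs⟩ := hch (γ t₀)
    obtain ⟨U, hU, V, hV, hUV⟩ := mem_nhds_prod_iff.1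
      (φ.open_target.mem_nhds (φ.map_source hs))
    obtain ⟨U', hU'U, hU'o, hU'⟩ := mem_nhds_iff.1 hU
    obtain ⟨ε, hε, hball⟩ := Metric.mem_nhds_iff.1 hV
    set J := Metric.ball (φ (γ t₀)).2 ε with hJ
    have hJc : J.OrdConnected := by
      refine ⟨fun x hx y hy z hz => ?_⟩
      simp only [hJ, Metric.mem_ball, Subtype.dist_eq, Real.dist_eq, abs_lt] at hx hy ⊢
      have h1 : (x : ℝ) ≤ z := hz.1
      have h2 : (z : ℝ) ≤ y := hz.2
      constructor <;> linarith [hx.1, hy.2]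
    have hbox : U' ×ˢ J ⊆ φ.target := (prod_mono hU'U hball).trans hUV
    have hnear : φ.source ∩ φ ⁻¹' (U' ×ˢ J) ∈ 𝓝 (γ t₀) :=
      Filter.inter_mem (φ.open_source.mem_nhds hs) ((φ.continuousAt hs).preimage_mem_nhds
        ((hU'o.prod Metric.isOpen_ball).mem_nhds ⟨hU', Metric.mem_ball_self hε⟩))
    obtain ⟨d, hd, hdball⟩ := Metric.mem_nhdsWithin_iff.1 (hcont t₀ ht₀ hnear)
    have key : ∀ t ∈ Metric.ball t₀ d ∩ Icc a b, (φ (γ t)).1 = (φ (γ t₀)).1 := by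
      intro t ht
      have sub : ∀ x ∈ Icc (min t₀ t) (max t₀ t), γ x ∈ φ.source := fun x hx => by
        refine (hdball ⟨?_, (le_min ht₀.1 ht.2.1).trans hx.1, hx.2.trans (max_le ht₀.2 ht.2.2)⟩).1
        have := abs_lt.1 (Metric.mem_ball.1 ht.1)
        rw [Metric.mem_ball, Real.dist_eq, abs_lt]
        have h1 : t₀ - d < min t₀ t := lt_min (by linarith) (by linarith [this.1])
        have h2 : max t₀ t < t₀ + d := max_lt (by linarith) (by linarith [this.2])
        constructor <;> linarith [hx.1, hx.2]
      have hv := (hφ γ _ _ sub).1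
        (hγ _ _ (le_min ht₀.1 ht.2.1) min_le_max (max_le ht₀.2 ht.2.2))
      rw [hv.2.2.1 t ⟨min_le_right _ _, le_max_right _ _⟩,
        hv.2.2.1 t₀ ⟨min_le_left _ _, le_max_left _ _⟩]
    have h₀ := hdball ⟨Metric.mem_ball_self hd, ht₀⟩
    filter_upwards [inter_mem_nhdsWithin (Icc a b) (Metric.ball_mem_nhds t₀ hd)] with t ht
    have ht' := hdball ht.symm
    exact ⟨LeafPaths.mem_interior_of_box hφ hC hU'o Metric.isOpen_ball hJc hbox h₀.1 ht'.1 h₀.2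
        ht'.2 (key t ht.symm).symm,
      LeafPaths.mem_interior_of_box hφ hC hU'o Metric.isOpen_ball hJc hbox ht'.1 h₀.1 ht'.2 h₀.2
        (key t ht.symm)⟩
  · exact fun _ _ _ _ _ _ h₁ h₂ h => h₂ (h₁ h)

/-! ### The domain of the self-insertion -/

theorem isCompact_domain_aux {c : ℝ} (h1 : 1 ≤ c) (h2 : c < 9) :
    IsCompact {p : Base | radius p - radius p ^ 2 / 4 - 2 * (angle p - c) ^ 2 ∈ Icc (-1 : ℝ) 1 ∧
      angle p - c ∈ Icc (-1 : ℝ) 1} := by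
  have : {p : Base | radius p - radius p ^ 2 / 4 - 2 * (angle p - c) ^ 2 ∈ Icc (-1 : ℝ) 1 ∧
      angle p - c ∈ Icc (-1 : ℝ) 1} =
      (fun x : Icc (-1 : ℝ) 1 × ℝ => ((x.1, (x.2 : AddCircle (10 : ℝ))) : Base)) ''
      {x | ((x.1 : ℝ) - (x.1 : ℝ) ^ 2 / 4 - 2 * (x.2 - c) ^ 2 ∈ Icc (-1 : ℝ) 1) ∧
        x.2 - c ∈ Icc (-1 : ℝ) 1} := by
    ext p
    constructor
    · rintro ⟨h1, h2⟩
      exact ⟨(p.1, angle p), ⟨h1, h2⟩, Prod.ext rfl (coe_angle p)⟩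
    · rintro ⟨⟨r, x⟩, ⟨k1, k2⟩, rfl⟩
      simp only at k1 k2
      have ha := angle_mk r (x := x) ⟨by linarith [k2.1], by linarith [k2.2]⟩
      refine ⟨?_, ?_⟩
      · rw [ha]; exact k1
      · rw [ha]; exact k2
  rw [this]
  refine IsCompact.image ?_
    (continuous_fst.prodMk ((AddCircle.continuous_mk' 10).comp continuous_snd))
  refine (isCompact_univ.prod (isCompact_Icc (a := c - 1) (b := c + 1))).of_isClosed_subset ?_ ?_
  · refine IsClosed.inter ?_ ?_
    · exact isClosed_Icc.preimage (f := fun x : Icc (-1 : ℝ) 1 × ℝ =>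
        ((x.1 : ℝ) - (x.1 : ℝ) ^ 2 / 4 - 2 * (x.2 - c) ^ 2)) (by fun_prop)
    · exact isClosed_Icc.preimage (f := fun x : Icc (-1 : ℝ) 1 × ℝ => x.2 - c) (by fun_prop)
  · rintro x ⟨-, h⟩
    exact ⟨mem_univ _, by linarith [h.1], by linarith [h.2]⟩

/-- The domain of the self-insertion is bounded only by the points that are mapped to radius
`-1`. -/
theorem mem_interior_domain_aux {c : ℝ} (h1 : 1 < c) {p : Base}
    (h : angle p - c ∈ Icc (-1 : ℝ) 1)
    (hr : -1 < radius p - radius p ^ 2 / 4 - 2 * (angle p - c) ^ 2) :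
    p ∈ interior {p : Base | radius p - radius p ^ 2 / 4 - 2 * (angle p - c) ^ 2 ∈ Icc (-1 : ℝ) 1 ∧
      angle p - c ∈ Icc (-1 : ℝ) 1} := by
  have hp1 : -1 ≤ radius p ∧ radius p ≤ 1 := p.1.2
  have ca : ContinuousAt angle p := by
    have h0 : p.2 ≠ ((0 : ℝ) : AddCircle (10 : ℝ)) := by
      intro h0
      have : angle p = 0 := by
        rw [show p = (p.1, ((0 : ℝ) : AddCircle (10 : ℝ))) from Prod.ext rfl h0]
        exact angle_mk _ (by norm_num)
      rw [this] at h
      linarith [h.1]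
    exact continuousAt_subtype_val.comp
      ((AddCircle.continuousAt_equivIco 10 0 h0).comp continuousAt_snd)
  have cr : ContinuousAt radius p := (continuous_subtype_val.comp continuous_fst).continuousAt
  have cw : ContinuousAt (fun p => radius p - radius p ^ 2 / 4 - 2 * (angle p - c) ^ 2) p :=
    (cr.sub ((cr.pow 2).div_const 4)).sub (((ca.sub continuousAt_const).pow 2).const_mul 2)
  have cz : ContinuousAt (fun p => angle p - c) p := ca.sub continuousAt_const
  have w1 : radius p - radius p ^ 2 / 4 - 2 * (angle p - c) ^ 2 < 1 := by
    nlinarith [sq_nonneg (angle p - c)]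
  have z2 : (angle p - c) ^ 2 < 1 := by nlinarith
  have z3 := abs_lt.1 ((sq_lt_one_iff_abs_lt_one _).1 z2)
  rw [mem_interior_iff_mem_nhds]
  filter_upwards [cw (Icc_mem_nhds hr w1), cz (Icc_mem_nhds z3.1 z3.2)] with y h1 h2
  exact ⟨h1, h2⟩

theorem domainS_eq : domainS = {p : Base |
    radius p - radius p ^ 2 / 4 - 2 * (angle p - 2) ^ 2 ∈ Icc (-1 : ℝ) 1 ∧
      angle p - 2 ∈ Icc (-1 : ℝ) 1} := by
  ext p
  refine and_congr_right fun _ => ?_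
  rw [mem_Icc, mem_Icc]
  constructor <;> rintro ⟨h1, h2⟩ <;> constructor <;> linarith

theorem isCompact_insertionDomain : IsCompact insertionDomain := by
  rw [insertionDomain, domainS_eq]
  exact (isCompact_domain_aux (by norm_num) (by norm_num)).union
    (isCompact_domain_aux (c := 8) (by norm_num) (by norm_num))

theorem mem_interior_insertionDomain (q : insertionDomain) (h : -1 < radius (sigma q).1) :
    (q : Base) ∈ interior insertionDomain := by
  rcases sigma_spec q with ⟨hq, h1, -⟩ | ⟨hq, h1, -⟩
  · rw [h1] at h
    refine interior_mono subset_union_left ?_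
    rw [domainS_eq] at hq ⊢
    exact mem_interior_domain_aux (by norm_num) hq.2 h
  · rw [h1] at h
    refine interior_mono subset_union_right ?_
    exact mem_interior_domain_aux (c := 8) (by norm_num) hq.2 h

/-! ### Continuous dependence of the leaves on their base point -/

theorem continuousOn_clock :
    ContinuousOn (fun x : ℝ × ℝ => clock x.1 3 x.2) {x | x.1 ≠ 0} := by
  rw [continuousOn_iff_continuous_domRestrict]
  refine intervalIntegral.continuous_parametric_intervalIntegral_of_continuous
    (f := fun (x : {x : ℝ × ℝ | x.1 ≠ 0}) t => (clampedSpeed x.1.1 3 t)⁻¹)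
    (s := fun x => x.1.2) ?_ (by fun_prop)
  refine Continuous.inv₀ ?_ fun x => ?_
  · exact ((continuous_fst.comp (continuous_subtype_val.comp continuous_fst)).pow 2).add
      (continuous_localHeight_pow_six.comp (by fun_prop))
  · exact (Climbs.clampedSpeed_pos ⟨by norm_num, Or.inl x.1.2⟩ _).ne'

theorem continuousOn_turn :
    ContinuousOn (fun x : ℝ × ℝ => turn x.1 3 x.2) {x | x.1 ≠ 0} := by
  have h1 : ContinuousOn (fun x : ℝ × ℝ => clock x.1 3 1) {x | x.1 ≠ 0} :=
    continuousOn_clock.comp (f := fun x : ℝ × ℝ => (x.1, (1 : ℝ))) (by fun_prop) fun x hx => hx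
  exact h1.sub (continuousOn_clock.sub h1).abs

theorem continuousAt_turn {X : Type*} [TopologicalSpace X] {f g : X → ℝ} {x : X}
    (hf : ContinuousAt f x) (hg : ContinuousAt g x) (h : f x ≠ 0) :
    ContinuousAt (fun y => turn (f y) 3 (g y)) x := by
  have ho : IsOpen {x : ℝ × ℝ | x.1 ≠ 0} := isOpen_ne_fun continuous_fst continuous_const
  exact ContinuousAt.comp (f := fun y => (f y, g y))
    (continuousOn_turn.continuousAt (ho.mem_nhds h)) (hf.prodMk hg)

/-- The bottom point of the leaf through `u`, if `u` does not have radius `0`. -/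
def foot (u : Support) : Base :=
  (u.1.1, u.1.2 - (turn (radius u.1) 3 u.2 : AddCircle (10 : ℝ)))

theorem foot_rising (p : Base) {h : ℝ} (hh : h ∈ Icc (-1 : ℝ) 3) : foot (rising p 3 h) = p := by
  rw [foot, rising_radius, rising_height _ _ hh]
  simp only [rising, add_sub_cancel_right]

theorem rising_foot (u : Support) : rising (foot u) 3 u.2 = u := by
  refine support_ext rfl ?_ (rising_height _ _ u.2.2)
  simp [rising, foot, radius]

theorem continuousAt_rising_foot {u : Support} (hu : radius u.1 ≠ 0) (x : ℝ) :
    ContinuousAt (fun z : Support × ℝ => rising (foot z.1) 3 (min z.1.2 z.2)) (u, x) := by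
  have c1 : Continuous fun z : Support × ℝ => z.1.1.1 := by fun_prop
  have c2 : Continuous fun z : Support × ℝ => z.1.1.2 := by fun_prop
  have c3 : Continuous fun z : Support × ℝ => (z.1.2 : ℝ) := by fun_prop
  have c4 : Continuous fun z : Support × ℝ => min (z.1.2 : ℝ) z.2 := by fun_prop
  have cr : Continuous fun z : Support × ℝ => radius z.1.1 := continuous_subtype_val.comp c1
  have mk := AddCircle.continuous_mk' (10 : ℝ)
  have t1 := mk.continuousAt.comp
    (continuousAt_turn (x := (u, x)) cr.continuousAt c3.continuousAt hu)
  have t2 := mk.continuousAt.comp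
    (continuousAt_turn (x := (u, x)) cr.continuousAt c4.continuousAt hu)
  exact (c1.continuousAt.prodMk ((c2.continuousAt.sub t1).add t2)).prodMk
    ((continuous_projIcc (h := (by norm_num : (-1 : ℝ) ≤ 3))).comp c4).continuousAt

namespace SelfInsertion

variable {𝒮 : SelfInsertion}

/-! ### An open set of leaves that stop -/

variable (𝒮) in
/-- The union of the leaves of `Ŵ` that start at a bottom point of radius in `(-1/20, 0)`. -/
def stoppedLeaves : Set 𝒮.Hat :=
  {x | ∃ p : Base, -(1 / 20) < radius p ∧ radius p < 0 ∧
    x ∈ 𝒮.hatFoliation.leaf (𝒮.hatBottom p)}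

theorem isCompact_slab_image {V : Set (insertionDomain × unitInterval)} (hV : IsClosed V) :
    IsCompact (𝒮.slab '' V) := by
  have := isCompact_iff_compactSpace.1 isCompact_insertionDomain
  exact hV.isCompact.image 𝒮.slab_isEmbedding.continuous

theorem isOpen_kept : IsOpen {u | 𝒮.Kept u} := by
  refine (isCompact_slab_image (V := {y | ((y.1 : Base), y.2) ∉ 𝒮.collar}) ?_).isClosed.isOpen_compl
  exact (𝒮.collar_isOpen.preimage (f := fun y : insertionDomain × unitInterval =>
    ((y.1 : Base), y.2)) (by fun_prop)).isClosed_compl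

theorem isClosed_range_slab : IsClosed (range 𝒮.slab) := by
  rw [← image_univ]
  exact (isCompact_slab_image isClosed_univ).isClosed

/-- If the leaf above `foot u` avoids the removed part up to the height of `u`, then so do the
nearby leaves. -/
theorem eventually_mem_stoppedLeaves {u : Support} (h1 : -(1 / 20) < radius u.1)
    (h2 : radius u.1 < 0) (hk : ∀ x ∈ Icc (-1 : ℝ) u.2, 𝒮.Kept (rising (foot u) 3 x)) :
    ∀ᶠ v in 𝓝 u, 𝒮.Kept v ∧ 𝒮.point v ∈ 𝒮.stoppedLeaves := by
  have cr : Continuous fun v : Support => radius v.1 :=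
    continuous_subtype_val.comp (by fun_prop : Continuous fun v : Support => v.1.1)
  have ev : ∀ᶠ v in 𝓝 u, ∀ x ∈ Icc (-1 : ℝ) 3,
      𝒮.Kept (rising (foot v) 3 (min (v.2 : ℝ) x)) := by
    refine isCompact_Icc.eventually_forall_of_forall_eventually fun x hx => ?_
    exact (continuousAt_rising_foot h2.ne x).eventually
      (isOpen_kept.mem_nhds (hk _ ⟨le_min u.2.2.1 hx.1, min_le_left _ _⟩))
  filter_upwards [ev, cr.continuousAt.eventually (lt_mem_nhds h1),
    cr.continuousAt.eventually (gt_mem_nhds h2)] with v hv hv1 hv2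
  have hc : Climbs (radius (foot v)) 3 := ⟨by norm_num, Or.inl hv2.ne⟩
  have hv' : ∀ x ∈ Icc (-1 : ℝ) v.2, 𝒮.Kept (rising (foot v) 3 x) := fun x hx => by
    have := hv x ⟨hx.1, hx.2.trans v.2.2.2⟩
    rwa [min_eq_right hx.2] at this
  have path := wilson_sub (rising_path hc) le_rfl v.2.2.1 v.2.2.2
  refine ⟨?_, foot v, hv1, hv2, ?_⟩
  · have := hv' v.2 ⟨v.2.2.1, le_rfl⟩
    rwa [rising_foot] at this
  · have := LeafPaths.mem_leaf_of_path (𝓕 := 𝒮.hatFoliation) (hatPath_of_path path hv')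
      (left_mem_Icc.2 v.2.2.1) (right_mem_Icc.2 v.2.2.1)
    rwa [rising_foot, rising_bottom hc, point_bottom] at this

/-- Near a point of the slab over the interior of `D`, the projection to `Ŵ` is open: a
neighborhood of such a point, together with the points glued to it, is open. -/
theorem point_mem_interior {q : insertionDomain} {t : unitInterval}
    (hq : (q : Base) ∈ interior insertionDomain) {C : Set 𝒮.Hat}
    (h : ∀ᶠ v in 𝓝 (𝒮.slab (q, t)), 𝒮.Kept v ∧ 𝒮.point v ∈ C) :
    𝒮.point (𝒮.slab (q, t)) ∈ interior C := by
  obtain ⟨N₁, hN₁, oN₁, mN₁⟩ := eventually_nhds_iff.1 h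
  obtain ⟨N₂, oN₂, eN₂⟩ := 𝒮.slab_isEmbedding.isInducing.isOpen_iff.1
    (isOpen_interior.preimage (f := fun y : insertionDomain × unitInterval => (y.1 : Base))
      (t := interior insertionDomain) (by fun_prop))
  set A := closure (𝒮.attach '' {x | x ∈ 𝒮.collar ∧ x.1 ∈ insertionDomain}) with hA
  set N := N₁ ∩ N₂ ∩ Aᶜ with hN
  have oN : IsOpen N := (oN₁.inter oN₂).inter isClosed_closure.isOpen_compl
  have mN : 𝒮.slab (q, t) ∈ N := by
    refine ⟨⟨mN₁, ?_⟩, fun hm => disjoint_left.1 𝒮.slab_disjoint_attach ⟨_, rfl⟩ hm⟩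
    have : (q, t) ∈ 𝒮.slab ⁻¹' N₂ := by rw [eN₂]; exact hq
    exact this
  have int : ∀ {q' t'}, 𝒮.slab (q', t') ∈ N → (q' : Base) ∈ interior insertionDomain :=
    fun {q' t'} hm => by
      have : (q', t') ∈ 𝒮.slab ⁻¹' N₂ := hm.1.2
      rw [eN₂] at this
      exact this
  -- the points of the collar that are glued to points of `N`
  have ind : IsInducing fun y : insertionDomain × unitInterval => ((y.1 : Base), y.2) :=
    IsInducing.subtypeVal.prodMap IsInducing.id
  obtain ⟨V, oV, eV⟩ := ind.isOpen_iff.1 (oN.preimage 𝒮.slab_isEmbedding.continuous)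
  set V' : Set 𝒮.collar := {x | x.1 ∈ V ∧ x.1.1 ∈ interior insertionDomain} with hV'
  have oV' : IsOpen V' := (oV.inter (isOpen_interior.preimage continuous_fst)).preimage
    continuous_subtype_val
  have oα := 𝒮.attach_isOpenEmbedding.isOpenMap V' oV'
  have memV : ∀ {q' : insertionDomain} {t'}, ((q' : Base), t') ∈ V ↔ 𝒮.slab (q', t') ∈ N := by
    intro q' t'
    exact Set.ext_iff.1 eV (q', t')
  rw [mem_interior]
  refine ⟨𝒮.point '' N, ?_, ?_, mem_image_of_mem _ mN⟩
  · rintro _ ⟨v, hv, rfl⟩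
    exact (hN₁ v hv.1.1).2
  · have pre : 𝒮.proj ⁻¹' (𝒮.point '' N) = (fun x : 𝒮.Cut => x.1) ⁻¹'
        (N ∪ (fun x : 𝒮.collar => 𝒮.attach x) '' V') := by
      ext x
      have kx : 𝒮.Kept x.1 := x.2
      constructor
      · rintro ⟨v, hv, e⟩
        rw [← point_coe, point_eq_point_iff (hN₁ v hv.1.1).1 kx] at e
        rcases e with e | ⟨q', t', k1, k2, -⟩ | ⟨q', t', k1, k2, k3⟩
        · exact Or.inl (show x.1 ∈ N from e ▸ hv)
        · exact absurd (show v ∈ A from subset_closure ⟨((q' : Base), t'), ⟨k1, q'.2⟩, k2.symm⟩) hv.2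
        · have hm : 𝒮.slab (q', t') ∈ N := by
            have k3' : v = 𝒮.slab (q', t') := k3
            rwa [← k3']
          exact Or.inr ⟨⟨((q' : Base), t'), k1⟩, ⟨memV.2 hm, int hm⟩, k2.symm⟩
      · rintro (hx | ⟨⟨⟨b, t'⟩, k1⟩, ⟨hV, hb⟩, k2⟩)
        · exact ⟨x.1, hx, point_coe x⟩
        · have hb' := interior_subset hb
          have hm := (memV (q' := ⟨b, hb'⟩)).1 hV
          refine ⟨_, hm, ?_⟩
          rw [← point_coe]
          exact (point_eq_point_iff (hN₁ _ hm.1.1).1 kx).2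
            (Or.inr (Or.inr ⟨⟨b, hb'⟩, t', k1, k2.symm, rfl⟩))
    have qm : IsQuotientMap 𝒮.proj := isQuotientMap_quot_mk
    rw [← qm.isOpen_preimage, pre]
    exact (oN.union oα).preimage continuous_subtype_val

/-- On a leaf from an external entry point of radius in `(-1/20, 0)`, the first point `e` of the
trimmed plug is followed by a point near which all leaves stop: the first point of the slab. -/
theorem exists_interior_stoppedLeaves {p : Base} (hp : p ∉ insertionDomain)
    (h1 : -(1 / 20) < radius p) (h2 : radius p < 0) {c : ℝ → 𝒮.Cut}
    (hc : wilsonFoliation.IsPath (fun t => (c t).1) 0 1) (h0 : (c 0).1 = bottom p)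
    (hinf : (𝒮.transitionAhead (𝒮.proj (c 1))).Infinite) :
    ∃ a ∈ Icc (-1 : ℝ) 3, ∃ b ∈ Icc a 3, (∀ x ∈ Icc a b, 𝒮.Kept (rising p 3 x)) ∧
      𝒮.point (rising p 3 a) = 𝒮.proj (c 1) ∧
      𝒮.point (rising p 3 b) ∈ interior 𝒮.stoppedLeaves := by
  have hcl : Climbs (radius p) 3 := ⟨by norm_num, Or.inl h2.ne⟩
  have hg := rising_path hcl
  obtain ⟨a, ha, ea, ka⟩ : ∃ a ∈ Icc (-1 : ℝ) 3, rising p 3 a = (c 1).1 ∧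
      ∀ x ∈ Icc (-1 : ℝ) a, 𝒮.Kept (rising p 3 x) := by
    rcases wilson_det_forward hg hc ((rising_bottom hcl).trans h0.symm) with
      ⟨s, hs, es, im⟩ | ⟨s, hs, es, im⟩
    · refine ⟨s, hs, es, fun x hx => ?_⟩
      obtain ⟨t, -, et⟩ := im.subset (mem_image_of_mem _ hx)
      exact et ▸ (c t).2
    · rw [rising_top h2.ne] at es
      have := wilson_eq_of_top (wilson_sub hc hs.1 hs.2 le_rfl) es (right_mem_Icc.2 hs.2)
      refine ⟨3, by norm_num, by rw [rising_top h2.ne]; exact this.symm, fun x hx => ?_⟩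
      obtain ⟨t, -, et⟩ := im.symm.subset (mem_image_of_mem _ hx)
      exact et ▸ (c t).2
  have pa : 𝒮.point (rising p 3 a) = 𝒮.proj (c 1) := by rw [ea, point_coe]
  have hsub : Icc a 3 ⊆ Icc (-1) 3 := Icc_subset_Icc_left ha.1
  -- the leaf must meet the slab, since it does not end at the external exit point
  obtain ⟨b, ⟨hb, hbK⟩, hbmin⟩ : ∃ b, IsLeast {x ∈ Icc a 3 | rising p 3 x ∈ range 𝒮.slab} b := by
    refine IsCompact.exists_isLeast ?_ ?_
    · have cont := (wilson_continuousOn hg).mono hsub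
      exact isCompact_Icc.of_isClosed_subset
        (cont.preimage_isClosed_of_isClosed isClosed_Icc isClosed_range_slab) (sep_subset _ _)
    · by_contra hne
      have ha3 := ahead_of_path (𝒮 := 𝒮) (wilson_sub hg ha.1 ha.2 le_rfl) fun x hx =>
        kept_of_not_mem_range fun hr => hne ⟨x, hx, hr⟩
      rw [pa] at ha3
      refine infinite_transitionAhead ha3 hinf ((finite_singleton (𝒮.point (top p))).subset ?_)
      rintro z ⟨-, T, hT⟩
      rw [rising_top h2.ne] at hT
      exact subset_of_arc_top hT hp rfl (arcSystem_arc.right_mem hT)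
  obtain ⟨q, t, ht, eb⟩ := exists_slabAt_of_mem_range hbK
  obtain ⟨b', hb', eb', im⟩ := exists_entry_of_rising hcl (hsub hb) ht eb
  have kb : 𝒮.Kept (rising p 3 b) := by
    rcases le_total a b' with hab | hba
    · have : b ≤ b' := hbmin ⟨⟨hab, hb'.2.trans hb.2⟩, eb' ▸ ⟨(q, 0), 𝒮.slab_zero q⟩⟩
      rw [le_antisymm this hb'.2, eb']
      exact kept_sigma q
    · -- the leaf is in the slab already at height `a`
      have hm : rising p 3 a ∈ 𝒮.slabAt q '' Icc 0 t := im ▸ mem_image_of_mem _ ⟨hba, hb.1⟩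
      obtain ⟨s, -, es⟩ := hm
      have : b ≤ a := hbmin ⟨⟨le_rfl, ha.2⟩, es ▸ slabAt_mem_range q s⟩
      rw [le_antisymm this hb.1]
      exact ka a ⟨ha.1, le_rfl⟩
  have kall : ∀ x ∈ Icc a b, 𝒮.Kept (rising p 3 x) := fun x hx => by
    rcases hx.2.lt_or_eq with hlt | rfl
    · refine kept_of_not_mem_range fun hr => ?_
      exact absurd (hbmin ⟨⟨hx.1, hx.2.trans hb.2⟩, hr⟩) (not_le.2 hlt)
    · exact kb
  refine ⟨a, ha, b, hb, kall, pa, ?_⟩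
  have hq : (q : Base) ∈ interior insertionDomain := by
    refine mem_interior_insertionDomain q ?_
    rw [← eb', rising_radius]
    linarith
  have hbh := rising_height p 3 (hsub hb)
  have ev := eventually_mem_stoppedLeaves (𝒮 := 𝒮) (u := rising p 3 b) h1 h2 fun x hx => by
    rw [foot_rising p (hsub hb)]
    rw [hbh] at hx
    rcases le_total x a with h | h
    · exact ka x ⟨hx.1, h⟩
    · exact kall x ⟨h, hx.2⟩
  rw [eb] at ev ⊢
  exact point_mem_interior hq ev

end SelfInsertion

namespace SelfInsertion

variable {𝒮 : SelfInsertion} {P : Set 𝒮.Hat}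

/-! ### Stopped content -/

/-- The first point of the trimmed plug on the leaf of an external entry point belongs to the entry
region, and to the leaf. -/
theorem proj_mem_entryRegion (hb : (𝒮.tildeFoliation P).IsFlowBordism) {p : Base}
    (hp : p ∉ insertionDomain) {c : ℝ → 𝒮.Cut}
    (hc : wilsonFoliation.IsPath (fun t => (c t).1) 0 1) (h0 : (c 0).1 = bottom p)
    (h1 : 𝒮.proj (c 1) ∈ P)
    (hfirst : ∀ t ∈ Icc (0 : ℝ) 1, 𝒮.proj (c t) ∈ P → 𝒮.proj (c t) = 𝒮.proj (c 1)) :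
    (⟨𝒮.proj (c 1), h1⟩ : P) ∈ (𝒮.tildeFoliation P).entryRegion ∧
      𝒮.proj (c 1) ∈ 𝒮.hatFoliation.leaf (𝒮.hatBottom p) := by
  have arc := arc_of_cut hc
  have e0 : 𝒮.proj (c 0) = 𝒮.hatBottom p := by rw [← point_coe, h0, point_bottom]
  rw [e0] at arc
  refine ⟨mem_entryRegion hb hp (e := ⟨𝒮.proj (c 1), h1⟩) arc ?_,
    subset_leaf_of_arc arc (arcSystem_arc.right_mem arc)⟩
  rintro _ ⟨t, ht, rfl⟩ hw
  exact hfirst t ht hw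

/-- The external entry point at which the open set of stopped base points is found. -/
theorem exists_external_entry :
    ∃ p : Base, p ∉ insertionDomain ∧ -(1 / 20) < radius p ∧ radius p < 0 := by
  refine ⟨(⟨-(1 / 40), by norm_num, by norm_num⟩, ((5 : ℝ) : AddCircle (10 : ℝ))), ?_, ?_, ?_⟩
  · have ha := angle_mk ⟨-(1 / 40), by norm_num, by norm_num⟩ (x := 5) (by norm_num)
    rintro (h | h)
    · have := h.2.1
      rw [ha] at this
      norm_num at this
    · have := h.2.1
      rw [ha] at this
      norm_num at this
  · norm_num [radius]
  · norm_num [radius]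

end SelfInsertion

end AnalyticPlug

end

theorem proposition6p5 (𝒮 : SelfInsertion) (P : Set 𝒮.Hat) (hP : 𝒮.IsTrimming P)
    (hbord : (𝒮.tildeFoliation P).IsFlowBordism)
    {B : Type*} [TopologicalSpace B] (M : (𝒮.tildeFoliation P).MatchedEnds B) :
    (∀ (p : Base) (x : B), -(1 / 20) < radius p → radius p < 0 →
      (M.entry x : 𝒮.Hat) ∈ 𝒮.hatFoliation.leaf (𝒮.hatBottom p) → x ∈ M.stoppedSet) ∧
    (∀ p : Base, p ∉ insertionDomain → -(1 / 20) < radius p → radius p < 0 →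
      ∃ x ∈ M.stoppedSet, (M.entry x : 𝒮.Hat) ∈ 𝒮.hatFoliation.leaf (𝒮.hatBottom p)) ∧
    M.StopsContent := by
  have := hbord.hausdorff
  have mem_stopped : ∀ (p : Base) (x : B), -(1 / 20) < radius p → radius p < 0 →
      (M.entry x : 𝒮.Hat) ∈ 𝒮.hatFoliation.leaf (𝒮.hatBottom p) → x ∈ M.stoppedSet :=
    fun p x h1 h2 hx => SelfInsertion.infiniteLeaf_of_infinite_transitionAhead hP
      (SelfInsertion.infinite_transitionAhead_of_mem_leaf h1 h2 hx)
  refine ⟨mem_stopped, fun p hp h1 h2 => ?_, ?_⟩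
  · obtain ⟨c, hc, h0, hcP, hfirst⟩ := SelfInsertion.exists_first_point hP hp
    obtain ⟨he, hl⟩ := SelfInsertion.proj_mem_entryRegion hbord hp hc h0 hcP hfirst
    rw [← M.range_entry] at he
    obtain ⟨x, hx⟩ := he
    have hl' : (M.entry x : 𝒮.Hat) ∈ 𝒮.hatFoliation.leaf (𝒮.hatBottom p) := by rw [hx]; exact hl
    exact ⟨x, mem_stopped p x h1 h2 hl', hl'⟩
  · obtain ⟨p, hp, h1, h2⟩ := SelfInsertion.exists_external_entry
    obtain ⟨c, hc, h0, hcP, hfirst⟩ := SelfInsertion.exists_first_point hP hp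
    obtain ⟨he, hl⟩ := SelfInsertion.proj_mem_entryRegion hbord hp hc h0 hcP hfirst
    rw [← M.range_entry] at he
    obtain ⟨x, hx⟩ := he
    have hinf := SelfInsertion.infinite_transitionAhead_of_mem_leaf h1 h2 hl
    obtain ⟨a, ha, b, hb, kept, ea, hint⟩ :=
      SelfInsertion.exists_interior_stoppedLeaves hp h1 h2 hc h0 hinf
    have hcl : Climbs (radius p) 3 := ⟨by norm_num, Or.inl h2.ne⟩
    -- the leaf path from the entry point to the neighborhood in which all leaves stop
    have sub : ∀ s t, a ≤ s → s ≤ t → t ≤ b → wilsonFoliation.IsPath (rising p 3) s t :=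
      fun s t hs hst ht => wilson_sub (rising_path hcl) (ha.1.trans hs) hst (ht.trans hb.2)
    have inP : ∀ t ∈ Icc a b, 𝒮.point (rising p 3 t) ∈ P := fun t ht => by
      have ahead := SelfInsertion.ahead_of_path (sub a t le_rfl ht.1 ht.2)
        fun y hy => kept y ⟨hy.1, hy.2.trans ht.2⟩
      rw [ea] at ahead
      exact SelfInsertion.mem_of_infinite_transitionAhead hP hcP ahead
        (SelfInsertion.infinite_transitionAhead ahead hinf)
    set γ : ℝ → P := fun t => ⟨𝒮.point (rising p 3 (projIcc a b hb.1 t)),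
      inP _ (projIcc a b hb.1 t).2⟩ with hγ
    have γeq : ∀ t (ht : t ∈ Icc a b), γ t = ⟨𝒮.point (rising p 3 t), inP t ht⟩ := fun t ht => by
      simp only [hγ, projIcc_of_mem hb.1 ht]
    have path : ∀ s t, a ≤ s → s ≤ t → t ≤ b → (𝒮.tildeFoliation P).IsPath γ s t := by
      intro s t hs hst ht
      refine SelfInsertion.hatPath_of_path (γ := fun t => rising p 3 (projIcc a b hb.1 t))
        (wilson_congr (sub s t hs hst ht) fun y hy => ?_)
        fun y _ => kept _ (projIcc a b hb.1 y).2
      simp only [projIcc_of_mem hb.1 ⟨hs.trans hy.1, hy.2.trans ht⟩]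
    have cont : ContinuousOn γ (Icc a b) := Topology.IsInducing.subtypeVal.continuousOn_iff.2
      (SelfInsertion.hatPath_continuousOn (path a b le_rfl hb.1 le_rfl))
    have key := LeafPaths.mem_interior_of_path hbord.exists_chart
      (C := {y : P | (y : 𝒮.Hat) ∈ 𝒮.stoppedLeaves}) (by
        rintro δ s₀ t₀ hδ s hs t ht ⟨p', k1, k2, k3⟩
        refine ⟨p', k1, k2, ?_⟩
        rw [← LeafPaths.leaf_eq k3]
        exact LeafPaths.mem_leaf_of_path (𝓕 := 𝒮.hatFoliation) hδ hs ht) hb.1 cont path (by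
        rw [γeq b (right_mem_Icc.2 hb.1)]
        exact preimage_interior_subset_interior_preimage continuous_subtype_val hint)
    have γa : γ a = M.entry x := by
      rw [γeq a (left_mem_Icc.2 hb.1), hx]
      exact Subtype.ext ea
    rw [γa, mem_interior_iff_mem_nhds] at key
    refine ⟨x, mem_interior_iff_mem_nhds.2 ?_⟩
    filter_upwards [M.entry_isEmbedding.continuous.continuousAt key] with y hy
    obtain ⟨p', k1, k2, k3⟩ := hy
    exact mem_stopped p' y k1 k2 k3
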